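/- Call a prime $p$ a *Fermat prime* (in this statement) if it is a sum of two positive squares, i.e. $p = 2$ or $p \equiv 1 \pmod 4$. Every such prime has exactly one representation $p = r^2 + s^2$ with $r, s$ positive integers and $r$ odd; the Jacobi symbol $\sigma_p = \left(\frac{s}{r}\right) \in \{1, -1\}$ is called the spin of $p$. Then there is an absolute constant $C$ (which can be taken to be a natural number) such that for all real $x \ge 1$ $$\Bigl|\ \sum_{\substack{r, s \ge 1,\ r \text{ odd} \\ r^2 + s^2 = p \le x,\ p \text{ prime}}} \left(\frac{s}{r}\right)\Bigr| \le C\, x^{76/77}.$$ Moreover the positive and the negative spins are equidistributed: as $x \to \infty$, the proportion of the Fermat primes $p \le x$ with $\sigma_p = 1$ tends to $\frac12$, and so does the proportion of those with $\sigma_p = -1$. -/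

import Mathlib

/-- `n = r² + s²` with `r`, `s` positive integers and `r` odd. -/
def IsOddSumOfSquares (n r s : ℕ) : Prop :=
  0 < r ∧ 0 < s ∧ Odd r ∧ r ^ 2 + s ^ 2 = n

/-- A prime which is the sum of two positive squares. -/
def IsFermatPrime (p : ℕ) : Prop :=
  p.Prime ∧ ∃ r s : ℕ, 0 < r ∧ 0 < s ∧ r ^ 2 + s ^ 2 = p

/-- `p` is a prime `r² + s²` (`r`, `s` positive, `r` odd) whose spin, the Jacobi symbol `(s / r)`,
equals `ε`. -/
def HasSpin (p : ℕ) (ε : ℤ) : Prop :=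
  p.Prime ∧ ∃ r s : ℕ, IsOddSumOfSquares p r s ∧ jacobiSym (s : ℤ) r = ε

open Classical in
/-- The pairs `(r, s)` of positive integers with `r` odd for which `r² + s²` is a prime `≤ x`.
(The box contains all of them, since `r, s ≤ r² + s² ≤ x`.) -/
noncomputable def spinPairs (x : ℝ) : Finset (ℕ × ℕ) :=
  (Finset.Icc 1 ⌊x⌋₊ ×ˢ Finset.Icc 1 ⌊x⌋₊).filter fun rs =>
    Odd rs.1 ∧ (rs.1 ^ 2 + rs.2 ^ 2).Prime ∧ ((rs.1 ^ 2 + rs.2 ^ 2 : ℕ) : ℝ) ≤ x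

/-- The sum of the Jacobi symbols `(s / r)` over positive integers `r`, `s` with `r` odd and
`r² + s² = p ≤ x`, `p` prime. -/
noncomputable def spinSum (x : ℝ) : ℤ :=
  ∑ rs ∈ spinPairs x, jacobiSym (rs.2 : ℤ) rs.1

open Classical in
/-- The number of primes `p ≤ x` which are sums of two positive squares. -/
noncomputable def fermatPrimeCount (x : ℝ) : ℕ :=
  ((Finset.Icc 1 ⌊x⌋₊).filter fun p => IsFermatPrime p).card

open Classical in
/-- The number of primes `p ≤ x` of spin `ε`. -/
noncomputable def spinCount (ε : ℤ) (x : ℝ) : ℕ :=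
  ((Finset.Icc 1 ⌊x⌋₊).filter fun p => HasSpin p ε).card

/-! Apart from `p = 2`, a prime `r² + s²` with `r` odd and `r, s > 0` has `s` even. It is then the
norm of exactly one primary Gaussian integer `z = ±r + i s` in the upper half plane, and the spin
does not see the sign of the real part. So the sum in question is, up to one term, the sum over
primes `n` of `spinCoeff n`, the total spin of the primary elements of norm `n` with positive
imaginary part (`abs_spinSum_le`). Such a sum is attacked by Vaughan's identity, which asks for two
estimates: for sums over the multiples of a fixed `w` of small norm (type I), and for bilinear sums
over products `w z` with arbitrary bounded coefficients (type II).

Type II. The spin is not multiplicative, but `spin_mul` says that `spin (w z)` is `spin w * spin z *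
quadSym w z` up to a sign coming from the real place. The factors `spin w` and `spin z` disappear
into the coefficients, and what is left is the kernel `quadSym w z`. For primitive `w` it is a real
character in `z`, and on primitive primary elements it is symmetric, so either variable may serve as
modulus. Hölder's inequality of exponent `k` followed by Cauchy's (`abs_bilin_pow_le`) replaces `z`
by a product of `k` such variables, which runs over a box long enough for the moduli. Correlations
of two characters over a box are small unless the product of the norms is a square, and such pairs
are rare by the divisor bound. Taking `k = 1`, `2` or `5` according to the size of the shorter
variable saves a power of `x` as soon as both variables exceed `x ^ (3 / 100)`.

Type I. For fixed `w` the same rule leaves the symbol `(s / r)` of rational integers, twisted by a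
function of period `N(w)`. Here `r` and `s` themselves are the two variables of a bilinear form, and
the same method with `k = 3` applies (`exists_bilinBound_jacobiSym`).

The signs, the half plane and the size of the norm are all order relations between functions of the
two variables. `BilinBound.mul_ite_lt` removes such a condition from any bilinear form at the cost
of a logarithm, so that no smoothing is needed.

With the cut of Vaughan's identity at `N ^ (3 / 100)` all pieces are `O(N ^ (1 - 27 / 2000))`, and
`1 - 27 / 2000 < 76 / 77`. Equidistribution needs in addition that Fermat primes be more numerous
than this bound. It suffices to have `x ^ (988 / 1000)` of them up to a constant, which follows from
Mertens' theorem in the class `1` modulo `4`, that is, from an explicit positive lower bound for the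
partial sums of `L(1, χ₄)`. -/

/-! ### Primary Gaussian integers, their spin, and the quadratic symbol -/

namespace GaussianSpin

/-- Gaussian integers congruent to `1` modulo `(1 + i) ^ 3`. -/
def IsPrimary (z : GaussianInt) : Prop := z.im % 2 = 0 ∧ (z.re + z.im) % 4 = 1

/-- The spin of a Gaussian integer with odd real part. -/
def spin (z : GaussianInt) : ℤ := jacobiSym z.im z.re.natAbs

/-- The quadratic symbol attached to a modulus `w`. -/
def quadSym (w z : GaussianInt) : ℤ := jacobiSym (w * z).re w.norm.natAbs

/-- The Hilbert symbol at the real place. -/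
def infHilbert (a b : ℤ) : ℤ := if a < 0 ∧ b < 0 then -1 else 1

/-- The sign in the multiplication rule of the spin. -/
def spinSign (w z : GaussianInt) : ℤ :=
  infHilbert w.im w.re * infHilbert (z.re * w.im) (w * z).re * infHilbert (z.re * w.im) z.re

instance : DecidablePred IsPrimary := fun _ => inferInstanceAs (Decidable (_ ∧ _))

theorem IsPrimary.odd_re {z : GaussianInt} (hz : IsPrimary z) : z.re % 2 = 1 := by
  obtain ⟨h1, h2⟩ := hz; omega

theorem IsPrimary.re_ne_zero {z : GaussianInt} (hz : IsPrimary z) : z.re ≠ 0 := by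
  have := hz.odd_re; omega

theorem re_mul (w z : GaussianInt) : (w * z).re = w.re * z.re - w.im * z.im := by
  rw [Zsqrtd.re_mul]; ring

theorem im_mul (w z : GaussianInt) : (w * z).im = w.re * z.im + w.im * z.re := by
  rw [Zsqrtd.im_mul]

theorem norm_eq (z : GaussianInt) : z.norm = z.re ^ 2 + z.im ^ 2 := by
  rw [Zsqrtd.norm_def]; ring

theorem IsPrimary.mul {w z : GaussianInt} (hw : IsPrimary w) (hz : IsPrimary z) :
    IsPrimary (w * z) := by
  have hw' := hw.odd_re
  have hz' := hz.odd_re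
  obtain ⟨u, v⟩ := w
  obtain ⟨r, s⟩ := z
  simp only [IsPrimary, re_mul, im_mul] at *
  obtain ⟨k, rfl⟩ : ∃ k, v = 2 * k := ⟨v / 2, by omega⟩
  obtain ⟨l, rfl⟩ : ∃ l, s = 2 * l := ⟨s / 2, by omega⟩
  obtain ⟨a, rfl⟩ : ∃ a, u = 1 - 2 * k + 4 * a := ⟨(u - 1 + 2 * k) / 4, by omega⟩
  obtain ⟨b, rfl⟩ : ∃ b, r = 1 - 2 * l + 4 * b := ⟨(r - 1 + 2 * l) / 4, by omega⟩
  constructor <;> ring_nf <;> omega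

theorem IsPrimary.of_mul {w z : GaussianInt} (hw : IsPrimary w) (h : IsPrimary (w * z)) :
    IsPrimary z := by
  have hw' := hw.odd_re
  obtain ⟨u, v⟩ := w
  obtain ⟨r, s⟩ := z
  simp only [IsPrimary, re_mul, im_mul] at *
  obtain ⟨k, rfl⟩ : ∃ k, v = 2 * k := ⟨v / 2, by omega⟩
  obtain ⟨a, rfl⟩ : ∃ a, u = 1 - 2 * k + 4 * a := ⟨(u - 1 + 2 * k) / 4, by omega⟩
  obtain ⟨h1, h2⟩ := h
  have h3 : s % 2 = 0 := by
    ring_nf at h1; omega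
  obtain ⟨l, rfl⟩ : ∃ l, s = 2 * l := ⟨s / 2, by omega⟩
  refine ⟨h3, ?_⟩
  ring_nf at h2 ⊢
  omega

theorem IsPrimary.norm_mod_four {z : GaussianInt} (hz : IsPrimary z) : z.norm % 4 = 1 := by
  have h1 := hz.odd_re
  obtain ⟨h2, -⟩ := hz
  rw [norm_eq]
  obtain ⟨k, hk⟩ : ∃ k, z.im = 2 * k := ⟨z.im / 2, by omega⟩
  obtain ⟨l, hl⟩ : ∃ l, z.re = 2 * l + 1 := ⟨z.re / 2, by omega⟩
  rw [hk, hl]; ring_nf; omega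

theorem natAbs_mod_four_of_nonneg {a : ℤ} (h : a % 4 = 1) (h0 : 0 ≤ a) : a.natAbs % 4 = 1 := by
  omega

theorem IsPrimary.natAbs_norm_mod_four {z : GaussianInt} (hz : IsPrimary z) :
    z.norm.natAbs % 4 = 1 :=
  natAbs_mod_four_of_nonneg hz.norm_mod_four (GaussianInt.norm_nonneg z)

theorem IsPrimary.norm_pos {z : GaussianInt} (hz : IsPrimary z) : 0 < z.norm := by
  have := hz.norm_mod_four
  have := GaussianInt.norm_nonneg z
  omega

theorem IsPrimary.ne_zero {z : GaussianInt} (hz : IsPrimary z) : z ≠ 0 :=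
  GaussianInt.norm_pos.1 hz.norm_pos

/-- Quadratic reciprocity with signs. -/
theorem jacobiSym_natAbs_comm {a b : ℤ} (ha : a % 4 = 1) (hb : b % 2 = 1) :
    jacobiSym a b.natAbs = infHilbert a b * jacobiSym b a.natAbs := by
  have hbo : Odd b.natAbs := Nat.odd_iff.2 (by omega)
  have hao : Odd a.natAbs := Nat.odd_iff.2 (by omega)
  have hb2 : b.natAbs % 2 = 1 := Nat.odd_iff.1 hbo
  have ha2 : a.natAbs % 2 = 1 := Nat.odd_iff.1 hao
  unfold infHilbert
  -- As `a ≡ 1 (mod 4)`, no sign is left at two: for negative `a`, `|a| ≡ 3 (mod 4)`, and the signs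
  -- of `(-1 / |b|)` and of reciprocity cancel. Only the case of two negative arguments changes
  -- sign.
  rcases le_or_gt 0 a with h0 | h0
  · have h4 : a.natAbs % 4 = 1 := by omega
    have e : (a.natAbs : ℤ) = a := by omega
    have h1 : jacobiSym a b.natAbs = jacobiSym b.natAbs a.natAbs := by
      conv_lhs => rw [← e]
      exact jacobiSym.quadratic_reciprocity_one_mod_four h4 hbo
    rw [if_neg (by omega), one_mul, h1]
    rcases le_or_gt 0 b with h | h
    · rw [show (b.natAbs : ℤ) = b by omega]
    · rw [show (b.natAbs : ℤ) = -b by omega, jacobiSym.neg _ hao, ZMod.χ₄_nat_one_mod_four h4,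
        one_mul]
  · have h4 : a.natAbs % 4 = 3 := by omega
    have e : a = -(a.natAbs : ℤ) := by omega
    have h1 : jacobiSym a b.natAbs = jacobiSym b.natAbs a.natAbs := by
      conv_lhs => rw [e]
      rw [jacobiSym.neg _ hbo]
      rcases Nat.odd_mod_four_iff.1 hb2 with h | h
      · rw [ZMod.χ₄_nat_one_mod_four h, one_mul]
        exact jacobiSym.quadratic_reciprocity_one_mod_four' hao h
      · rw [ZMod.χ₄_nat_three_mod_four h, jacobiSym.quadratic_reciprocity_three_mod_four h4 h]
        ring
    rw [h1]
    rcases le_or_gt 0 b with h | h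
    · rw [if_neg (by omega), one_mul, show (b.natAbs : ℤ) = b by omega]
    · rw [if_pos ⟨h0, h⟩, show (b.natAbs : ℤ) = -b by omega, jacobiSym.neg _ hao,
        ZMod.χ₄_nat_three_mod_four h4]

theorem infHilbert_of_pos {a : ℤ} (h : 0 < a) (b : ℤ) : infHilbert a b = 1 :=
  if_neg (by omega)

theorem infHilbert_congr {a a' : ℤ} (h : a < 0 ↔ a' < 0) (b : ℤ) :
    infHilbert a b = infHilbert a' b := by
  simp [infHilbert, h]

theorem jacobiSym_congr {a b : ℤ} {n : ℕ} (h : (n : ℤ) ∣ a - b) :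
    jacobiSym a n = jacobiSym b n :=
  jacobiSym.mod_left' (Int.modEq_iff_dvd.2 h).symm

theorem jacobiSym_natAbs_congr {a b c : ℤ} (h : c ∣ a - b) :
    jacobiSym a c.natAbs = jacobiSym b c.natAbs :=
  jacobiSym_congr (by simpa using h)

theorem mul_self_jacobiSym {a : ℤ} {n : ℕ} (h : a.gcd n = 1) :
    jacobiSym a n * jacobiSym a n = 1 := by
  rw [← sq, jacobiSym.sq_one h]

theorem spin_eq_zero_of_not_isCoprime {z : GaussianInt} (h0 : z.re ≠ 0)
    (h : ¬ IsCoprime z.re z.im) : spin z = 0 := by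
  unfold spin
  rw [jacobiSym.eq_zero_iff]
  refine ⟨by omega, fun hg => h ?_⟩
  rw [Int.isCoprime_iff_gcd_eq_one, Int.gcd_comm]
  rwa [Int.gcd, Int.natAbs_natCast] at hg

theorem isCoprime_of_mul_left {w z : GaussianInt} (h : IsCoprime (w * z).re (w * z).im) :
    IsCoprime w.re w.im := by
  obtain ⟨a, b, h⟩ := h
  refine ⟨a * z.re + b * z.im, -a * z.im + b * z.re, ?_⟩
  rw [re_mul, im_mul] at h
  linear_combination h

theorem isCoprime_of_mul_right {w z : GaussianInt} (h : IsCoprime (w * z).re (w * z).im) :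
    IsCoprime z.re z.im :=
  isCoprime_of_mul_left (w := z) (z := w) (by rwa [mul_comm])

/-- The norm of a primary modulus can be flipped with the real part. -/
theorem IsPrimary.quadSym_eq {w z : GaussianInt} (hw : IsPrimary w) (h : (w * z).re % 2 = 1) :
    quadSym w z = jacobiSym w.norm (w * z).re.natAbs := by
  have := jacobiSym_natAbs_comm hw.norm_mod_four h
  rw [infHilbert_of_pos hw.norm_pos, one_mul] at this
  rw [this, quadSym]

/-- Auxiliary prime: a large prime `p = u + y v` with `y ≡ 1 (mod 4)`. -/
theorem exists_prime_eq_add_mul {u v : ℤ} (hv : v ≠ 0) (h2 : v % 2 = 0) (h4 : (u + v) % 4 = 1)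
    (huv : IsCoprime u v) (n : ℕ) :
    ∃ (p : ℕ) (y : ℤ), n < p ∧ p.Prime ∧ y % 4 = 1 ∧ (p : ℤ) = u + y * v := by
  -- A prime in the class of `u + v` modulo `4 v` has the form `u + (1 + 4 k) v`, which gives `y = 1
  -- + 4 k`.
  have hc : IsCoprime (u + v) ((4 * v.natAbs : ℕ) : ℤ) := by
    have h1 : IsCoprime (u + v) v := by
      obtain ⟨a, b, h⟩ := huv
      exact ⟨a, b - a, by rw [← h]; ring⟩
    have h3 : IsCoprime (u + v) 4 := by
      refine ⟨1, -((u + v) / 4), ?_⟩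
      have := Int.emod_add_mul_ediv (u + v) 4
      linarith
    have := h3.mul_right h1
    rcases le_or_gt 0 v with h | h
    · rwa [show ((4 * v.natAbs : ℕ) : ℤ) = 4 * v by omega]
    · rw [show ((4 * v.natAbs : ℕ) : ℤ) = -(4 * v) by omega]
      exact this.neg_right
  obtain ⟨p, hp, hpp, hmod⟩ := Nat.forall_exists_prime_gt_and_zmodEq n (by omega) hc
  have hd : 4 * v ∣ (p : ℤ) - (u + v) := by
    have := (Int.modEq_iff_dvd.1 hmod.symm)
    have h5 : 4 * v ∣ ((4 * v.natAbs : ℕ) : ℤ) := by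
      rw [← Int.natAbs_dvd_natAbs, Int.natAbs_natCast, Int.natAbs_mul]; rfl
    exact h5.trans this
  obtain ⟨k, hk⟩ := hd
  exact ⟨p, 1 + 4 * k, hp, hpp, by omega, by linear_combination hk⟩

theorem gcd_eq_one_of_prime_of_natAbs_lt {p : ℕ} (hp : p.Prime) {a : ℤ} (h0 : a ≠ 0)
    (h : a.natAbs < p) : a.gcd p = 1 := by
  rw [Int.gcd, Int.natAbs_natCast, Nat.gcd_comm]
  exact (Nat.Prime.coprime_iff_not_dvd hp).2 fun hd =>
    absurd (Nat.le_of_dvd (by omega) hd) (by omega)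

/-- The symbol computation behind the multiplication rule, with an auxiliary prime `p`. -/
theorem jacobiSym_mul_rule {u v r s y S A B : ℤ} {p : ℕ} (hu2 : u % 2 = 1) (hr2 : r % 2 = 1)
    (hy4 : y % 4 = 1) (hS4 : S % 4 = 1) (hp4 : (p : ℤ) % 4 = 1) (hAodd : A % 2 = 1)
    (hpy : (p : ℤ) = u + y * v) (hS : S = s + y * r) (hA : A = u * r - v * s)
    (hB : B = u * s + v * r) (hpA : A.gcd p = 1) (hSp : S.gcd p = 1) (hpy1 : y.gcd p = 1) :
    jacobiSym B A.natAbs = infHilbert y u * infHilbert S A * infHilbert S r *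
      jacobiSym v u.natAbs * jacobiSym s r.natAbs * jacobiSym (u ^ 2 + v ^ 2) A.natAbs := by
  have hp4' : p % 4 = 1 := by omega
  have hp_pos : (0 : ℤ) < p := by omega
  have hflip : ∀ b : ℤ, b % 2 = 1 → jacobiSym p b.natAbs = jacobiSym b p := by
    intro b hb
    have := jacobiSym_natAbs_comm hp4 hb
    rwa [infHilbert_of_pos hp_pos, one_mul, Int.natAbs_natCast] at this
  have hneg : ∀ b : ℤ, jacobiSym (-b) p = jacobiSym b p := by
    intro b
    rw [jacobiSym.neg _ (Nat.odd_iff.2 (by omega)), ZMod.χ₄_nat_one_mod_four hp4', one_mul]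
  -- This identity gives `A ≡ -S v` modulo `p` and `A ≡ r p` modulo `S`; moreover `p B ≡ (u² + v²)
  -- S` modulo `A`, `S ≡ s` modulo `r`, and `y v ≡ -u` modulo `p`. Reciprocity, clean since `p`, `S`
  -- and `y` are `1` modulo `4`, links these congruences; all symbols modulo `p` cancel at the end.
  have hAeq : A = r * p - S * v := by rw [hA, hpy, hS]; ring
  have e1 : jacobiSym p A.natAbs * jacobiSym B A.natAbs =
      jacobiSym (u ^ 2 + v ^ 2) A.natAbs * jacobiSym S A.natAbs := by
    rw [← jacobiSym.mul_left, ← jacobiSym.mul_left]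
    exact jacobiSym_natAbs_congr ⟨v - y * u, by rw [hpy, hB, hS, hA]; ring⟩
  have e2 : jacobiSym p A.natAbs = jacobiSym S p * jacobiSym v p := by
    rw [hflip A hAodd, ← jacobiSym.mul_left, ← hneg (S * v)]
    exact jacobiSym_congr ⟨r, by rw [hAeq]; ring⟩
  have e3 : jacobiSym S A.natAbs = infHilbert S A * (jacobiSym r S.natAbs * jacobiSym S p) := by
    rw [jacobiSym_natAbs_comm hS4 hAodd, ← hflip S (by omega), ← jacobiSym.mul_left]
    congr 1
    exact jacobiSym_natAbs_congr ⟨-v, by rw [hAeq]; ring⟩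
  have e4 : jacobiSym s r.natAbs = infHilbert S r * jacobiSym r S.natAbs := by
    rw [← jacobiSym_natAbs_comm hS4 hr2]
    exact jacobiSym_natAbs_congr ⟨-y, by rw [hS]; ring⟩
  have e5 : jacobiSym v p * jacobiSym y p = jacobiSym y u.natAbs * jacobiSym v u.natAbs := by
    rw [← jacobiSym.mul_left, ← jacobiSym.mul_left]
    have h1 : jacobiSym (v * y) p = jacobiSym u p := by
      rw [← hneg u]
      exact jacobiSym_congr ⟨1, by rw [hpy]; ring⟩
    rw [h1, ← hflip u hu2]
    exact jacobiSym_natAbs_congr ⟨1, by rw [hpy]; ring⟩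
  have e6 : jacobiSym y u.natAbs = infHilbert y u * jacobiSym y p := by
    rw [jacobiSym_natAbs_comm hy4 hu2, ← hflip y (by omega)]
    congr 1
    exact jacobiSym_natAbs_congr ⟨-v, by rw [hpy]; ring⟩
  have s1 := mul_self_jacobiSym hpA
  rw [← hflip A hAodd] at s1
  have s2 := mul_self_jacobiSym hSp
  have s3 := mul_self_jacobiSym hpy1
  have s4 : infHilbert S r * infHilbert S r = 1 := by unfold infHilbert; split_ifs <;> norm_num
  have hvp : jacobiSym v p = infHilbert y u * jacobiSym v u.natAbs := by
    linear_combination jacobiSym y p * e5 - jacobiSym v p * s3 +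
      jacobiSym y p * jacobiSym v u.natAbs * e6 + infHilbert y u * jacobiSym v u.natAbs * s3
  have hB' : jacobiSym B A.natAbs =
      jacobiSym v p * (jacobiSym (u ^ 2 + v ^ 2) A.natAbs * infHilbert S A) *
        jacobiSym r S.natAbs := by
    have : jacobiSym B A.natAbs =
      jacobiSym p A.natAbs * (jacobiSym (u ^ 2 + v ^ 2) A.natAbs * jacobiSym S A.natAbs) := by
      rw [← e1]; linear_combination -jacobiSym B A.natAbs * s1
    rw [this, e2, e3]
    linear_combination jacobiSym v p * (jacobiSym (u ^ 2 + v ^ 2) A.natAbs * infHilbert S A) *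
        jacobiSym r S.natAbs * s2
  rw [hB', e4, hvp]
  linear_combination -(infHilbert y u * jacobiSym v u.natAbs *
    jacobiSym (u ^ 2 + v ^ 2) A.natAbs * infHilbert S A * jacobiSym r S.natAbs) * s4

/-- For `|y| > |s|` the term `y * r` dominates. The sign of the auxiliary number `S` is then that of
`r * v`, so that the sign in the multiplication rule no longer depends on the auxiliary prime. -/
theorem add_mul_neg_iff {y v r s : ℤ} (hr0 : r ≠ 0) (hv0 : v ≠ 0) (hyv : y < 0 ↔ v < 0)
    (hys : |s| < |y|) : s + y * r < 0 ↔ r * v < 0 := by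
  have h1 : s + y * r < 0 ↔ y * r < 0 := by
    have h3 : |s| < |y * r| := by
      rw [abs_mul]
      exact hys.trans_le (le_mul_of_one_le_right (abs_nonneg y) (Int.one_le_abs hr0))
    generalize y * r = t at *
    rw [Int.abs_eq_natAbs, Int.abs_eq_natAbs] at h3
    omega
  have hy0 : y ≠ 0 := by
    rintro rfl
    rw [abs_zero] at hys
    exact absurd (abs_nonneg s) (by omega)
  rw [h1, mul_neg_iff, mul_neg_iff]
  omega

theorem neg_iff_neg_of_mul_pos {y v : ℤ} (h : 0 < y * v) : y < 0 ↔ v < 0 := by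
  rw [mul_pos_iff] at h
  omega

theorem spin_mul_of_isCoprime {w z : GaussianInt} (hw : IsPrimary w) (hz : IsPrimary z)
    (hc : IsCoprime w.re w.im) (hv0 : w.im ≠ 0) :
    spin (w * z) = spinSign w z * spin w * spin z * quadSym w z := by
  have hAodd : (w * z).re % 2 = 1 := (hw.mul hz).odd_re
  rw [hw.quadSym_eq hAodd]
  have hu2 := hw.odd_re
  have hr2 := hz.odd_re
  have hr0 := hz.re_ne_zero
  unfold spin spinSign
  rw [norm_eq]
  obtain ⟨h2, h4⟩ := hw
  obtain ⟨hs2, hs4⟩ := hz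
  have hA := re_mul w z
  have hB := im_mul w z
  generalize (w * z).re = A at *
  generalize (w * z).im = B at *
  generalize w.re = u at *
  generalize w.im = v at *
  generalize z.re = r at *
  generalize z.im = s at *
  -- The lower bound on `p` serves three purposes: `p > |A|` prevents `p` from dividing `A`, `p >
  -- |u|` makes `y v = p - u` positive, and `p > |u| + |s| |v|` forces `|y| > |s|`.
  obtain ⟨p, y, hpn, hp, hy4, hpy⟩ := exists_prime_eq_add_mul hv0 h2 h4 hc
    (A.natAbs + u.natAbs + s.natAbs * v.natAbs)
  have hA0 : A ≠ 0 := by omega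
  have hyv : y * v = p - u := by linarith
  have hyv_pos : 0 < y * v := by
    have : 0 ≤ s.natAbs * v.natAbs := Nat.zero_le _
    omega
  have hyv_sign : y < 0 ↔ v < 0 := neg_iff_neg_of_mul_pos hyv_pos
  have hy0 : y ≠ 0 := by omega
  have hys : |s| < |y| := by
    have h1 : |s| * |v| < |y| * |v| := by
      have e : ((s.natAbs * v.natAbs : ℕ) : ℤ) = |s| * |v| := by simp
      rw [← abs_mul y v, abs_of_pos hyv_pos, hyv, ← e]
      omega
    exact lt_of_mul_lt_mul_right h1 (abs_nonneg v)
  obtain ⟨S, hS⟩ : ∃ S, S = s + y * r := ⟨_, rfl⟩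
  have hS4 : S % 4 = 1 := by
    obtain ⟨k, hk⟩ : ∃ k, y = 1 + 4 * k := ⟨y / 4, by omega⟩
    have : S = s + r + 4 * (k * r) := by rw [hS, hk]; ring
    omega
  have hS_sign : S < 0 ↔ r * v < 0 := by
    rw [hS]; exact add_mul_neg_iff hr0 hv0 hyv_sign hys
  have hp4 : (p : ℤ) % 4 = 1 := by
    obtain ⟨k, hk⟩ : ∃ k, y = 1 + 4 * k := ⟨y / 4, by omega⟩
    have : (p : ℤ) = u + v + 4 * (k * v) := by rw [hpy, hk]; ring
    omega
  have hpA : A.gcd p = 1 := gcd_eq_one_of_prime_of_natAbs_lt hp hA0 (by omega)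
  have hpy1 : y.gcd p = 1 := by
    refine gcd_eq_one_of_prime_of_natAbs_lt hp hy0 ?_
    -- Since `v` is even and nonzero, `2 |y| ≤ |y v| = p - u < 2 p`.
    have h1 : 2 * |y| ≤ |y| * |v| := by
      have : 2 ≤ |v| := by rw [Int.abs_eq_natAbs]; omega
      nlinarith [abs_nonneg y]
    rw [← abs_mul, abs_of_pos hyv_pos, hyv] at h1
    rw [Int.abs_eq_natAbs] at h1
    have : 0 ≤ s.natAbs * v.natAbs := Nat.zero_le _
    omega
  have hAeq : A = r * p - S * v := by rw [hA, hpy, hS]; ring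
  have hSp : S.gcd p = 1 := by
    by_contra hne
    have hd : (p : ℤ) ∣ S := by
      rw [Int.gcd, Int.natAbs_natCast] at hne
      have := (Nat.Prime.coprime_iff_not_dvd hp).not.1 (fun h => hne (Nat.Coprime.symm h))
      rw [not_not] at this
      exact Int.natCast_dvd.2 this
    have hdA : (p : ℤ) ∣ A := by
      rw [hAeq]; exact dvd_sub (dvd_mul_left _ _) (hd.mul_right _)
    have := Nat.le_of_dvd (by omega) (Int.natCast_dvd.1 hdA)
    omega
  rw [← infHilbert_congr hyv_sign u, ← infHilbert_congr hS_sign A, ← infHilbert_congr hS_sign r]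
  exact jacobiSym_mul_rule hu2 hr2 hy4 hS4 hp4 hAodd hpy hS hA hB hpA hSp hpy1

/-- The multiplication rule of the spin. -/
theorem spin_mul {w z : GaussianInt} (hw : IsPrimary w) (hz : IsPrimary z) :
    spin (w * z) = spinSign w z * spin w * spin z * quadSym w z := by
  by_cases hc : IsCoprime w.re w.im
  · by_cases hv0 : w.im = 0
    -- No auxiliary prime exists for real `w`, but a primitive primary real element is `1`.
    · rw [hv0, isCoprime_zero_right, Int.isUnit_iff] at hc
      have h1 := hw.2
      have hw1 : w = 1 := by
        apply Zsqrtd.ext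
        · rw [Zsqrtd.re_one]; omega
        · rw [Zsqrtd.im_one]; exact hv0
      subst hw1
      simp [spin, spinSign, quadSym, infHilbert]
    · exact spin_mul_of_isCoprime hw hz hc hv0
  · rw [spin_eq_zero_of_not_isCoprime hw.re_ne_zero hc,
      spin_eq_zero_of_not_isCoprime (hw.mul hz).re_ne_zero fun h => hc (isCoprime_of_mul_left h)]
    ring

/-- Reciprocity turns the symbol into `(N(w) / |u|)` with `u = w.re`, and `N(w)` is the square of
`w.im` modulo `u`. -/
theorem jacobiSym_re_norm {w : GaussianInt} (hw : IsPrimary w) (hc : IsCoprime w.re w.im) :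
    jacobiSym w.re w.norm.natAbs = 1 := by
  have h := jacobiSym_natAbs_comm hw.norm_mod_four hw.odd_re
  rw [infHilbert_of_pos hw.norm_pos, one_mul] at h
  rw [← h, jacobiSym_natAbs_congr (b := w.im ^ 2) ⟨w.re, by rw [norm_eq]; ring⟩]
  refine jacobiSym.sq_one' ?_
  rw [Int.isCoprime_iff_gcd_eq_one, Int.gcd_comm] at hc
  rwa [Int.gcd, Int.natAbs_natCast]

/-- The quadratic symbol is completely multiplicative for a primitive modulus. -/
theorem quadSym_mul {w : GaussianInt} (hw : IsPrimary w) (hc : IsCoprime w.re w.im)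
    (z z' : GaussianInt) : quadSym w (z * z') = quadSym w z * quadSym w z' := by
  unfold quadSym
  -- Modulo `N(w)` one has `Re w * Re (w z z') ≡ Re (w z) * Re (w z')`; the factor `Re w` is
  -- inserted at no cost because its symbol is `1`.
  have h1 : jacobiSym (w * (z * z')).re w.norm.natAbs =
      jacobiSym (w.re * (w * (z * z')).re) w.norm.natAbs := by
    rw [jacobiSym.mul_left, jacobiSym_re_norm hw hc, one_mul]
  rw [← jacobiSym.mul_left, h1]
  refine jacobiSym_natAbs_congr ⟨-(z.im * z'.im), ?_⟩
  rw [norm_eq]; simp only [re_mul, im_mul]; ring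

theorem quadSym_intCast {w : GaussianInt} (hw : IsPrimary w) (hc : IsCoprime w.re w.im) (a : ℤ) :
    quadSym w a = jacobiSym a w.norm.natAbs := by
  unfold quadSym
  rw [re_mul, Zsqrtd.re_intCast, Zsqrtd.im_intCast, mul_zero, sub_zero, jacobiSym.mul_left,
    jacobiSym_re_norm hw hc, one_mul]

theorem quadSym_one {w : GaussianInt} (hw : IsPrimary w) (hc : IsCoprime w.re w.im) :
    quadSym w 1 = 1 := by
  rw [quadSym, mul_one, jacobiSym_re_norm hw hc]

/-- Quadratic reciprocity for primitive primary Gaussian integers. -/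
theorem quadSym_comm {w z : GaussianInt} (hw : IsPrimary w) (hz : IsPrimary z)
    (hwc : IsCoprime w.re w.im) (hzc : IsCoprime z.re z.im) : quadSym w z = quadSym z w := by
  have hodd := (hw.mul hz).odd_re
  have h1 := hw.quadSym_eq hodd
  have h2 : quadSym z w = jacobiSym z.norm (w * z).re.natAbs := by
    rw [hz.quadSym_eq (by rwa [mul_comm]), mul_comm]
  have h0 : (w * z).re ≠ 0 := by omega
  by_cases hc : IsCoprime (w * z).re (w * z).im
  -- Both symbols have been flipped to the modulus `Re (w z)`. Their product is the symbol of `N(w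
  -- z)`, which is congruent to the square of `Im (w z)`.
  · have h3 : jacobiSym w.norm (w * z).re.natAbs * jacobiSym z.norm (w * z).re.natAbs = 1 := by
      rw [← jacobiSym.mul_left, ← Zsqrtd.norm_mul,
        jacobiSym_natAbs_congr (b := (w * z).im ^ 2) ⟨(w * z).re, by rw [norm_eq]; ring⟩]
      refine jacobiSym.sq_one' ?_
      rw [Int.isCoprime_iff_gcd_eq_one, Int.gcd_comm] at hc
      rwa [Int.gcd, Int.natAbs_natCast]
    rw [h1, h2]
    rcases Int.mul_eq_one_iff_eq_one_or_neg_one.1 h3 with ⟨a, b⟩ | ⟨a, b⟩ <;> rw [a, b]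
  · obtain ⟨p, hp, hp1, hp2⟩ :=
      Int.isCoprime_iff_gcd_eq_one.not.1 hc |> Nat.Prime.not_coprime_iff_dvd.1
    have hp1 := Int.natCast_dvd.2 hp1
    have hp2 := Int.natCast_dvd.2 hp2
    -- A prime dividing both coordinates of `w z` divides `N(w)` when `z` is primitive, and by
    -- symmetry `N(z)`; then both symbols vanish.
    have key : ∀ w z : GaussianInt, IsCoprime z.re z.im → (p : ℤ) ∣ (w * z).re →
        (p : ℤ) ∣ (w * z).im → (p : ℤ) ∣ w.norm := by
      intro w z ⟨a, b, h⟩ h1 h2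
      have : w.norm = a * (w.re * (w * z).re + w.im * (w * z).im) +
          b * (w.re * (w * z).im - w.im * (w * z).re) := by
        rw [norm_eq, re_mul, im_mul]; linear_combination -(w.re ^ 2 + w.im ^ 2) * h
      rw [this]
      exact dvd_add ((dvd_add (h1.mul_left _) (h2.mul_left _)).mul_left _)
        ((dvd_sub (h2.mul_left _) (h1.mul_left _)).mul_left _)
    have zero : ∀ a : ℤ, (p : ℤ) ∣ a → jacobiSym a (w * z).re.natAbs = 0 := by
      intro a ha
      rw [jacobiSym.eq_zero_iff]
      refine ⟨by omega, fun hg => ?_⟩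
      have := Nat.dvd_gcd (Int.natCast_dvd.1 ha) (Int.natCast_dvd.1 hp1)
      rw [Int.gcd, Int.natAbs_natCast] at hg
      rw [hg] at this
      exact hp.one_lt.ne' (Nat.dvd_one.1 this)
    rw [h1, h2, zero _ (key w z hzc hp1 hp2),
      zero _ (key z w hwc (by rwa [mul_comm]) (by rwa [mul_comm]))]

end GaussianSpin

/-! ### Finite sets of Gaussian integers and unique factorization by norms -/

namespace GaussianSpin

/-- The Gaussian integers whose coordinates are at most `H` in absolute value. -/
noncomputable def gaussBox (H : ℕ) : Finset GaussianInt :=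
  (Finset.Icc (-(H : ℤ)) H ×ˢ Finset.Icc (-(H : ℤ)) H).image fun p => ⟨p.1, p.2⟩

/-- The primary Gaussian integers of norm at most `X`. -/
noncomputable def primaryBall (X : ℕ) : Finset GaussianInt :=
  (gaussBox X.sqrt).filter fun z => IsPrimary z ∧ z.norm ≤ X

/-- The primary Gaussian integers of norm `n`. -/
noncomputable def primaryNorm (n : ℕ) : Finset GaussianInt :=
  (primaryBall n).filter fun z => z.norm = n

theorem mem_gaussBox {H : ℕ} {z : GaussianInt} :
    z ∈ gaussBox H ↔ (-(H : ℤ) ≤ z.re ∧ z.re ≤ H) ∧ -(H : ℤ) ≤ z.im ∧ z.im ≤ H := by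
  simp only [gaussBox, Finset.mem_image, Finset.mem_product, Finset.mem_Icc, Prod.exists]
  constructor
  · rintro ⟨a, b, h, rfl⟩; exact h
  · intro h; exact ⟨z.re, z.im, h, rfl⟩

theorem sum_gaussBox {M : Type*} [AddCommMonoid M] (H : ℕ) (f : GaussianInt → M) :
    ∑ z ∈ gaussBox H, f z =
      ∑ a ∈ Finset.Icc (-(H : ℤ)) H, ∑ b ∈ Finset.Icc (-(H : ℤ)) H, f ⟨a, b⟩ := by
  rw [gaussBox, Finset.sum_image, Finset.sum_product]
  intro p _ q _ h
  simpa [Zsqrtd.ext_iff, Prod.ext_iff] using h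

theorem card_gaussBox (H : ℕ) : (gaussBox H).card = (2 * H + 1) ^ 2 := by
  have h := sum_gaussBox H (fun _ => 1)
  simp only [Finset.sum_const, smul_eq_mul, mul_one, Int.card_Icc] at h
  rw [h, sq]
  congr 1 <;> omega

theorem mem_gaussBox_of_norm_le {X H : ℕ} (hX : X ≤ H ^ 2) {z : GaussianInt} (h : z.norm ≤ X) :
    z ∈ gaussBox H := by
  rw [norm_eq] at h
  have hX' : (X : ℤ) ≤ (H : ℤ) ^ 2 := by exact_mod_cast hX
  rw [mem_gaussBox, ← abs_le, ← abs_le]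
  constructor
  · exact abs_le_of_sq_le_sq (by nlinarith [sq_nonneg z.im]) (by positivity)
  · exact abs_le_of_sq_le_sq (by nlinarith [sq_nonneg z.re]) (by positivity)

theorem mem_gaussBox_sqrt {X : ℕ} {z : GaussianInt} (h : z.norm ≤ X) : z ∈ gaussBox X.sqrt := by
  have h' := h
  rw [norm_eq] at h'
  have key : ∀ a b : ℤ, a ^ 2 + b ^ 2 ≤ X → a.natAbs ≤ X.sqrt := by
    intro a b hab
    rw [Nat.le_sqrt']
    zify
    rw [sq_abs]
    nlinarith [sq_nonneg b]
  have h1 := key _ _ h'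
  have h2 := key z.im z.re (by linarith)
  rw [mem_gaussBox]
  omega

theorem mem_primaryBall {X : ℕ} {z : GaussianInt} :
    z ∈ primaryBall X ↔ IsPrimary z ∧ z.norm ≤ X := by
  rw [primaryBall, Finset.mem_filter]
  exact ⟨fun h => h.2, fun h => ⟨mem_gaussBox_sqrt h.2, h⟩⟩

theorem mem_primaryNorm {n : ℕ} {z : GaussianInt} :
    z ∈ primaryNorm n ↔ IsPrimary z ∧ z.norm = n := by
  rw [primaryNorm, Finset.mem_filter, mem_primaryBall]
  exact ⟨fun h => ⟨h.1.1, h.2⟩, fun h => ⟨⟨h.1, h.2.le⟩, h.2⟩⟩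

theorem card_primaryBall_le {X : ℕ} (hX : 1 ≤ X) : (primaryBall X).card ≤ 9 * X := by
  refine (Finset.card_filter_le _ _).trans ?_
  rw [card_gaussBox]
  have h1 : X.sqrt * X.sqrt ≤ X := Nat.sqrt_le X
  have h2 : 1 ≤ X.sqrt := Nat.le_sqrt.2 (by omega)
  nlinarith

theorem sum_primaryBall {M : Type*} [AddCommMonoid M] (X : ℕ) (f : GaussianInt → M) :
    ∑ z ∈ primaryBall X, f z = ∑ n ∈ Finset.Icc 1 X, ∑ z ∈ primaryNorm n, f z := by
  rw [← Finset.sum_fiberwise_of_maps_to (s := primaryBall X) (t := Finset.Icc 1 X)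
    (g := fun z => z.norm.natAbs)]
  · refine Finset.sum_congr rfl fun n hn => Finset.sum_congr ?_ fun _ _ => rfl
    ext z
    rw [Finset.mem_filter, mem_primaryBall, mem_primaryNorm]
    rw [Finset.mem_Icc] at hn
    constructor
    · rintro ⟨⟨h1, h2⟩, h3⟩
      have := h1.norm_pos
      exact ⟨h1, by omega⟩
    · rintro ⟨h1, h2⟩
      exact ⟨⟨h1, by omega⟩, by omega⟩
  · intro z hz
    rw [mem_primaryBall] at hz
    have := hz.1.norm_pos
    rw [Finset.mem_Icc]
    omega

theorem exists_isUnit_mul_isPrimary {z : GaussianInt} (h : z.norm % 2 = 1) :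
    ∃ e : GaussianInt, IsUnit e ∧ IsPrimary (z * e) := by
  have hu : ∀ e : GaussianInt, e.norm = 1 → IsUnit e := by
    intro e he
    rw [← Zsqrtd.norm_eq_one_iff, he]; rfl
  rw [norm_eq, sq, sq] at h
  have h1 : z.re % 2 = 1 ∧ z.im % 2 = 0 ∨ z.re % 2 = 0 ∧ z.im % 2 = 1 := by
    rcases Int.emod_two_eq_zero_or_one z.re with a | a <;>
      rcases Int.emod_two_eq_zero_or_one z.im with b | b <;>
      simp [Int.add_emod, Int.mul_emod, a, b] at h ⊢
  have key : ∀ c d : ℤ, c ^ 2 + d ^ 2 = 1 →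
      ((z.re * d + z.im * c) % 2 = 0 ∧ (z.re * c - z.im * d + (z.re * d + z.im * c)) % 4 = 1) →
      ∃ e : GaussianInt, IsUnit e ∧ IsPrimary (z * e) := by
    intro c d hcd hh
    refine ⟨⟨c, d⟩, hu _ (by rw [norm_eq]; exact hcd), ?_⟩
    rw [IsPrimary, re_mul, im_mul]
    exact hh
  rcases h1 with ⟨a, b⟩ | ⟨a, b⟩
  · rcases (by omega : (z.re + z.im) % 4 = 1 ∨ (z.re + z.im) % 4 = 3) with c | c
    · exact key 1 0 (by norm_num) (by omega)
    · exact key (-1) 0 (by norm_num) (by omega)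
  · rcases (by omega : (z.re - z.im) % 4 = 1 ∨ (z.re - z.im) % 4 = 3) with c | c
    · exact key 0 1 (by norm_num) (by omega)
    · exact key 0 (-1) (by norm_num) (by omega)

theorem IsPrimary.eq_one_of_isUnit {e : GaussianInt} (he : IsPrimary e) (hu : IsUnit e) :
    e = 1 := by
  have h1 : e.norm = 1 := by
    have := Zsqrtd.norm_eq_one_iff.2 hu
    have := he.norm_pos
    omega
  rw [norm_eq] at h1
  have h0 : e.im = 0 := by
    have h2 : 1 ≤ e.re ^ 2 := by
      have h := Int.one_le_abs he.re_ne_zero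
      nlinarith [sq_abs e.re]
    have : e.im ^ 2 ≤ 0 := by linarith
    exact pow_eq_zero_iff two_ne_zero |>.1 (le_antisymm this (sq_nonneg _))
  have h2 := he.2
  rw [h0] at h1 h2
  have h3 : e.re = 1 ∨ e.re = -1 := by
    exact mul_self_eq_one_iff.1 (by linarith)
  apply Zsqrtd.ext
  · rw [Zsqrtd.re_one]; omega
  · rw [Zsqrtd.im_one]; exact h0

theorem IsPrimary.eq_of_associated {a b : GaussianInt} (ha : IsPrimary a) (hb : IsPrimary b)
    (h : Associated a b) : a = b := by
  obtain ⟨e, rfl⟩ := h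
  rw [(ha.of_mul hb).eq_one_of_isUnit e.isUnit, mul_one]

/-- Writing the gcd by Bézout as `x z + y b`, every term of its norm contains `b` or `z * star z = b
m`. Conversely the norm of the gcd divides `z b`, hence `b`, because the coordinates of `z` are
coprime. So a primitive `z` of norm `b m` has a divisor of norm `b`, and by `associated_gcd` only
one up to units, with no assumption that `b` and `m` are coprime. -/
theorem norm_gcd_eq {z : GaussianInt} (hc : IsCoprime z.re z.im) {b m : ℕ}
    (hn : z.norm = b * m) : (EuclideanDomain.gcd z (b : GaussianInt)).norm = b := by
  set g := EuclideanDomain.gcd z (b : GaussianInt) with hg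
  have h1 : (b : ℤ) ∣ g.norm := by
    rw [← Zsqrtd.intCast_dvd_intCast (d := -1), Zsqrtd.norm_eq_mul_conj]
    have e := EuclideanDomain.gcd_eq_gcd_ab z (b : GaussianInt)
    rw [← hg] at e
    generalize EuclideanDomain.gcdA z (b : GaussianInt) = x at e
    generalize EuclideanDomain.gcdB z (b : GaussianInt) = y at e
    have hz : z * star z = b * m := by
      rw [← Zsqrtd.norm_eq_mul_conj, hn]; push_cast; rfl
    refine ⟨m * x * star x + z * x * star y + y * star z * star x + b * y * star y, ?_⟩
    rw [e]
    simp only [star_add, star_mul', star_natCast, Int.cast_natCast]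
    linear_combination x * star x * hz
  have h2 : g.norm ∣ (b : ℤ) := by
    have hd : ((g.norm : ℤ) : GaussianInt) ∣ z * b := by
      rw [Zsqrtd.norm_eq_mul_conj]
      refine mul_dvd_mul (EuclideanDomain.gcd_dvd_left _ _) ?_
      have := map_dvd (starRingEnd GaussianInt) (EuclideanDomain.gcd_dvd_right z (b : GaussianInt))
      rw [map_natCast, starRingEnd_apply] at this
      exact this
    rw [Zsqrtd.intCast_dvd] at hd
    obtain ⟨hd1, hd2⟩ := hd
    rw [re_mul] at hd1
    rw [im_mul] at hd2
    simp only [Zsqrtd.re_natCast, Zsqrtd.im_natCast, mul_zero, sub_zero, zero_add] at hd1 hd2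
    obtain ⟨x, y, hxy⟩ := hc
    have : (b : ℤ) = x * (z.re * b) + y * (z.im * b) := by
      linear_combination -(b : ℤ) * hxy
    rw [this]
    exact dvd_add (hd1.mul_left _) (hd2.mul_left _)
  exact Int.dvd_antisymm (GaussianInt.norm_nonneg g) (by positivity) h2 h1

theorem associated_gcd {z w : GaussianInt} (hc : IsCoprime z.re z.im) {b m : ℕ} (hb : b ≠ 0)
    (hn : z.norm = b * m) (hw : w.norm = b) (hd : w ∣ z) :
    Associated w (EuclideanDomain.gcd z (b : GaussianInt)) := by
  have hwb : w ∣ (b : GaussianInt) := by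
    refine ⟨star w, ?_⟩
    rw [← Zsqrtd.norm_eq_mul_conj, hw]; push_cast; rfl
  obtain ⟨e, he⟩ := EuclideanDomain.dvd_gcd hd hwb
  have hg := norm_gcd_eq hc hn
  rw [he, Zsqrtd.norm_mul, hw] at hg
  have h1 : e.norm = 1 := by
    have : (b : ℤ) ≠ 0 := by exact_mod_cast hb
    exact mul_left_cancel₀ this (by rw [hg, mul_one])
  have hu : IsUnit e := by
    rw [← Zsqrtd.norm_eq_one_iff, h1]; rfl
  rw [he]
  exact ⟨hu.unit, rfl⟩

/-- A sum over primitive primary elements of norm `b * m` factors. -/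
theorem sum_primaryNorm_mul {M : Type*} [AddCommMonoid M] {b m : ℕ} (hb : b ≠ 0)
    (f : GaussianInt → M)
    (hf : ∀ z, IsPrimary z → ¬ IsCoprime z.re z.im → f z = 0) :
    ∑ z ∈ primaryNorm (b * m), f z =
      ∑ w ∈ primaryNorm b, ∑ z ∈ primaryNorm m, f (w * z) := by
  rw [← Finset.sum_product']
  symm
  -- Factorization by norms is unique only for primitive elements; the others contribute zero, so
  -- the bijection is needed only on the support.
  refine Finset.sum_bij_ne_zero (fun p _ _ => p.1 * p.2) ?_ ?_ ?_ ?_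
  · intro p hp _
    rw [Finset.mem_product, mem_primaryNorm, mem_primaryNorm] at hp
    rw [mem_primaryNorm, Zsqrtd.norm_mul, hp.1.2, hp.2.2]
    exact ⟨hp.1.1.mul hp.2.1, by push_cast; ring⟩
  · intro p hp hp0 q hq _ hpq
    rw [Finset.mem_product, mem_primaryNorm, mem_primaryNorm] at hp hq
    have hc : IsCoprime (p.1 * p.2).re (p.1 * p.2).im := by
      by_contra h
      exact hp0 (hf _ (hp.1.1.mul hp.2.1) h)
    have hn : (p.1 * p.2).norm = b * m := by rw [Zsqrtd.norm_mul, hp.1.2, hp.2.2]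
    have h1 := associated_gcd hc hb hn hp.1.2 (dvd_mul_right _ _)
    have h2 := associated_gcd hc hb hn hq.1.2 (by rw [hpq]; exact dvd_mul_right _ _)
    have h3 := hp.1.1.eq_of_associated hq.1.1 (h1.trans h2.symm)
    refine Prod.ext h3 ?_
    rw [h3] at hpq
    exact mul_left_cancel₀ hq.1.1.ne_zero hpq
  · intro z hz hz0
    rw [mem_primaryNorm] at hz
    have hc : IsCoprime z.re z.im := by
      by_contra h
      exact hz0 (hf z hz.1 h)
    have hn : z.norm = b * m := by rw [hz.2]; push_cast; ring
    have hg := norm_gcd_eq hc hn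
    have hodd : (EuclideanDomain.gcd z (b : GaussianInt)).norm % 2 = 1 := by
      have h4 := hz.1.norm_mod_four
      rw [hg]
      rcases Int.emod_two_eq_zero_or_one (b : ℤ) with h | h
      · exfalso
        obtain ⟨k, hk⟩ : ∃ k, (b : ℤ) = 2 * k := ⟨(b : ℤ) / 2, by omega⟩
        rw [hn, hk, mul_assoc] at h4
        omega
      · exact h
    obtain ⟨e, he, hpe⟩ := exists_isUnit_mul_isPrimary hodd
    obtain ⟨t, ht⟩ := EuclideanDomain.gcd_dvd_left z (b : GaussianInt)
    generalize EuclideanDomain.gcd z (b : GaussianInt) = g at *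
    obtain ⟨e', hee⟩ := he.exists_right_inv
    have hz' : (g * e) * (e' * t) = z := by
      rw [ht]; linear_combination g * t * hee
    have hne : (g * e).norm = b := by
      have := Zsqrtd.norm_eq_one_iff.2 he
      have := GaussianInt.norm_nonneg e
      rw [Zsqrtd.norm_mul, hg, show e.norm = 1 by omega, mul_one]
    have hp2 : IsPrimary (e' * t) := hpe.of_mul (by rw [hz']; exact hz.1)
    refine ⟨(g * e, e' * t), ?_, ?_, hz'⟩
    · rw [Finset.mem_product, mem_primaryNorm, mem_primaryNorm]
      refine ⟨⟨hpe, hne⟩, hp2, ?_⟩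
      have h6 := hn
      rw [← hz', Zsqrtd.norm_mul, hne] at h6
      exact mul_left_cancel₀ (by exact_mod_cast hb) h6
    · show f ((g * e) * (e' * t)) ≠ 0
      rwa [hz']
  · intro p _ _; rfl

end GaussianSpin

/-! ### Bilinear forms with bounded coefficients -/

namespace GaussianSpin

open Finset

/-- All bilinear forms with kernel `K` and coefficients bounded by `1` are bounded by `B`. -/
def BilinBound {α β : Type*} (W : Finset α) (Z : Finset β) (K : α → β → ℝ) (B : ℝ) : Prop :=
  ∀ (a : α → ℝ) (b : β → ℝ), (∀ w, |a w| ≤ 1) → (∀ z, |b z| ≤ 1) →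
    |∑ w ∈ W, ∑ z ∈ Z, a w * b z * K w z| ≤ B

namespace BilinBound

variable {α β : Type*} {W : Finset α} {Z : Finset β} {K K' : α → β → ℝ} {B B' : ℝ}

theorem nonneg (h : BilinBound W Z K B) : 0 ≤ B := by
  have := h (fun _ => 0) (fun _ => 0) (by simp) (by simp)
  simpa using this

theorem mono (h : BilinBound W Z K B) (hB : B ≤ B') : BilinBound W Z K B' :=
  fun a b ha hb => (h a b ha hb).trans hB

theorem congr (h : BilinBound W Z K B) (hK : ∀ w ∈ W, ∀ z ∈ Z, K' w z = K w z) :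
    BilinBound W Z K' B := by
  intro a b ha hb
  rw [sum_congr rfl fun w hw => sum_congr rfl fun z hz => by rw [hK w hw z hz]]
  exact h a b ha hb

theorem zero : BilinBound W Z (fun _ _ => 0) 0 := by
  intro a b _ _; simp

theorem add (h : BilinBound W Z K B) (h' : BilinBound W Z K' B') :
    BilinBound W Z (fun w z => K w z + K' w z) (B + B') := by
  intro a b ha hb
  simp only [mul_add, sum_add_distrib]
  exact (abs_add_le _ _).trans (add_le_add (h a b ha hb) (h' a b ha hb))

theorem sum {ι : Type*} (s : Finset ι) {K : ι → α → β → ℝ} {B : ι → ℝ}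
    (h : ∀ i ∈ s, BilinBound W Z (K i) (B i)) :
    BilinBound W Z (fun w z => ∑ i ∈ s, K i w z) (∑ i ∈ s, B i) := by
  classical
  induction s using Finset.induction_on with
  | empty => simpa using zero
  | insert i s hi ih =>
    simp only [sum_insert hi]
    exact (h i (mem_insert_self i s)).add (ih fun j hj => h j (mem_insert_of_mem hj))

theorem mul_separated (h : BilinBound W Z K B) {f : α → ℝ} {g : β → ℝ} (hf : ∀ w, |f w| ≤ 1)
    (hg : ∀ z, |g z| ≤ 1) : BilinBound W Z (fun w z => f w * g z * K w z) B := by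
  intro a b ha hb
  have := h (fun w => a w * f w) (fun z => b z * g z)
    (fun w => by rw [abs_mul]; exact mul_le_one₀ (ha w) (abs_nonneg _) (hf w))
    (fun z => by rw [abs_mul]; exact mul_le_one₀ (hb z) (abs_nonneg _) (hg z))
  refine le_of_eq_of_le (congrArg abs ?_) this
  exact sum_congr rfl fun w _ => sum_congr rfl fun z _ => by ring

theorem const_mul (h : BilinBound W Z K B) (c : ℝ) :
    BilinBound W Z (fun w z => c * K w z) (|c| * B) := by
  intro a b ha hb
  have : ∑ w ∈ W, ∑ z ∈ Z, a w * b z * (c * K w z) = c * ∑ w ∈ W, ∑ z ∈ Z, a w * b z * K w z := by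
    simp only [mul_sum]
    exact sum_congr rfl fun w _ => sum_congr rfl fun z _ => by ring
  rw [this, abs_mul]
  exact mul_le_mul_of_nonneg_left (h a b ha hb) (abs_nonneg c)

theorem swap (h : BilinBound W Z K B) : BilinBound Z W (fun z w => K w z) B := by
  intro a b ha hb
  rw [sum_comm]
  refine le_of_eq_of_le (congrArg abs ?_) (h b a hb ha)
  exact sum_congr rfl fun w _ => sum_congr rfl fun z _ => by ring

theorem subset (h : BilinBound W Z K B) {W' : Finset α} {Z' : Finset β} (hW : W' ⊆ W)
    (hZ : Z' ⊆ Z) : BilinBound W' Z' K B := by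
  classical
  intro a b ha hb
  have := h (fun w => if w ∈ W' then a w else 0) (fun z => if z ∈ Z' then b z else 0)
    (fun w => by split_ifs <;> simp [ha w]) (fun z => by split_ifs <;> simp [hb z])
  convert this using 2
  rw [← sum_subset hW (fun w _ hw => by simp [hw])]
  refine sum_congr rfl fun w hw => ?_
  rw [← sum_subset hZ (fun z _ hz => by simp [hz])]
  refine sum_congr rfl fun z hz => ?_
  simp [hw, hz]

/-- A kernel supported on a matching of blocks: average over random signs of the blocks. -/
theorem mul_ite_eq (h : BilinBound W Z K B) {n : ℕ} (f : α → Fin n) (g : β → Fin n) :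
    BilinBound W Z (fun w z => if f w = g z then K w z else 0) B := by
  intro a b ha hb
  have hE : ∀ i j : Fin n, ∑ e : Fin n → Bool, ((if e i then (1 : ℝ) else -1) *
      (if e j then 1 else -1)) = if i = j then (Fintype.card (Fin n → Bool) : ℝ) else 0 := by
    intro i j
    split_ifs with hij
    · subst hij
      rw [sum_congr rfl (g := fun _ => (1 : ℝ)) fun e _ => by cases e i <;> simp]
      simp
    -- Flipping the sign of the block `i` alone pairs opposite terms, so signs of distinct blocks
    -- are orthogonal.
    · refine sum_involution (fun e _ => Function.update e i (!e i)) ?_ ?_ ?_ ?_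
      · intro e _
        rw [Function.update_self, Function.update_of_ne (Ne.symm hij)]
        cases e i <;> cases e j <;> simp
      · intro e _ _ hcon
        have := congrFun hcon i
        simp at this
      · simp
      · intro e _; ext k; simp
  have hcard : (0 : ℝ) < Fintype.card (Fin n → Bool) := by exact_mod_cast Fintype.card_pos
  have key : (Fintype.card (Fin n → Bool) : ℝ) *
      ∑ w ∈ W, ∑ z ∈ Z, a w * b z * (if f w = g z then K w z else 0) =
      ∑ e : Fin n → Bool, ∑ w ∈ W, ∑ z ∈ Z, (a w * (if e (f w) then (1 : ℝ) else -1)) *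
        (b z * (if e (g z) then (1 : ℝ) else -1)) * K w z := by
    rw [sum_comm (s := univ), mul_sum]
    refine sum_congr rfl fun w _ => ?_
    rw [sum_comm (s := univ), mul_sum]
    refine sum_congr rfl fun z _ => ?_
    have := hE (f w) (g z)
    rw [sum_congr rfl (g := fun e : Fin n → Bool => (a w * b z * K w z) *
      ((if e (f w) then (1 : ℝ) else -1) * (if e (g z) then 1 else -1))) fun e _ => by ring,
      ← mul_sum, this]
    split_ifs <;> ring
  have hs : ∀ (c : ℝ) (e : Bool), |c| ≤ 1 → |c * (if e then (1 : ℝ) else -1)| ≤ 1 := by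
    intro c e hc; cases e <;> simpa using hc
  have h2 : |(Fintype.card (Fin n → Bool) : ℝ) *
      ∑ w ∈ W, ∑ z ∈ Z, a w * b z * (if f w = g z then K w z else 0)| ≤
      (Fintype.card (Fin n → Bool) : ℝ) * B := by
    rw [key]
    refine (abs_sum_le_sum_abs _ _).trans ?_
    refine (sum_le_card_nsmul _ _ B fun e _ =>
      h _ _ (fun w => hs _ _ (ha w)) (fun z => hs _ _ (hb z))).trans_eq ?_
    rw [nsmul_eq_mul]; rfl
  rw [abs_mul, abs_of_pos hcard] at h2
  exact le_of_mul_le_mul_left h2 hcard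

/-- Compare binary expansions: `f < g` means that the halves satisfy `f / 2 < g / 2`, or that they
agree and the last digits are `0` and `1`. Equality of the halves is a matching of blocks, which
costs nothing by `mul_ite_eq`, so each digit costs one more `B`. -/
theorem mul_ite_nat_lt (h : BilinBound W Z K B) (n : ℕ) (f : α → ℕ) (g : β → ℕ)
    (hf : ∀ w, f w < 2 ^ n) (hg : ∀ z, g z < 2 ^ n) :
    BilinBound W Z (fun w z => if f w < g z then K w z else 0) (n * B) := by
  induction n generalizing f g with
  | zero =>
    rw [Nat.cast_zero, zero_mul]
    refine zero.congr fun w _ z _ => if_neg ?_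
    have := hf w
    have := hg z
    omega
  | succ n ih =>
    have h1 := ih (fun w => f w / 2) (fun z => g z / 2)
      (fun w => by have := hf w; rw [pow_succ] at this; omega)
      (fun z => by have := hg z; rw [pow_succ] at this; omega)
    have h2 : BilinBound W Z (fun w z => (if f w % 2 = 0 then (1 : ℝ) else 0) *
        (if g z % 2 = 1 then 1 else 0) *
        (if (⟨f w / 2, by have := hf w; rw [pow_succ] at this; omega⟩ : Fin (2 ^ n)) =
          ⟨g z / 2, by have := hg z; rw [pow_succ] at this; omega⟩ then K w z else 0)) B := by
      refine mul_separated (mul_ite_eq h _ _) ?_ ?_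
      · intro w; split_ifs <;> simp
      · intro z; split_ifs <;> simp
    refine ((h1.add h2).mono (by push_cast; linarith)).congr fun w _ z _ => ?_
    simp only [Fin.mk.injEq]
    split_ifs <;> first | omega | simp

/-- A kernel cut off by an order relation between functions of the two variables. -/
theorem mul_ite_lt {R : Type*} [LinearOrder R] (h : BilinBound W Z K B) (f : α → R) (g : β → R)
    {n : ℕ} (hn : W.card + Z.card < 2 ^ n) :
    BilinBound W Z (fun w z => if f w < g z then K w z else 0) (n * B) := by
  classical
  -- Values are replaced by their ranks among all values taken, so the cost depends only on the
  -- number of elements.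
  set T := W.image f ∪ Z.image g with hT
  have hTc : T.card < 2 ^ n :=
    ((card_union_le _ _).trans (add_le_add card_image_le card_image_le)).trans_lt hn
  have hlt : ∀ t : R, (T.filter (· < t)).card < 2 ^ n :=
    fun t => (card_filter_le _ _).trans_lt hTc
  refine (h.mul_ite_nat_lt n (fun w => (T.filter (· < f w)).card)
    (fun z => (T.filter (· < g z)).card) (fun w => hlt _) (fun z => hlt _)).congr
    fun w hw z hz => ?_
  have hiff : f w < g z ↔ (T.filter (· < f w)).card < (T.filter (· < g z)).card := by
    constructor
    · intro hl
      refine card_lt_card ⟨fun t ht => ?_, fun hs => ?_⟩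
      · rw [mem_filter] at ht ⊢
        exact ⟨ht.1, ht.2.trans hl⟩
      · have : f w ∈ T.filter (· < f w) := hs (mem_filter.2
          ⟨mem_union_left _ (mem_image_of_mem f hw), hl⟩)
        exact lt_irrefl _ (mem_filter.1 this).2
    · intro hl
      by_contra hge
      refine absurd hl (not_lt.2 (card_le_card fun t ht => ?_))
      rw [mem_filter] at ht ⊢
      exact ⟨ht.1, ht.2.trans_le (not_lt.1 hge)⟩
  simp only [hiff]

theorem mul_ite_le {R : Type*} [LinearOrder R] (h : BilinBound W Z K B) (f : α → R) (g : β → R)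
    {n : ℕ} (hn : W.card + Z.card < 2 ^ n) :
    BilinBound W Z (fun w z => if f w ≤ g z then K w z else 0) ((n + 1) * B) := by
  have h1 := (h.swap.mul_ite_lt g f (n := n) (by omega)).swap.const_mul (-1)
  refine ((h.add h1).mono (by rw [abs_neg, abs_one]; linarith)).congr fun w _ z _ => ?_
  by_cases hle : f w ≤ g z
  · rw [if_pos hle, if_neg (not_lt.2 hle)]; ring
  · rw [if_neg hle, if_pos (not_le.1 hle)]; ring

/-- Kernels that vary over finitely many classes of the two variables. -/
theorem of_classes {ι κ : Type*} [Fintype ι] [Fintype κ] [DecidableEq ι] [DecidableEq κ]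
    (c : α → ι) (d : β → κ) {L : ι → κ → α → β → ℝ} (h : ∀ i j, BilinBound W Z (L i j) B) :
    BilinBound W Z (fun w z => L (c w) (d z) w z) (Fintype.card ι * Fintype.card κ * B) := by
  have h1 : BilinBound W Z (fun w z => ∑ p ∈ (univ : Finset (ι × κ)),
      ((if c w = p.1 then (1 : ℝ) else 0) * (if d z = p.2 then 1 else 0) * L p.1 p.2 w z))
      (∑ p ∈ (univ : Finset (ι × κ)), B) :=
    sum _ fun p _ => (h p.1 p.2).mul_separated (fun w => by split_ifs <;> simp)
      (fun z => by split_ifs <;> simp)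
  refine (h1.mono ?_).congr fun w _ z _ => ?_
  · simp
  · rw [sum_eq_single (c w, d z)]
    · simp
    · rintro ⟨i, j⟩ _ hne
      by_cases h1 : c w = i
      · have h2 : d z ≠ j := fun h2 => hne (by rw [h1, h2])
        simp [h2]
      · simp [h1]
    · simp

/-- A kernel multiplied by a bounded function of finitely many classes. -/
theorem mul_classes {ι κ : Type*} [Fintype ι] [Fintype κ] [DecidableEq ι] [DecidableEq κ]
    (h : BilinBound W Z K B) (c : α → ι) (d : β → κ) {F : ι → κ → ℝ} (hF : ∀ i j, |F i j| ≤ 1) :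
    BilinBound W Z (fun w z => F (c w) (d z) * K w z) (Fintype.card ι * Fintype.card κ * B) :=
  of_classes c d fun i j => (h.const_mul (F i j)).mono
    (mul_le_of_le_one_left h.nonneg (hF i j))

theorem div_sub_div_eq {p p' q q' : ℝ} (h : p * q' ≠ 0) :
    q / q' - p' / p = (p * q - p' * q') / (p * q') := by
  have hp := left_ne_zero_of_mul h
  have hq := right_ne_zero_of_mul h
  field_simp

/-- A kernel cut off by the sign of a two-dimensional bilinear form. -/
theorem mul_ite_mul_lt_mul (h : BilinBound W Z K B) (p p' : α → ℝ) (q q' : β → ℝ)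
    {n : ℕ} (hn : W.card + Z.card < 2 ^ n) :
    BilinBound W Z (fun w z => if p w * q z < p' w * q' z then K w z else 0)
      (9 * ((9 + n) * B)) := by
  have hB := h.nonneg
  -- Fix the signs of `p w` and `q' z`. If one of them is zero the condition already separates;
  -- otherwise division turns it into a comparison of `q z / q' z` with `p' w / p w`, in a direction
  -- given by the two signs. The nine sign classes account for the factor `9`.
  let L : SignType → SignType → α → β → ℝ := fun i j w z =>
    if i = 0 then (if 0 < p' w * (j : ℝ) then 1 else 0) * 1 * K w z else
    if j = 0 then (if (i : ℝ) * q z < 0 then 1 else 0) * K w z else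
    if i = j then (if q z / q' z < p' w / p w then K w z else 0) else
      (if p' w / p w < q z / q' z then K w z else 0)
  have hL : ∀ i j, BilinBound W Z (L i j) ((9 + n) * B) := by
    intro i j
    have hn0 : (0 : ℝ) ≤ n := Nat.cast_nonneg n
    by_cases hi : i = 0
    · simp only [L, if_pos hi]
      refine (h.mul_separated (f := fun w => if 0 < p' w * (j : ℝ) then 1 else 0) (g := fun _ => 1)
        (fun w => by split_ifs <;> simp) (by simp)).mono (by nlinarith)
    by_cases hj : j = 0
    · simp only [L, if_neg hi, if_pos hj]
      refine ((h.mul_separated (f := fun _ => 1) (g := fun z => if (i : ℝ) * q z < 0 then 1 else 0)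
        (by simp) (fun w => by split_ifs <;> simp)).mono (by nlinarith)).congr fun _ _ _ _ => ?_
      rw [one_mul]
    by_cases hij : i = j
    · simp only [L, if_neg hi, if_neg hj, if_pos hij]
      exact (h.swap.mul_ite_lt (fun z => q z / q' z) (fun w => p' w / p w) (n := n)
        (by omega)).swap.mono (by nlinarith)
    · simp only [L, if_neg hi, if_neg hj, if_neg hij]
      exact (h.mul_ite_lt (fun w => p' w / p w) (fun z => q z / q' z) hn).mono (by nlinarith)
  refine ((of_classes (fun w => SignType.sign (p w)) (fun z => SignType.sign (q' z)) hL).mono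
    (le_of_eq ?_)).congr fun w _ z _ => ?_
  · have : Fintype.card SignType = 3 := rfl
    rw [this]; norm_num
  · simp only [L]
    have hpos : 0 < p w * q' z → (p w * q z < p' w * q' z ↔ q z / q' z < p' w / p w) := by
      intro h0
      rw [← sub_neg, ← sub_neg (a := q z / q' z), div_sub_div_eq h0.ne', div_neg_iff]
      constructor
      · intro h; exact Or.inr ⟨h, h0⟩
      · rintro (h | h)
        · linarith [h.2]
        · exact h.1
    have hneg : p w * q' z < 0 → (p w * q z < p' w * q' z ↔ p' w / p w < q z / q' z) := by
      intro h0
      rw [← sub_neg, ← sub_pos (a := q z / q' z), div_sub_div_eq h0.ne, div_pos_iff]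
      constructor
      · intro h; exact Or.inr ⟨h, h0⟩
      · rintro (h | h)
        · linarith [h.2]
        · exact h.1
    rcases lt_trichotomy (p w) 0 with hp | hp | hp <;>
      rcases lt_trichotomy (q' z) 0 with hq | hq | hq
    · simp [hpos (mul_pos_of_neg_of_neg hp hq), sign_neg hp, sign_neg hq]
    · simp [sign_neg hp, hq, mul_neg_iff, hp, hp.not_gt]
    · simp [hneg (mul_neg_of_neg_of_pos hp hq), sign_neg hp, sign_pos hq]
    · simp [hp, sign_neg hq, mul_pos_iff, hq, hq.not_gt]
    · simp [hp, hq]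
    · simp [hp, sign_pos hq, hq]
    · simp [hneg (mul_neg_of_pos_of_neg hp hq), sign_pos hp, sign_neg hq]
    · simp [sign_pos hp, hq, mul_neg_iff, hp, hp.not_gt]
    · simp [hpos (mul_pos hp hq), sign_pos hp, sign_pos hq]

end BilinBound

end GaussianSpin

/-! ### Moments of bilinear forms, divisor bounds and complete sums -/

namespace GaussianSpin

open Finset

/-- Hölder's and Cauchy's inequalities reduce a bilinear form with a multiplicative kernel to
correlations of the kernel over a long range of the second variable. -/
theorem abs_bilin_pow_le {α β : Type*} [CommMonoid β] [DecidableEq β] (W : Finset α)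
    (Z Box : Finset β) (χ : α → β → ℝ) (hone : ∀ w ∈ W, χ w 1 = 1)
    (hmul : ∀ w ∈ W, ∀ z z', χ w (z * z') = χ w z * χ w z') {k : ℕ} (hk : 1 ≤ k) {τ E : ℝ}
    (hτ0 : 0 ≤ τ)
    (hBox : ∀ t ∈ Fintype.piFinset (fun _ : Fin k => Z), ∏ i, t i ∈ Box)
    (hτ : ∀ y ∈ Box, (((Fintype.piFinset (fun _ : Fin k => Z)).filter
      fun t => ∏ i, t i = y).card : ℝ) ≤ τ)
    (hE : ∑ w₁ ∈ W, ∑ w₂ ∈ W, |∑ y ∈ Box, χ w₁ y * χ w₂ y| ≤ E)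
    (a : α → ℝ) (b : β → ℝ) (ha : ∀ w, |a w| ≤ 1) (hb : ∀ z, |b z| ≤ 1) :
    |∑ w ∈ W, ∑ z ∈ Z, a w * b z * χ w z| ^ (2 * k) ≤
      (W.card : ℝ) ^ (2 * (k - 1)) * (τ * (Z.card : ℝ) ^ k * E) := by
  set T : α → ℝ := fun w => ∑ z ∈ Z, b z * χ w z with hT
  obtain ⟨c, hc1, hcT⟩ : ∃ c : α → ℝ, (∀ w, |c w| ≤ 1) ∧ ∀ w, |T w| ^ k = c w * T w ^ k := by
    refine ⟨fun w => (SignType.sign (T w) : ℝ) ^ k, fun w => ?_, fun w => ?_⟩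
    · rw [abs_pow]
      refine pow_le_one₀ (abs_nonneg _) ?_
      rcases SignType.sign (T w) with _ | _ | _ <;> simp
    · rw [← mul_pow, sign_mul_self]
  set P := Fintype.piFinset (fun _ : Fin k => Z) with hP
  set F : β → ℝ := fun y => ∑ w ∈ W, c w * χ w y with hF
  have hprod : ∀ w ∈ W, ∀ t : Fin k → β, χ w (∏ i, t i) = ∏ i, χ w (t i) := by
    intro w hw t
    let φ : β →* ℝ := ⟨⟨χ w, hone w hw⟩, hmul w hw⟩
    exact map_prod φ t univ
  have h1 : |∑ w ∈ W, ∑ z ∈ Z, a w * b z * χ w z| ^ k ≤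
      (W.card : ℝ) ^ (k - 1) * ∑ w ∈ W, |T w| ^ k := by
    have h2 : |∑ w ∈ W, ∑ z ∈ Z, a w * b z * χ w z| ≤ ∑ w ∈ W, |T w| := by
      refine (abs_sum_le_sum_abs _ _).trans (sum_le_sum fun w _ => ?_)
      have : ∑ z ∈ Z, a w * b z * χ w z = a w * T w := by
        rw [hT, mul_sum]; exact sum_congr rfl fun z _ => by ring
      rw [this, abs_mul]
      exact mul_le_of_le_one_left (abs_nonneg _) (ha w)
    refine (pow_le_pow_left₀ (abs_nonneg _) h2 k).trans ?_
    obtain ⟨m, rfl⟩ : ∃ m, k = m + 1 := ⟨k - 1, by omega⟩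
    exact pow_sum_le_card_mul_sum_pow (fun _ _ => abs_nonneg _) _
  -- The sign `c w` removes the absolute value, the power is expanded into `k`-tuples, and by
  -- multiplicativity the kernel depends only on the product of the tuple.
  have h3 : ∑ w ∈ W, |T w| ^ k = ∑ t ∈ P, (∏ i, b (t i)) * F (∏ i, t i) := by
    have : ∀ w ∈ W, |T w| ^ k = ∑ t ∈ P, (∏ i, b (t i)) * (c w * χ w (∏ i, t i)) := by
      intro w hw
      rw [hcT, show T w ^ k = ∏ _i : Fin k, T w by simp, hT, prod_univ_sum, mul_sum]
      refine sum_congr rfl fun t _ => ?_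
      rw [prod_mul_distrib, hprod w hw]; ring
    rw [sum_congr rfl this, sum_comm]
    exact sum_congr rfl fun t _ => by rw [hF, mul_sum]
  have hPc : (P.card : ℝ) = (Z.card : ℝ) ^ k := by
    rw [hP, Fintype.card_piFinset]; simp
  have hF2 : ∑ y ∈ Box, F y ^ 2 ≤ E := by
    refine le_trans ?_ hE
    have : ∑ y ∈ Box, F y ^ 2 =
        ∑ w₁ ∈ W, ∑ w₂ ∈ W, c w₁ * c w₂ * ∑ y ∈ Box, χ w₁ y * χ w₂ y := by
      simp only [hF, sq, sum_mul_sum]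
      rw [sum_comm]
      refine sum_congr rfl fun w₁ _ => ?_
      rw [sum_comm]
      refine sum_congr rfl fun w₂ _ => ?_
      rw [mul_sum]
      exact sum_congr rfl fun y _ => by ring
    rw [this]
    refine sum_le_sum fun w₁ _ => sum_le_sum fun w₂ _ => (le_abs_self _).trans ?_
    rw [abs_mul, abs_mul]
    exact mul_le_of_le_one_left (abs_nonneg _) (mul_le_one₀ (hc1 _) (abs_nonneg _) (hc1 _))
  have h4 : (∑ w ∈ W, |T w| ^ k) ^ 2 ≤ τ * (Z.card : ℝ) ^ k * E := by
    have h5 : |∑ w ∈ W, |T w| ^ k| ≤ ∑ t ∈ P, |F (∏ i, t i)| := by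
      rw [h3]
      refine (abs_sum_le_sum_abs _ _).trans (sum_le_sum fun t _ => ?_)
      rw [abs_mul, abs_prod]
      exact mul_le_of_le_one_left (abs_nonneg _)
        (prod_le_one (fun _ _ => abs_nonneg _) fun _ _ => hb _)
    -- Grouping the tuples by their product `y` costs at most the multiplicity `τ` and makes `y`
    -- range freely over `Box`.
    have h6 : ∑ t ∈ P, |F (∏ i, t i)| ^ 2 ≤ τ * E := by
      rw [← sum_fiberwise_of_maps_to (s := P) (t := Box) (g := fun t => ∏ i, t i) hBox]
      have : ∀ y ∈ Box, ∑ t ∈ P.filter (fun t => ∏ i, t i = y), |F (∏ i, t i)| ^ 2 ≤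
          τ * F y ^ 2 := by
        intro y hy
        rw [sum_congr rfl (g := fun _ => F y ^ 2) fun t ht => by rw [(mem_filter.1 ht).2, sq_abs],
          sum_const, nsmul_eq_mul]
        exact mul_le_mul_of_nonneg_right (hτ y hy) (sq_nonneg _)
      refine (sum_le_sum this).trans ?_
      rw [← mul_sum]
      exact mul_le_mul_of_nonneg_left hF2 hτ0
    rw [← sq_abs]
    refine (pow_le_pow_left₀ (abs_nonneg _) h5 2).trans ?_
    refine (sq_sum_le_card_mul_sum_sq).trans ?_
    rw [hPc]
    nlinarith [mul_le_mul_of_nonneg_left h6 (by positivity : (0 : ℝ) ≤ (Z.card : ℝ) ^ k)]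
  calc |∑ w ∈ W, ∑ z ∈ Z, a w * b z * χ w z| ^ (2 * k)
      = (|∑ w ∈ W, ∑ z ∈ Z, a w * b z * χ w z| ^ k) ^ 2 := by rw [← pow_mul, mul_comm]
    _ ≤ ((W.card : ℝ) ^ (k - 1) * ∑ w ∈ W, |T w| ^ k) ^ 2 :=
        pow_le_pow_left₀ (by positivity) h1 2
    _ = (W.card : ℝ) ^ (2 * (k - 1)) * (∑ w ∈ W, |T w| ^ k) ^ 2 := by
        rw [mul_pow, ← pow_mul, mul_comm (k - 1)]
    _ ≤ _ := mul_le_mul_of_nonneg_left h4 (by positivity)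

/-! #### The divisor bound -/

theorem succ_le_mul_rpow {ε : ℝ} (hε : 0 < ε) (e : ℕ) :
    ((e : ℝ) + 1) ≤ max 1 (1 / (ε * Real.log 2)) * ((2 : ℝ) ^ ε) ^ e := by
  have hl : 0 < ε * Real.log 2 := mul_pos hε (Real.log_pos one_lt_two)
  have h1 : 1 + (e : ℝ) * (ε * Real.log 2) ≤ ((2 : ℝ) ^ ε) ^ e := by
    rw [← Real.rpow_natCast, ← Real.rpow_mul (by norm_num), Real.rpow_def_of_pos (by norm_num)]
    have := Real.add_one_le_exp (Real.log 2 * (ε * e))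
    linarith
  set A := max 1 (1 / (ε * Real.log 2)) with hA
  have hA1 : 1 ≤ A := le_max_left _ _
  have hA2 : 1 ≤ A * (ε * Real.log 2) := by
    rw [← div_le_iff₀ hl]; exact le_max_right _ _
  have he : (0 : ℝ) ≤ e := Nat.cast_nonneg e
  calc (e : ℝ) + 1 ≤ A * (1 + (e : ℝ) * (ε * Real.log 2)) := by nlinarith
    _ ≤ _ := mul_le_mul_of_nonneg_left h1 (by linarith)

/-- The number of divisors is at most `9 ∏ (e + 1)` over the primes `π` with exponent `e`,
associates accounting for the `9`. If `N(π) ≥ 2 ^ (1 / ε)` then `e + 1 ≤ 2 ^ e ≤ N(π) ^ (ε e)`; the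
remaining primes lie in a fixed box, and each of them loses at most the constant `A` of
`succ_le_mul_rpow`. -/
theorem exists_card_divisors_le {ε : ℝ} (hε : 0 < ε) :
    ∃ C : ℝ, 1 ≤ C ∧ ∀ (y : GaussianInt), y ≠ 0 → ∀ s : Finset GaussianInt, (∀ z ∈ s, z ∣ y) →
      (s.card : ℝ) ≤ C * (y.norm : ℝ) ^ ε := by
  classical
  let _ : StrongNormalizationMonoid GaussianInt :=
    UniqueFactorizationMonoid.strongNormalizationMonoid
  set A := max 1 (1 / (ε * Real.log 2)) with hA
  have hA1 : 1 ≤ A := le_max_left _ _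
  obtain ⟨H, hH⟩ := exists_nat_gt ((2 : ℝ) ^ (1 / ε))
  refine ⟨9 * A ^ (gaussBox H).card, by nlinarith [one_le_pow₀ hA1 (n := (gaussBox H).card)], ?_⟩
  intro y hy s hs
  set nf : GaussianInt → Multiset GaussianInt := UniqueFactorizationMonoid.normalizedFactors
  have hfib : ∀ m ∈ s.image nf, (s.filter fun z => nf z = m).card ≤ 9 := by
    intro m hm
    obtain ⟨z₀, hz₀, rfl⟩ := mem_image.1 hm
    have hz₀0 : z₀ ≠ 0 := ne_zero_of_dvd_ne_zero hy (hs z₀ hz₀)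
    have : s.filter (fun z => nf z = nf z₀) ⊆ (gaussBox 1).image fun e => z₀ * e := by
      intro z hz
      rw [mem_filter] at hz
      have hz0 : z ≠ 0 := ne_zero_of_dvd_ne_zero hy (hs z hz.1)
      have hass : Associated z₀ z :=
        (UniqueFactorizationMonoid.associated_iff_normalizedFactors_eq_normalizedFactors hz₀0
          hz0).2 hz.2.symm
      obtain ⟨e, he⟩ := hass
      refine mem_image.2 ⟨e, ?_, he⟩
      refine mem_gaussBox_of_norm_le (X := 1) (by norm_num) ?_
      have := Zsqrtd.norm_eq_one_iff.2 e.isUnit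
      push_cast
      omega
    refine (card_le_card this).trans (card_image_le.trans ?_)
    rw [card_gaussBox]; norm_num
  have hsub : s.image nf ⊆ Iic (nf y) := by
    intro m hm
    obtain ⟨z, hz, rfl⟩ := mem_image.1 hm
    rw [mem_Iic]
    exact (UniqueFactorizationMonoid.dvd_iff_normalizedFactors_le_normalizedFactors
      (ne_zero_of_dvd_ne_zero hy (hs z hz)) hy).1 (hs z hz)
  have hcard : s.card ≤ 9 * ∏ π ∈ (nf y).toFinset, ((nf y).count π + 1) := by
    rw [← Multiset.card_Iic]
    exact (card_le_mul_card_image s 9 hfib).trans (Nat.mul_le_mul_left _ (card_le_card hsub))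
  have hnorm : (y.norm : ℝ) = ∏ π ∈ (nf y).toFinset, (π.norm : ℝ) ^ ((nf y).count π) := by
    have hass := UniqueFactorizationMonoid.prod_normalizedFactors hy
    have h1 : (nf y).prod.norm = y.norm :=
      (Zsqrtd.norm_eq_of_associated (by norm_num) hass)
    rw [← h1, Finset.prod_multiset_count]
    have : ∀ (S : Finset GaussianInt) (g : GaussianInt → ℕ),
        (Zsqrtd.norm (∏ π ∈ S, π ^ g π) : ℤ) = ∏ π ∈ S, (Zsqrtd.norm π) ^ g π := by
      intro S g
      have := map_prod (Zsqrtd.normMonoidHom (d := -1)) (fun π => π ^ g π) S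
      rw [show (∏ π ∈ S, Zsqrtd.norm π ^ g π) = ∏ π ∈ S, Zsqrtd.normMonoidHom (π ^ g π) from
        prod_congr rfl fun π _ => (map_pow Zsqrtd.normMonoidHom π (g π)).symm]
      exact this
    rw [this]
    push_cast
    rfl
  have hterm : ∀ π ∈ (nf y).toFinset, (((nf y).count π : ℝ) + 1) ≤
      (if π ∈ gaussBox H then A else 1) * ((π.norm : ℝ) ^ ε) ^ ((nf y).count π) := by
    intro π hπ
    have hirr := UniqueFactorizationMonoid.irreducible_of_normalized_factor π
      (Multiset.mem_toFinset.1 hπ)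
    have h2 : (2 : ℝ) ≤ π.norm := by
      have h0 := GaussianInt.norm_pos.2 hirr.ne_zero
      have h1 : π.norm ≠ 1 := fun h => hirr.not_isUnit (by
        rw [← Zsqrtd.norm_eq_one_iff, h]; rfl)
      exact_mod_cast (by omega : (2 : ℤ) ≤ π.norm)
    split_ifs with hb
    · refine (succ_le_mul_rpow hε _).trans ?_
      gcongr
    · have h3 : (2 : ℝ) ≤ (π.norm : ℝ) ^ ε := by
        have h4 : (2 : ℝ) ^ (1 / ε) ≤ π.norm := by
          by_contra hlt
          push Not at hlt
          refine hb (mem_gaussBox_of_norm_le (X := H)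
            (by nlinarith [Nat.le_self_pow two_ne_zero H]) ?_)
          have : (π.norm : ℝ) < H := hlt.trans hH
          exact_mod_cast this.le
        calc (2 : ℝ) = ((2 : ℝ) ^ (1 / ε)) ^ ε := by
              rw [← Real.rpow_mul (by norm_num), one_div_mul_cancel hε.ne', Real.rpow_one]
          _ ≤ _ := Real.rpow_le_rpow (by positivity) h4 hε.le
      rw [one_mul]
      calc (((nf y).count π : ℝ) + 1) ≤ 2 ^ ((nf y).count π) := by
            exact_mod_cast Nat.lt_two_pow_self
        _ ≤ _ := by gcongr
  have hN0 : ∀ π : GaussianInt, (0 : ℝ) ≤ π.norm := fun π => by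
    exact_mod_cast GaussianInt.norm_nonneg π
  calc (s.card : ℝ) ≤ 9 * ∏ π ∈ (nf y).toFinset, (((nf y).count π : ℝ) + 1) := by
        exact_mod_cast hcard
    _ ≤ 9 * ∏ π ∈ (nf y).toFinset,
        ((if π ∈ gaussBox H then A else 1) * ((π.norm : ℝ) ^ ε) ^ ((nf y).count π)) := by
        gcongr with π hπ
        exact hterm π hπ
    _ = 9 * ((∏ π ∈ (nf y).toFinset, (if π ∈ gaussBox H then A else 1)) * (y.norm : ℝ) ^ ε) := by
        rw [prod_mul_distrib, hnorm, ← Real.finsetProd_rpow _ _ fun π _ => pow_nonneg (hN0 π) _]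
        congr 2
        refine prod_congr rfl fun π _ => ?_
        rw [← Real.rpow_natCast, ← Real.rpow_natCast, ← Real.rpow_mul (hN0 π),
          ← Real.rpow_mul (hN0 π), mul_comm]
    _ ≤ 9 * (A ^ (gaussBox H).card * (y.norm : ℝ) ^ ε) := by
        have : ∏ π ∈ (nf y).toFinset, (if π ∈ gaussBox H then A else 1) ≤
            A ^ (gaussBox H).card := by
          rw [prod_ite, prod_const, prod_const_one, mul_one]
          exact pow_le_pow_right₀ hA1 (card_le_card fun π hπ => (mem_filter.1 hπ).2)
        have h0 : (0 : ℝ) ≤ (y.norm : ℝ) ^ ε := Real.rpow_nonneg (hN0 y) _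
        gcongr
    _ = _ := by ring

end GaussianSpin

/-! ### Incomplete sums of periodic functions -/

namespace GaussianSpin

open Finset

theorem sum_range_add_eq_of_periodic {f : ℤ → ℝ} {Q : ℕ} (hf : ∀ i, f (i + Q) = f i) (A : ℤ) :
    ∑ i ∈ range Q, f (A + i) = ∑ i ∈ range Q, f i := by
  have step : ∀ A : ℤ, ∑ i ∈ range Q, f (A + 1 + i) = ∑ i ∈ range Q, f (A + i) := by
    intro A
    have h1 := sum_range_succ (fun i : ℕ => f (A + i)) Q
    have h2 := sum_range_succ' (fun i : ℕ => f (A + i)) Q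
    rw [h1] at h2
    rw [hf A, Nat.cast_zero, add_zero] at h2
    have h3 := add_right_cancel h2
    rw [h3]
    refine sum_congr rfl fun i _ => ?_
    push_cast; congr 1; ring
  induction A using Int.induction_on with
  | zero => simp
  | succ n ih => rw [step, ih]
  | pred n ih => rw [← ih, ← step, sub_add_cancel]

theorem sum_range_mul_of_periodic {f : ℤ → ℝ} {Q : ℕ} (hf : ∀ i, f (i + Q) = f i) (m : ℕ) :
    ∑ i ∈ range (Q * m), f i = m * ∑ i ∈ range Q, f i := by
  induction m with
  | zero => simp
  | succ m ih =>
    rw [Nat.mul_succ, sum_range_add, ih]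
    have := sum_range_add_eq_of_periodic hf ((Q * m : ℕ) : ℤ)
    push_cast at this ⊢
    rw [this]; ring

/-- A sum of a periodic function over an interval is the number of complete periods times the
sum over a period, up to one period. -/
theorem abs_sum_Ico_sub_le_of_periodic {f : ℤ → ℝ} {Q : ℕ} (hQ : 0 < Q)
    (hf : ∀ i, f (i + Q) = f i) {M : ℝ} (hM : ∀ i, |f i| ≤ M) (A : ℤ) (L : ℕ) :
    |∑ i ∈ range L, f (A + i) - (L / Q : ℕ) * ∑ i ∈ range Q, f i| ≤ Q * M := by
  have hg : ∀ i, (fun i => f (A + i)) (i + Q) = (fun i => f (A + i)) i := fun i => by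
    simp only; rw [← add_assoc, hf]
  have h1 := sum_range_mul_of_periodic (f := fun i => f (A + i)) hg (L / Q)
  rw [sum_range_add_eq_of_periodic hf A] at h1
  have hL := Nat.div_add_mod L Q
  conv_lhs => rw [← hL, sum_range_add, h1]
  rw [Nat.mul_add_div hQ, Nat.div_eq_of_lt (Nat.mod_lt _ hQ), add_zero, add_sub_cancel_left]
  refine (abs_sum_le_sum_abs _ _).trans ((sum_le_card_nsmul _ _ M fun i _ => hM _).trans ?_)
  rw [card_range, nsmul_eq_mul]
  have hM0 : 0 ≤ M := (abs_nonneg _).trans (hM 0)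
  gcongr
  exact (Nat.mod_lt _ hQ).le

theorem sum_Icc_eq_sum_range (H : ℕ) (f : ℤ → ℝ) :
    ∑ i ∈ Icc (-(H : ℤ)) H, f i = ∑ i ∈ range (2 * H + 1), f (-(H : ℤ) + i) := by
  symm
  refine sum_bij (fun i _ => -(H : ℤ) + i) ?_ ?_ ?_ ?_
  · intro i hi; rw [mem_range] at hi; rw [mem_Icc]; omega
  · intro i _ j _ h; omega
  · intro b hb
    rw [mem_Icc] at hb
    exact ⟨(b + H).toNat, by rw [mem_range]; omega, by omega⟩
  · intros; rfl

theorem abs_sum_Icc_le_of_periodic {f : ℤ → ℝ} {Q : ℕ} (hQ : 0 < Q)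
    (hf : ∀ i, f (i + Q) = f i) {M : ℝ} (hM : ∀ i, |f i| ≤ M) (h0 : ∑ i ∈ range Q, f i = 0)
    (H : ℕ) : |∑ i ∈ Icc (-(H : ℤ)) H, f i| ≤ Q * M := by
  have := abs_sum_Ico_sub_le_of_periodic hQ hf hM (-(H : ℤ)) (2 * H + 1)
  rwa [h0, mul_zero, sub_zero, ← sum_Icc_eq_sum_range] at this

/-- The two-dimensional version, over a square. -/
theorem abs_sum_gaussBox_le_of_periodic {f : GaussianInt → ℝ} {Q : ℕ} (hQ : 0 < Q)
    (hf₁ : ∀ a b, f ⟨a + Q, b⟩ = f ⟨a, b⟩) (hf₂ : ∀ a b, f ⟨a, b + Q⟩ = f ⟨a, b⟩)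
    (hM : ∀ z, |f z| ≤ 1) (h0 : ∑ a ∈ range Q, ∑ b ∈ range Q, f ⟨a, b⟩ = 0) (H : ℕ) :
    |∑ z ∈ gaussBox H, f z| ≤ 2 * (2 * H + 1) * Q := by
  rw [sum_gaussBox]
  set L := 2 * H + 1 with hL
  set P : ℤ → ℝ := fun a => ∑ b ∈ range Q, f ⟨a, b⟩ with hP
  have hP1 : ∀ a, |P a| ≤ Q := fun a =>
    (abs_sum_le_sum_abs _ _).trans ((sum_le_card_nsmul _ _ 1 fun i _ => hM _).trans (by simp))
  -- Each row is a number of complete periods, the same for all rows, up to an error `Q`. The period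
  -- sums `P a` are themselves periodic with total zero.
  have h1 : ∀ a : ℤ, |∑ b ∈ Icc (-(H : ℤ)) H, f ⟨a, b⟩ - (L / Q : ℕ) * P a| ≤ Q := by
    intro a
    have := abs_sum_Ico_sub_le_of_periodic (f := fun b => f ⟨a, b⟩) hQ (hf₂ a) (fun i => hM _)
      (-(H : ℤ)) L
    rwa [hL, ← sum_Icc_eq_sum_range H (fun b => f ⟨a, b⟩), mul_one] at this
  have h2 := abs_sum_Icc_le_of_periodic (f := P) hQ
    (fun a => sum_congr rfl fun b _ => hf₁ a b) hP1 h0 H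
  have h3 : |∑ a ∈ Icc (-(H : ℤ)) H, (∑ b ∈ Icc (-(H : ℤ)) H, f ⟨a, b⟩ - (L / Q : ℕ) * P a)| ≤
      L * Q := by
    refine (abs_sum_le_sum_abs _ _).trans ((sum_le_card_nsmul _ _ (Q : ℝ) fun a _ => h1 a).trans ?_)
    rw [Int.card_Icc, nsmul_eq_mul, show ((H : ℤ) + 1 - -(H : ℤ)).toNat = L by omega]
  rw [sum_sub_distrib, ← mul_sum] at h3
  have h4 : |((L / Q : ℕ) : ℝ) * ∑ a ∈ Icc (-(H : ℤ)) H, P a| ≤ L * Q := by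
    rw [abs_mul, Nat.abs_cast]
    have h5 : ((L / Q : ℕ) : ℝ) * Q ≤ L := by exact_mod_cast Nat.div_mul_le_self L Q
    calc ((L / Q : ℕ) : ℝ) * |∑ a ∈ Icc (-(H : ℤ)) H, P a| ≤ ((L / Q : ℕ) : ℝ) * (Q * Q) := by
          gcongr
      _ = ((L / Q : ℕ) : ℝ) * Q * Q := by ring
      _ ≤ L * Q := by gcongr
  have hLc : (2 * (H : ℝ) + 1) = L := by rw [hL]; push_cast; ring
  rw [hLc]
  rw [abs_le] at *
  constructor <;> linarith [h3.1, h3.2, h4.1, h4.2]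

theorem sum_range_mul_eq_of_coprime {f : ℤ → ℝ} {Q : ℕ} (hQ : 0 < Q)
    (hf : ∀ i, f (i + Q) = f i) {t : ℤ} (ht : IsCoprime t Q) :
    ∑ i ∈ range Q, f (t * i) = ∑ i ∈ range Q, f i := by
  have hQ' : (0 : ℤ) < Q := by exact_mod_cast hQ
  have hmod : ∀ i : ℤ, f (i % Q) = f i := by
    have hper : Function.Periodic f (Q : ℤ) := hf
    intro i
    have := hper.int_mul (i / Q) (i % Q)
    rw [← this]
    congr 1
    have := Int.emod_add_mul_ediv i Q
    push_cast
    linarith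
  have hmaps : Set.MapsTo (fun i : ℕ => ((t * i) % Q).toNat) (range Q) (range Q) := by
    intro i _
    rw [coe_range, Set.mem_Iio]
    have h1 := Int.emod_lt_of_pos (t * i) hQ'
    show ((t * i) % Q).toNat < Q
    omega
  have hinj : Set.InjOn (fun i : ℕ => ((t * i) % Q).toNat) (range Q) := by
    intro i hi j hj hij
    rw [coe_range, Set.mem_Iio] at hi hj
    have h1 := Int.emod_nonneg (t * i) hQ'.ne'
    have h2 := Int.emod_nonneg (t * j) hQ'.ne'
    have h3 : (t * i) % Q = (t * j) % Q := by simp only at hij; omega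
    have h4 : (Q : ℤ) ∣ t * (j - i) := by
      rw [mul_sub]
      exact Int.modEq_iff_dvd.1 h3
    have h5 : (Q : ℤ) ∣ j - i := ht.symm.dvd_of_dvd_mul_left h4
    have h6 := Int.eq_zero_of_abs_lt_dvd h5 (by rw [abs_lt]; omega)
    omega
  refine sum_nbij _ (fun i hi => hmaps hi) hinj
    (Finset.surjOn_of_injOn_of_card_le _ hmaps hinj le_rfl) ?_
  intro i _
  rw [← hmod]
  congr 1
  exact (Int.toNat_of_nonneg (Int.emod_nonneg (t * i) hQ'.ne')).symm

/-- An odd number that is not a square has a residue class with Jacobi symbol `-1`. -/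
theorem exists_jacobiSym_eq_neg_one {n : ℕ} (hn : n % 2 = 1) (hsq : ¬ IsSquare n) :
    ∃ t : ℤ, IsCoprime t n ∧ jacobiSym t n = -1 := by
  -- Write `n = b² a` with `a` squarefree and `a = p c`: a nonresidue modulo `p` that is `1` modulo
  -- `c` has symbol `-1`, provided it is prime to `b`.
  obtain ⟨a, b, hab, ha⟩ := Nat.sq_mul_squarefree n
  have ha1 : a ≠ 1 := by
    rintro rfl
    exact hsq ⟨b, by rw [← hab]; ring⟩
  obtain ⟨p, hp, c, rfl⟩ := Nat.exists_prime_and_dvd ha1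
  have hb0 : b ≠ 0 := by rintro rfl; simp at hab; omega
  have hc0 : c ≠ 0 := by rintro rfl; simp at hab; omega
  have : Fact p.Prime := ⟨hp⟩
  have hp2 : p ≠ 2 := by
    rintro rfl
    rw [← hab, show b ^ 2 * (2 * c) = 2 * (b ^ 2 * c) by ring] at hn
    omega
  have hpc : Nat.Coprime p c := Nat.coprime_of_squarefree_mul ha
  obtain ⟨x, hx⟩ := FiniteField.exists_nonsquare (F := ZMod p) (by rwa [ZMod.ringChar_zmod_n])
  obtain ⟨e, he1, he2⟩ := Nat.chineseRemainder hpc x.val 1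
  have hep : ((e : ℤ) : ZMod p) = x := by
    have := (ZMod.natCast_eq_natCast_iff _ _ _).2 he1
    rw [ZMod.natCast_zmod_val] at this
    exact_mod_cast this
  have hec : Nat.Coprime e c := by
    have := he2.gcd_eq
    rwa [Nat.gcd_one_left] at this
  have hecp : Nat.Coprime e p := by
    rw [Nat.coprime_comm, Nat.Prime.coprime_iff_not_dvd hp]
    intro hd
    apply hx
    rw [← hep, Int.cast_natCast, (ZMod.natCast_eq_zero_iff _ _).2 hd]
    exact IsSquare.zero
  -- A prime larger than `n` in the prescribed class is automatically coprime to `n`, and so to `b`.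
  obtain ⟨t, htn, htp, htm⟩ := Nat.forall_exists_prime_gt_and_modEq n (q := p * c) (a := e)
    (mul_ne_zero hp.ne_zero hc0) (hecp.mul_right hec)
  have htn' : Nat.Coprime t n := by
    rw [Nat.Prime.coprime_iff_not_dvd htp]
    intro hd
    exact absurd (Nat.le_of_dvd (by omega) hd) (by omega)
  refine ⟨t, Nat.isCoprime_iff_coprime.2 htn', ?_⟩
  have : NeZero p := ⟨hp.ne_zero⟩
  have : NeZero c := ⟨hc0⟩
  have : NeZero b := ⟨hb0⟩
  have htb : Nat.Coprime t b := Nat.Coprime.coprime_dvd_right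
    ⟨b * (p * c), by rw [← hab]; ring⟩ htn'
  rw [← hab, jacobiSym.mul_right' _ (pow_ne_zero 2 hb0) (mul_ne_zero hp.ne_zero hc0),
    jacobiSym.mul_right, jacobiSym.pow_right, jacobiSym.sq_one (by simpa using htb), one_mul]
  have h1 : jacobiSym t p = -1 := by
    rw [ZMod.nonsquare_iff_jacobiSym_eq_neg_one]
    have : ((t : ℤ) : ZMod p) = x := by
      rw [← hep, Int.cast_natCast, Int.cast_natCast]
      exact (ZMod.natCast_eq_natCast_iff _ _ _).2 (htm.of_mul_right c)
    rwa [this]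
  have h2 : jacobiSym t c = 1 := by
    have h3 : t ≡ 1 [MOD c] := (htm.of_mul_left p).trans he2
    rw [jacobiSym.mod_left' (a₂ := 1) (by exact_mod_cast h3), jacobiSym.one_left]
  rw [h1, h2]; norm_num

end GaussianSpin

/-! ### Bilinear forms in quadratic symbols -/

namespace GaussianSpin

open Finset

theorem abs_jacobiSym_le_one (a : ℤ) (n : ℕ) : |(jacobiSym a n : ℝ)| ≤ 1 := by
  rcases jacobiSym.trichotomy a n with h | h | h <;> rw [h] <;> norm_num

/-- Pairs whose product of norms is a square are rare. -/
theorem exists_card_square_pairs_le {ε : ℝ} (hε : 0 < ε) :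
    ∃ C : ℝ, 1 ≤ C ∧ ∀ {γ : Type} [DecidableEq γ] (A : Finset γ) (ν : γ → ℕ) (ι : γ → GaussianInt)
      (P : ℕ), Function.Injective ι → (∀ g ∈ A, 1 ≤ ν g ∧ ν g ≤ P ∧ ι g ∣ (ν g : GaussianInt)) →
      (((A ×ˢ A).filter fun p => IsSquare (ν p.1 * ν p.2)).card : ℝ) ≤ C * (P : ℝ) ^ (1 + ε) := by
  -- If the product of the two norms is `m²`, then `m ≤ P` and both members of the pair divide `m²`.
  -- The norm of `m²` is `m ^ 4`, so the exponent `ε / 8` gives `m ^ (ε / 2)` divisors and `m ^ ε`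
  -- pairs for each `m`.
  obtain ⟨C, hC1, hC⟩ := exists_card_divisors_le (ε := ε / 8) (by positivity)
  refine ⟨C ^ 2, one_le_pow₀ hC1, ?_⟩
  intro γ _ A ν ι P hι hA
  classical
  have hsub : ((A ×ˢ A).filter fun p => IsSquare (ν p.1 * ν p.2)) ⊆
      (Icc 1 P).biUnion fun m => (A.filter fun g => ι g ∣ ((m ^ 2 : ℕ) : GaussianInt)) ×ˢ
        (A.filter fun g => ι g ∣ ((m ^ 2 : ℕ) : GaussianInt)) := by
    intro p hp
    rw [mem_filter, mem_product] at hp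
    obtain ⟨⟨h1, h2⟩, m, hm⟩ := hp
    obtain ⟨a1, a2, a3⟩ := hA _ h1
    obtain ⟨b1, b2, b3⟩ := hA _ h2
    have hm' : ((m ^ 2 : ℕ) : GaussianInt) = (ν p.1 : GaussianInt) * ν p.2 := by
      rw [sq, ← hm]; push_cast; rfl
    rw [mem_biUnion]
    refine ⟨m, ?_, ?_⟩
    · rw [mem_Icc]
      constructor
      · by_contra h
        have : m = 0 := by omega
        rw [this] at hm
        have := Nat.mul_pos a1 b1
        omega
      · by_contra h
        have : P * P < m * m := Nat.mul_self_lt_mul_self (by omega)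
        have := Nat.mul_le_mul a2 b2
        omega
    · rw [mem_product, mem_filter, mem_filter, hm']
      exact ⟨⟨h1, a3.mul_right _⟩, h2, b3.mul_left _⟩
  have hfib : ∀ m ∈ Icc 1 P, ((A.filter fun g => ι g ∣ ((m ^ 2 : ℕ) : GaussianInt)).card : ℝ) ≤
      C * (P : ℝ) ^ (ε / 2) := by
    intro m hm
    rw [mem_Icc] at hm
    have h0 : ((m ^ 2 : ℕ) : GaussianInt) ≠ 0 := by
      rw [Ne, Nat.cast_eq_zero]
      have : 0 < m ^ 2 := by have := hm.1; positivity
      omega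
    have h1 := hC _ h0 ((A.filter fun g => ι g ∣ ((m ^ 2 : ℕ) : GaussianInt)).image ι) (by
      intro z hz
      obtain ⟨g, hg, rfl⟩ := mem_image.1 hz
      exact (mem_filter.1 hg).2)
    rw [card_image_of_injective _ hι] at h1
    refine h1.trans ?_
    have h2 : ((Zsqrtd.norm ((m ^ 2 : ℕ) : GaussianInt) : ℤ) : ℝ) = (m : ℝ) ^ (4 : ℝ) := by
      rw [Zsqrtd.norm_natCast]; push_cast
      rw [show (4 : ℝ) = ((4 : ℕ) : ℝ) by norm_num, Real.rpow_natCast]; ring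
    rw [h2, ← Real.rpow_mul (Nat.cast_nonneg m), show 4 * (ε / 8) = ε / 2 by ring]
    have : (m : ℝ) ≤ P := by exact_mod_cast hm.2
    gcongr
  have hP0 : (0 : ℝ) ≤ (P : ℝ) := Nat.cast_nonneg P
  rcases Nat.eq_zero_or_pos P with rfl | hPpos
  · have : ((A ×ˢ A).filter fun p => IsSquare (ν p.1 * ν p.2)) = ∅ := by
      refine subset_empty.1 (hsub.trans ?_); simp
    rw [this]; simp; positivity
  calc (((A ×ˢ A).filter fun p => IsSquare (ν p.1 * ν p.2)).card : ℝ)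
      ≤ ∑ m ∈ Icc 1 P, (((A.filter fun g => ι g ∣ ((m ^ 2 : ℕ) : GaussianInt)) ×ˢ
        (A.filter fun g => ι g ∣ ((m ^ 2 : ℕ) : GaussianInt))).card : ℝ) := by
        exact_mod_cast (card_le_card hsub).trans card_biUnion_le
    _ ≤ ∑ m ∈ Icc 1 P, (C * (P : ℝ) ^ (ε / 2)) ^ 2 := by
        refine sum_le_sum fun m hm => ?_
        rw [card_product, Nat.cast_mul, sq (C * _)]
        exact mul_self_le_mul_self (Nat.cast_nonneg _) (hfib m hm)
    _ = C ^ 2 * (P : ℝ) ^ (1 + ε) := by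
        rw [sum_const, Nat.card_Icc, nsmul_eq_mul, Nat.add_sub_cancel, mul_pow,
          ← Real.rpow_natCast ((P : ℝ) ^ (ε / 2)), ← Real.rpow_mul hP0,
          Real.rpow_add (by exact_mod_cast hPpos), Real.rpow_one]
        rw [show ε / 2 * ((2 : ℕ) : ℝ) = ε by push_cast; ring]
        ring

/-- Splitting a double sum of correlations into square pairs and the others. -/
theorem sum_sum_abs_le_of_square_pairs {γ : Type} [DecidableEq γ] (A : Finset γ) (ν : γ → ℕ)
    (c : γ → γ → ℝ) {N D O : ℝ} (hO : 0 ≤ O) (hD : 0 ≤ D)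
    (hN : (((A ×ˢ A).filter fun p => IsSquare (ν p.1 * ν p.2)).card : ℝ) ≤ N)
    (h1 : ∀ g ∈ A, ∀ g' ∈ A, |c g g'| ≤ D)
    (h2 : ∀ g ∈ A, ∀ g' ∈ A, ¬ IsSquare (ν g * ν g') → |c g g'| ≤ O) :
    ∑ g ∈ A, ∑ g' ∈ A, |c g g'| ≤ N * D + (A.card : ℝ) ^ 2 * O := by
  rw [← sum_product', ← sum_filter_add_sum_filter_not (A ×ˢ A)
    (fun p => IsSquare (ν p.1 * ν p.2))]
  refine add_le_add ?_ ?_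
  · refine (sum_le_card_nsmul _ _ D fun p hp => ?_).trans ?_
    · rw [mem_filter, mem_product] at hp
      exact h1 _ hp.1.1 _ hp.1.2
    · rw [nsmul_eq_mul]
      exact mul_le_mul_of_nonneg_right hN hD
  · refine (sum_le_card_nsmul _ _ O fun p hp => ?_).trans ?_
    · rw [mem_filter, mem_product] at hp
      exact h2 _ hp.1.1 _ hp.1.2 hp.2
    · rw [nsmul_eq_mul]
      refine mul_le_mul_of_nonneg_right ?_ hO
      have := card_filter_le (A ×ˢ A) (fun p => ¬ IsSquare (ν p.1 * ν p.2))
      rw [card_product] at this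
      rw [sq]
      exact_mod_cast this

/-- Every member of a tuple divides the product of the tuple; this reduces the multiplicity `τ` of
the moment inequality to the divisor bound. -/
theorem card_fiber_prod_le {β : Type*} [CommMonoid β] [DecidableEq β] (Z : Finset β) (k : ℕ)
    (y : β) (D : Finset β) (hD : ∀ z ∈ Z, z ∣ y → z ∈ D) :
    ((Fintype.piFinset (fun _ : Fin k => Z)).filter fun t => ∏ i, t i = y).card ≤ D.card ^ k := by
  have : ((Fintype.piFinset (fun _ : Fin k => Z)).filter fun t => ∏ i, t i = y) ⊆
      Fintype.piFinset (fun _ : Fin k => D) := by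
    intro t ht
    rw [mem_filter, Fintype.mem_piFinset] at ht
    rw [Fintype.mem_piFinset]
    intro i
    exact hD _ (ht.1 i) (ht.2 ▸ dvd_prod_of_mem t (mem_univ i))
  refine (card_le_card this).trans ?_
  rw [Fintype.card_piFinset]; simp

open Classical in
/-- The primitive primary Gaussian integers of norm at most `P`. -/
noncomputable def primitiveBall (P : ℕ) : Finset GaussianInt :=
  (primaryBall P).filter fun w => IsCoprime w.re w.im

theorem mem_primitiveBall {P : ℕ} {w : GaussianInt} :
    w ∈ primitiveBall P ↔ IsPrimary w ∧ w.norm ≤ P ∧ IsCoprime w.re w.im := by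
  rw [primitiveBall, mem_filter, mem_primaryBall, and_assoc]

theorem quadSym_congr {w z z' : GaussianInt} (h : w.norm ∣ (w * z).re - (w * z').re) :
    quadSym w z = quadSym w z' :=
  jacobiSym_natAbs_congr h

/-- Correlations of two quadratic symbols whose moduli have non-square product of norms. -/
theorem abs_sum_gaussBox_quadSym_mul_le {w₁ w₂ : GaussianInt} (h₁ : IsPrimary w₁)
    (h₂ : IsPrimary w₂) (hc₁ : IsCoprime w₁.re w₁.im) (hc₂ : IsCoprime w₂.re w₂.im)
    (hsq : ¬ IsSquare (w₁.norm.natAbs * w₂.norm.natAbs)) (H : ℕ) :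
    |∑ z ∈ gaussBox H, (quadSym w₁ z : ℝ) * quadSym w₂ z| ≤
      2 * (2 * H + 1) * ((w₁.norm.natAbs * w₂.norm.natAbs : ℕ) : ℝ) := by
  set Q := w₁.norm.natAbs * w₂.norm.natAbs with hQ
  have hn₁ := h₁.natAbs_norm_mod_four
  have hn₂ := h₂.natAbs_norm_mod_four
  have hQpos : 0 < Q := Nat.mul_pos (by omega) (by omega)
  have hQ1 : w₁.norm ∣ (Q : ℤ) := by
    rw [hQ]; push_cast
    rw [abs_of_pos h₁.norm_pos]; exact dvd_mul_right _ _
  have hQ2 : w₂.norm ∣ (Q : ℤ) := by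
    rw [hQ]; push_cast
    rw [abs_of_pos h₂.norm_pos]; exact dvd_mul_left _ _
  have per : ∀ w : GaussianInt, w.norm ∣ (Q : ℤ) → ∀ z d : GaussianInt, (Q : ℤ) ∣ d.re →
      (Q : ℤ) ∣ d.im → quadSym w (z + d) = quadSym w z := by
    intro w hw z d hd1 hd2
    refine quadSym_congr ?_
    rw [mul_add, Zsqrtd.re_add, add_sub_cancel_left, re_mul]
    exact dvd_sub ((hw.trans hd1).mul_left _) ((hw.trans hd2).mul_left _)
  have e1 : ∀ a b : ℤ, (⟨a + Q, b⟩ : GaussianInt) = ⟨a, b⟩ + ⟨Q, 0⟩ := by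
    intro a b; ext <;> simp
  have e2 : ∀ a b : ℤ, (⟨a, b + Q⟩ : GaussianInt) = ⟨a, b⟩ + ⟨0, Q⟩ := by
    intro a b; ext <;> simp
  have hper1 : ∀ a b : ℤ, (quadSym w₁ ⟨a + Q, b⟩ : ℝ) * quadSym w₂ ⟨a + Q, b⟩ =
      quadSym w₁ ⟨a, b⟩ * quadSym w₂ ⟨a, b⟩ := by
    intro a b
    rw [e1, per w₁ hQ1 _ _ (by simp) (by simp), per w₂ hQ2 _ _ (by simp) (by simp)]
  have hper2 : ∀ a b : ℤ, (quadSym w₁ ⟨a, b + Q⟩ : ℝ) * quadSym w₂ ⟨a, b + Q⟩ =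
      quadSym w₁ ⟨a, b⟩ * quadSym w₂ ⟨a, b⟩ := by
    intro a b
    rw [e2, per w₁ hQ1 _ _ (by simp) (by simp), per w₂ hQ2 _ _ (by simp) (by simp)]
  refine abs_sum_gaussBox_le_of_periodic hQpos hper1 hper2 ?_ ?_ H
  · intro z
    rw [abs_mul]
    exact mul_le_one₀ (abs_jacobiSym_le_one _ _) (abs_nonneg _) (abs_jacobiSym_le_one _ _)
  · have hodd : Q % 2 = 1 := by
      rw [hQ, Nat.mul_mod, show w₁.norm.natAbs % 2 = 1 by omega,
        show w₂.norm.natAbs % 2 = 1 by omega]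
    -- Multiplication by a rational integer `t` with `(t / Q) = -1` permutes the residues modulo `Q`
    -- and changes the sign of every term, so the complete sum is zero.
    obtain ⟨t, htc, ht⟩ := exists_jacobiSym_eq_neg_one hodd hsq
    have ht' : jacobiSym t w₁.norm.natAbs * jacobiSym t w₂.norm.natAbs = -1 := by
      rwa [hQ, jacobiSym.mul_right' _ (by omega) (by omega)] at ht
    have hscale : ∀ a b : ℤ, (quadSym w₁ ⟨t * a, t * b⟩ : ℝ) * quadSym w₂ ⟨t * a, t * b⟩ =
        -(quadSym w₁ ⟨a, b⟩ * quadSym w₂ ⟨a, b⟩) := by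
      intro a b
      have e : (⟨t * a, t * b⟩ : GaussianInt) = (t : GaussianInt) * ⟨a, b⟩ := by
        ext
        · rw [re_mul]; simp
        · rw [im_mul]; simp
      rw [e, quadSym_mul h₁ hc₁, quadSym_mul h₂ hc₂, quadSym_intCast h₁ hc₁,
        quadSym_intCast h₂ hc₂]
      have h3 : (jacobiSym t w₁.norm.natAbs : ℝ) * jacobiSym t w₂.norm.natAbs = -1 := by
        exact_mod_cast ht'
      push_cast
      linear_combination (quadSym w₁ ⟨a, b⟩ : ℝ) * quadSym w₂ ⟨a, b⟩ * h3
    set f : ℤ → ℤ → ℝ := fun a b => (quadSym w₁ ⟨a, b⟩ : ℝ) * quadSym w₂ ⟨a, b⟩ with hf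
    have h1 : ∑ a ∈ range Q, ∑ b ∈ range Q, f a b = ∑ a ∈ range Q, ∑ b ∈ range Q,
        f (t * a) (t * b) := by
      have h4 := sum_range_mul_eq_of_coprime (f := fun a => ∑ b ∈ range Q, f a b) hQpos
        (fun a => sum_congr rfl fun b _ => hper1 a b) htc
      rw [← h4]
      refine sum_congr rfl fun a _ => ?_
      exact (sum_range_mul_eq_of_coprime (f := fun b => f (t * a) b) hQpos
        (fun b => hper2 _ b) htc).symm
    have h2 : ∑ a ∈ range Q, ∑ b ∈ range Q, f (t * a) (t * b) =
        -∑ a ∈ range Q, ∑ b ∈ range Q, f a b := by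
      rw [← sum_neg_distrib]
      refine sum_congr rfl fun a _ => ?_
      rw [← sum_neg_distrib]
      exact sum_congr rfl fun b _ => hscale a b
    rw [h2] at h1
    have : ∑ a ∈ range Q, ∑ b ∈ range Q, f a b = 0 := by linarith
    exact this

theorem abs_le_of_pow_two_mul_le {x B : ℝ} {k : ℕ} (hk : 1 ≤ k) (hB : 0 ≤ B)
    (h : |x| ^ (2 * k) ≤ B ^ (2 * k)) : |x| ≤ B :=
  le_of_pow_le_pow_left₀ (by omega) hB h

/-- The bilinear form in the quadratic symbol, in terms of its `2k`-th power. -/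
theorem exists_bilinBound_quadSym {k : ℕ} (hk : 1 ≤ k) {ε : ℝ} (hε : 0 < ε) :
    ∃ C : ℝ, 1 ≤ C ∧ ∀ (P Q : ℕ) (B : ℝ), 1 ≤ P → 1 ≤ Q → 0 ≤ B →
      C * ((P : ℝ) * Q) ^ ε * ((P : ℝ) * Q) ^ (2 * k) * ((P : ℝ)⁻¹ + P ^ 2 / (√(Q : ℝ)) ^ k) ≤
        B ^ (2 * k) →
      BilinBound (primitiveBall P) (primaryBall Q) (fun w z => (quadSym w z : ℝ)) B := by
  have hk0 : (0 : ℝ) < k := by exact_mod_cast hk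
  -- The divisor bound is used for norms up to `2 Q ^ k` and then raised to the power `k`, which
  -- costs `Q ^ (k² ε₁)`.
  set ε₁ : ℝ := ε / (k ^ 2 + 1) with hε₁
  have hε₁0 : 0 < ε₁ := by positivity
  have hε₁1 : ε₁ ≤ ε := div_le_self hε.le (by nlinarith)
  have hε₁2 : (k : ℝ) * (k * ε₁) ≤ ε := by
    rw [hε₁, ← mul_assoc, ← mul_div_assoc, div_le_iff₀ (by positivity)]; nlinarith
  obtain ⟨C₁, hC₁1, hC₁⟩ := exists_card_divisors_le hε₁0
  obtain ⟨C₂, hC₂1, hC₂⟩ := exists_card_square_pairs_le hε₁0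
  refine ⟨9 ^ (2 * (k - 1)) * (C₁ ^ k * 2 ^ (k * ε₁)) * 9 ^ k * (9 * C₂ + 486), ?_, ?_⟩
  · have h1 : (1 : ℝ) ≤ 9 ^ (2 * (k - 1)) := one_le_pow₀ (by norm_num)
    have h2 : (1 : ℝ) ≤ C₁ ^ k := one_le_pow₀ hC₁1
    have h3 : (1 : ℝ) ≤ 2 ^ (k * ε₁) := Real.one_le_rpow (by norm_num) (by positivity)
    have h4 : (1 : ℝ) ≤ 9 ^ k := one_le_pow₀ (by norm_num)
    have h5 : (1 : ℝ) ≤ 9 * C₂ + 486 := by linarith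
    exact one_le_mul_of_one_le_of_one_le (one_le_mul_of_one_le_of_one_le
      (one_le_mul_of_one_le_of_one_le h1 (one_le_mul_of_one_le_of_one_le h2 h3)) h4) h5
  intro P Q B hP hQ hB hbound a b ha hb
  refine abs_le_of_pow_two_mul_le hk hB (le_trans ?_ hbound)
  have hP' : (1 : ℝ) ≤ P := by exact_mod_cast hP
  have hQ' : (1 : ℝ) ≤ Q := by exact_mod_cast hQ
  have hP0 : (0 : ℝ) < P := by linarith
  have hQ0 : (0 : ℝ) < Q := by linarith
  -- The square of half-side `H` contains every product of `k` elements of norm at most `Q`.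
  set H := Nat.sqrt (Q ^ k) with hH
  set q : ℝ := √(Q : ℝ) ^ k with hq
  have hq1 : 1 ≤ q := one_le_pow₀ (Real.one_le_sqrt.2 hQ')
  have hqq : q ^ 2 = (Q : ℝ) ^ k := by
    rw [hq, ← pow_mul, mul_comm, pow_mul, Real.sq_sqrt hQ0.le]
  have hHq : (H : ℝ) ≤ q := by
    have h1 : (H : ℝ) ^ 2 ≤ q ^ 2 := by
      rw [hqq]; exact_mod_cast Nat.sqrt_le' (Q ^ k)
    exact le_of_sq_le_sq h1 (by linarith)
  have h2H : 2 * (H : ℝ) + 1 ≤ 3 * q := by linarith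
  have hprim : ∀ t ∈ Fintype.piFinset (fun _ : Fin k => primaryBall Q),
      (∏ i, t i).norm ≤ (Q : ℤ) ^ k ∧ ∏ i, t i ≠ 0 := by
    intro t ht
    rw [Fintype.mem_piFinset] at ht
    constructor
    · have h1 : (∏ i, t i).norm = ∏ i, (t i).norm := map_prod Zsqrtd.normMonoidHom t univ
      rw [h1]
      refine (prod_le_prod (fun i _ => GaussianInt.norm_nonneg _) fun i _ =>
        (mem_primaryBall.1 (ht i)).2).trans_eq ?_
      simp
    · exact prod_ne_zero_iff.2 fun i _ => (mem_primaryBall.1 (ht i)).1.ne_zero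
  have hτ : ∀ y ∈ gaussBox H, (((Fintype.piFinset (fun _ : Fin k => primaryBall Q)).filter
      fun t => ∏ i, t i = y).card : ℝ) ≤ C₁ ^ k * 2 ^ (k * ε₁) * (Q : ℝ) ^ ε := by
    intro y hy
    have hpos : 0 ≤ C₁ ^ k * 2 ^ (k * ε₁) * (Q : ℝ) ^ ε := by positivity
    by_cases hy0 : y = 0
    · have : ((Fintype.piFinset (fun _ : Fin k => primaryBall Q)).filter
          fun t => ∏ i, t i = y) = ∅ := by
        rw [filter_eq_empty_iff]
        intro t ht h
        exact (hprim t ht).2 (h.trans hy0)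
      rw [this]; simpa using hpos
    · classical
      have h1 := card_fiber_prod_le (primaryBall Q) k y ((primaryBall Q).filter fun z => z ∣ y)
        (fun z hz hd => mem_filter.2 ⟨hz, hd⟩)
      have h2 := hC₁ y hy0 ((primaryBall Q).filter fun z => z ∣ y)
        (fun z hz => (mem_filter.1 hz).2)
      have h3 : (y.norm : ℝ) ≤ 2 * (Q : ℝ) ^ k := by
        rw [norm_eq]; push_cast
        rw [mem_gaussBox] at hy
        have e1 : (y.re : ℝ) ^ 2 ≤ H ^ 2 := by
          have : y.re ^ 2 ≤ (H : ℤ) ^ 2 := sq_le_sq' hy.1.1 hy.1.2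
          exact_mod_cast this
        have e2 : (y.im : ℝ) ^ 2 ≤ H ^ 2 := by
          have : y.im ^ 2 ≤ (H : ℤ) ^ 2 := sq_le_sq' hy.2.1 hy.2.2
          exact_mod_cast this
        have e3 : (H : ℝ) ^ 2 ≤ (Q : ℝ) ^ k := by exact_mod_cast Nat.sqrt_le' (Q ^ k)
        linarith
      have hy0' : (0 : ℝ) ≤ y.norm := by exact_mod_cast GaussianInt.norm_nonneg y
      calc _ ≤ (((primaryBall Q).filter fun z => z ∣ y).card : ℝ) ^ k := by exact_mod_cast h1
        _ ≤ (C₁ * (2 * (Q : ℝ) ^ k) ^ ε₁) ^ k := by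
            refine pow_le_pow_left₀ (Nat.cast_nonneg _) (h2.trans ?_) k
            gcongr
        _ = C₁ ^ k * 2 ^ (k * ε₁) * (Q : ℝ) ^ ((k : ℝ) * (k * ε₁)) := by
            rw [mul_pow, ← Real.rpow_mul_natCast (by positivity),
              Real.mul_rpow (by norm_num) (by positivity), ← Real.rpow_natCast (Q : ℝ) k,
              ← Real.rpow_mul hQ0.le, mul_comm ε₁]
            ring
        _ ≤ _ := by
            gcongr
  -- Square pairs, about `P` of them, contribute the whole box, about `P Q ^ k`. The other pairs
  -- contribute at most about `P ^ 4 Q ^ (k / 2)`. These are the two terms in the hypothesis of the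
  -- bound.
  have hE : ∑ w₁ ∈ primitiveBall P, ∑ w₂ ∈ primitiveBall P,
      |∑ y ∈ gaussBox H, (quadSym w₁ y : ℝ) * quadSym w₂ y| ≤
      C₂ * (P : ℝ) ^ (1 + ε₁) * (3 * q) ^ 2 + (9 * P) ^ 2 * (2 * (3 * q) * P ^ 2) := by
    have hcard : ((primitiveBall P).card : ℝ) ≤ 9 * P := by
      exact_mod_cast (card_filter_le _ _).trans (card_primaryBall_le hP)
    have hnn : ∀ w ∈ primitiveBall P, 1 ≤ w.norm.natAbs ∧ w.norm.natAbs ≤ P ∧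
        w ∣ (w.norm.natAbs : GaussianInt) := by
      intro w hw
      rw [mem_primitiveBall] at hw
      have := hw.1.norm_pos
      refine ⟨by omega, by omega, star w, ?_⟩
      rw [← Zsqrtd.norm_eq_mul_conj]
      have e : (w.norm.natAbs : ℤ) = w.norm := by omega
      conv_rhs => rw [← e]
      exact (Int.cast_natCast _).symm
    have := sum_sum_abs_le_of_square_pairs (primitiveBall P) (fun w => w.norm.natAbs)
      (fun w₁ w₂ => ∑ y ∈ gaussBox H, (quadSym w₁ y : ℝ) * quadSym w₂ y)
      (N := C₂ * (P : ℝ) ^ (1 + ε₁)) (D := (3 * q) ^ 2) (O := 2 * (3 * q) * P ^ 2)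
      (by positivity) (by positivity)
      (hC₂ (primitiveBall P) (fun w => w.norm.natAbs) id P Function.injective_id hnn) ?_ ?_
    · refine this.trans ?_
      gcongr
    · intro w₁ _ w₂ _
      refine (abs_sum_le_sum_abs _ _).trans ((sum_le_card_nsmul _ _ 1 fun y _ => ?_).trans ?_)
      · rw [abs_mul]
        exact mul_le_one₀ (abs_jacobiSym_le_one _ _) (abs_nonneg _) (abs_jacobiSym_le_one _ _)
      · rw [card_gaussBox, nsmul_eq_mul, mul_one]
        push_cast
        gcongr
    · intro w₁ h₁ w₂ h₂ hsq
      have hn₁ := (hnn w₁ h₁).2.1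
      have hn₂ := (hnn w₂ h₂).2.1
      rw [mem_primitiveBall] at h₁ h₂
      refine (abs_sum_gaussBox_quadSym_mul_le h₁.1 h₂.1 h₁.2.2 h₂.2.2 hsq H).trans ?_
      have : ((w₁.norm.natAbs * w₂.norm.natAbs : ℕ) : ℝ) ≤ (P : ℝ) ^ 2 := by
        rw [sq]; exact_mod_cast Nat.mul_le_mul hn₁ hn₂
      gcongr
  have main := abs_bilin_pow_le (primitiveBall P) (primaryBall Q) (gaussBox H)
    (fun w z => (quadSym w z : ℝ))
    (fun w hw => by
      rw [mem_primitiveBall] at hw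
      rw [quadSym_one hw.1 hw.2.2]; norm_num)
    (fun w hw z z' => by
      rw [mem_primitiveBall] at hw
      rw [quadSym_mul hw.1 hw.2.2]; push_cast; ring)
    hk (τ := C₁ ^ k * 2 ^ (k * ε₁) * (Q : ℝ) ^ ε) (by positivity)
    (fun t ht => mem_gaussBox_sqrt (by exact_mod_cast (hprim t ht).1)) hτ hE a b ha hb
  refine main.trans ?_
  have hcW : ((primitiveBall P).card : ℝ) ≤ 9 * P := by
    exact_mod_cast (card_filter_le _ _).trans (card_primaryBall_le hP)
  have hcZ : ((primaryBall Q).card : ℝ) ≤ 9 * Q := by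
    exact_mod_cast card_primaryBall_le hQ
  have hE' : C₂ * (P : ℝ) ^ (1 + ε₁) * (3 * q) ^ 2 + (9 * P) ^ 2 * (2 * (3 * q) * P ^ 2) ≤
      (9 * C₂ + 486) * (P : ℝ) ^ ε * (P ^ 2 * Q ^ k * ((P : ℝ)⁻¹ + P ^ 2 / q)) := by
    have hPε : (P : ℝ) ^ ε₁ ≤ (P : ℝ) ^ ε := Real.rpow_le_rpow_of_exponent_le hP' hε₁1
    have hPε1 : 1 ≤ (P : ℝ) ^ ε := Real.one_le_rpow hP' hε.le
    have e1 : (P : ℝ) ^ 2 * Q ^ k * ((P : ℝ)⁻¹ + P ^ 2 / q) = P * q ^ 2 + P ^ 4 * q := by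
      rw [← hqq]; field_simp
    rw [e1, Real.rpow_add hP0, Real.rpow_one]
    have t1 : 0 ≤ (P : ℝ) * q ^ 2 := by positivity
    have t2 : 0 ≤ (P : ℝ) ^ 4 * q := by positivity
    have s1 := mul_le_mul_of_nonneg_right hPε (mul_nonneg (by linarith : 0 ≤ 9 * C₂) t1)
    have s2 := mul_le_mul_of_nonneg_right hPε1 (mul_nonneg (by norm_num : (0 : ℝ) ≤ 486) t2)
    have s3 : 0 ≤ (P : ℝ) ^ ε * (486 * (P * q ^ 2)) := by positivity
    have s4 : 0 ≤ (P : ℝ) ^ ε * (9 * C₂ * (P ^ 4 * q)) := by positivity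
    nlinarith [s1, s2, s3, s4]
  have hfac : (0 : ℝ) ≤ (P : ℝ)⁻¹ + P ^ 2 / q := by positivity
  calc ((primitiveBall P).card : ℝ) ^ (2 * (k - 1)) * (C₁ ^ k * 2 ^ (k * ε₁) * (Q : ℝ) ^ ε *
      ((primaryBall Q).card : ℝ) ^ k *
      (C₂ * (P : ℝ) ^ (1 + ε₁) * (3 * q) ^ 2 + (9 * P) ^ 2 * (2 * (3 * q) * P ^ 2)))
      ≤ (9 * P) ^ (2 * (k - 1)) * (C₁ ^ k * 2 ^ (k * ε₁) * (Q : ℝ) ^ ε * (9 * Q) ^ k *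
        ((9 * C₂ + 486) * (P : ℝ) ^ ε * (P ^ 2 * Q ^ k * ((P : ℝ)⁻¹ + P ^ 2 / q)))) := by
        gcongr
    _ = _ := by
        obtain ⟨m, rfl⟩ : ∃ m, k = m + 1 := ⟨k - 1, by omega⟩
        rw [Real.mul_rpow hP0.le hQ0.le, Nat.add_sub_cancel]
        ring

/-! ### Bilinear forms in the Jacobi symbol of rational integers -/

/-- The odd integers of absolute value at most `R`. -/
noncomputable def oddBall (R : ℕ) : Finset ℤ := (Icc (-(R : ℤ)) R).filter fun r => r % 2 = 1

/-- The nonzero integers of absolute value at most `R`. -/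
noncomputable def puncturedBall (R : ℕ) : Finset ℤ := (Icc (-(R : ℤ)) R).filter fun s => s ≠ 0

theorem mem_oddBall {R : ℕ} {r : ℤ} : r ∈ oddBall R ↔ r.natAbs ≤ R ∧ r % 2 = 1 := by
  rw [oddBall, mem_filter, mem_Icc]
  omega

theorem mem_puncturedBall {R : ℕ} {s : ℤ} : s ∈ puncturedBall R ↔ s.natAbs ≤ R ∧ s ≠ 0 := by
  rw [puncturedBall, mem_filter, mem_Icc]
  omega

theorem card_oddBall_le {R : ℕ} (hR : 1 ≤ R) : (oddBall R).card ≤ 3 * R := by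
  refine (card_filter_le _ _).trans ?_
  rw [Int.card_Icc]
  omega

theorem card_puncturedBall_le {R : ℕ} (hR : 1 ≤ R) : (puncturedBall R).card ≤ 3 * R := by
  refine (card_filter_le _ _).trans ?_
  rw [Int.card_Icc]
  omega

theorem abs_sum_Icc_jacobiSym_mul_le {m n : ℕ} (hm : m % 2 = 1) (hn : n % 2 = 1)
    (hsq : ¬ IsSquare (m * n)) (H : ℕ) :
    |∑ y ∈ Icc (-(H : ℤ)) H, (jacobiSym y m : ℝ) * jacobiSym y n| ≤ (m * n : ℕ) := by
  have hm0 : m ≠ 0 := by omega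
  have hn0 : n ≠ 0 := by omega
  have hpos : 0 < m * n := Nat.mul_pos (by omega) (by omega)
  have e : ∀ y : ℤ, (jacobiSym y m : ℝ) * jacobiSym y n = (jacobiSym y (m * n) : ℝ) := by
    intro y; rw [jacobiSym.mul_right' _ hm0 hn0]; push_cast; ring
  simp only [e]
  have hper : ∀ i : ℤ, (jacobiSym (i + (m * n : ℕ)) (m * n) : ℝ) = jacobiSym i (m * n) := by
    intro i
    rw [jacobiSym_congr (a := i + (m * n : ℕ)) (b := i) (by rw [add_sub_cancel_left])]
  have := abs_sum_Icc_le_of_periodic (f := fun y => (jacobiSym y (m * n) : ℝ)) hpos hper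
    (fun i => abs_jacobiSym_le_one _ _) ?_ H
  · rwa [mul_one] at this
  · obtain ⟨t, htc, ht⟩ := exists_jacobiSym_eq_neg_one
      (by rw [Nat.mul_mod, hm, hn]) hsq
    have h1 := sum_range_mul_eq_of_coprime (f := fun y => (jacobiSym y (m * n) : ℝ)) hpos hper htc
    have h2 : ∑ i ∈ range (m * n), (jacobiSym (t * i) (m * n) : ℝ) =
        -∑ i ∈ range (m * n), (jacobiSym (i : ℤ) (m * n) : ℝ) := by
      rw [← sum_neg_distrib]
      refine sum_congr rfl fun i _ => ?_
      rw [jacobiSym.mul_left, ht]; push_cast; ring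
    rw [h2] at h1
    linarith

/-- The bilinear form in the Jacobi symbol of rational integers. -/
theorem exists_bilinBound_jacobiSym {ε : ℝ} (hε : 0 < ε) :
    ∃ C : ℝ, 1 ≤ C ∧ ∀ R : ℕ, 1 ≤ R → BilinBound (oddBall R) (puncturedBall R)
      (fun r s => (jacobiSym s r.natAbs : ℝ)) (C * (R : ℝ) ^ (11 / 6 + ε)) := by
  set ε₁ : ℝ := ε / 4 with hε₁
  have hε₁0 : 0 < ε₁ := by positivity
  obtain ⟨C₁, hC₁1, hC₁⟩ := exists_card_divisors_le hε₁0
  obtain ⟨C₂, hC₂1, hC₂⟩ := exists_card_square_pairs_le hε₁0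
  set K : ℝ := 3 ^ 4 * (C₁ ^ 3 * 3 ^ 3 * (3 * C₂ + 9)) with hK
  have hK1 : 1 ≤ K := by
    have h2 : (1 : ℝ) ≤ C₁ ^ 3 := one_le_pow₀ hC₁1
    have : (1 : ℝ) ≤ C₁ ^ 3 * 3 ^ 3 * (3 * C₂ + 9) :=
      one_le_mul_of_one_le_of_one_le (by linarith) (by linarith)
    linarith
  have hinj : Function.Injective (fun s : ℤ => (s : GaussianInt)) := Int.cast_injective
  refine ⟨K, hK1, ?_⟩
  intro R hR a b ha hb
  have hR' : (1 : ℝ) ≤ R := by exact_mod_cast hR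
  have hR0 : (0 : ℝ) < R := by linarith
  -- With `k = 3` the square pairs give `R * R ^ 3` and the other pairs `R ^ 2 * R ^ 2`, so the two
  -- contributions balance. The sixth power is then about `R ^ (4 + 3 + 4)`, whence the exponent `11
  -- / 6`.
  refine abs_le_of_pow_two_mul_le (k := 3) (by norm_num) (by positivity) ?_
  have hprod : ∀ t ∈ Fintype.piFinset (fun _ : Fin 3 => puncturedBall R),
      ∏ i, t i ∈ Icc (-((R ^ 3 : ℕ) : ℤ)) (R ^ 3 : ℕ) ∧ ∏ i, t i ≠ 0 := by
    intro t ht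
    rw [Fintype.mem_piFinset] at ht
    constructor
    · rw [mem_Icc, ← abs_le, abs_prod]
      refine (prod_le_prod (fun i _ => abs_nonneg _) fun i _ =>
        (show |t i| ≤ (R : ℤ) from ?_)).trans_eq ?_
      · have := (mem_puncturedBall.1 (ht i)).1
        rw [Int.abs_eq_natAbs]; exact_mod_cast this
      · simp
    · exact prod_ne_zero_iff.2 fun i _ => (mem_puncturedBall.1 (ht i)).2
  have hτ : ∀ y ∈ Icc (-((R ^ 3 : ℕ) : ℤ)) (R ^ 3 : ℕ),
      (((Fintype.piFinset (fun _ : Fin 3 => puncturedBall R)).filter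
      fun t => ∏ i, t i = y).card : ℝ) ≤ C₁ ^ 3 * (R : ℝ) ^ (18 * ε₁) := by
    intro y hy
    by_cases hy0 : y = 0
    · have : ((Fintype.piFinset (fun _ : Fin 3 => puncturedBall R)).filter
          fun t => ∏ i, t i = y) = ∅ := by
        rw [filter_eq_empty_iff]
        intro t ht h
        exact (hprod t ht).2 (h.trans hy0)
      rw [this, card_empty, Nat.cast_zero]; positivity
    · classical
      have h1 := card_fiber_prod_le (puncturedBall R) 3 y ((puncturedBall R).filter fun z => z ∣ y)
        (fun z hz hd => mem_filter.2 ⟨hz, hd⟩)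
      have h2 := hC₁ (y : GaussianInt) (by exact_mod_cast hy0)
        (((puncturedBall R).filter fun z => z ∣ y).image fun s : ℤ => (s : GaussianInt)) (by
          intro z hz
          obtain ⟨s, hs, rfl⟩ := mem_image.1 hz
          exact (Zsqrtd.intCast_dvd_intCast _ _).2 (mem_filter.1 hs).2)
      rw [card_image_of_injective _ hinj] at h2
      have h3 : (Zsqrtd.norm (y : GaussianInt) : ℝ) ≤ (R : ℝ) ^ (6 : ℝ) := by
        rw [Zsqrtd.norm_intCast, show (6 : ℝ) = ((6 : ℕ) : ℝ) by norm_num, Real.rpow_natCast]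
        rw [mem_Icc] at hy
        have : y ^ 2 ≤ ((R ^ 3 : ℕ) : ℤ) ^ 2 := sq_le_sq' hy.1 hy.2
        have h4 : (y : ℝ) ^ 2 ≤ ((R : ℝ) ^ 3) ^ 2 := by exact_mod_cast this
        push_cast
        nlinarith
      have hy0' : (0 : ℝ) ≤ Zsqrtd.norm (y : GaussianInt) := by
        exact_mod_cast GaussianInt.norm_nonneg (y : GaussianInt)
      calc _ ≤ (((puncturedBall R).filter fun z => z ∣ y).card : ℝ) ^ 3 := by exact_mod_cast h1
        _ ≤ (C₁ * ((R : ℝ) ^ (6 : ℝ)) ^ ε₁) ^ 3 := by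
            refine pow_le_pow_left₀ (Nat.cast_nonneg _) (h2.trans ?_) 3
            gcongr
        _ = _ := by
            rw [mul_pow, ← Real.rpow_mul hR0.le, ← Real.rpow_mul_natCast hR0.le]
            congr 2; push_cast; ring
  have hE : ∑ r₁ ∈ oddBall R, ∑ r₂ ∈ oddBall R,
      |∑ y ∈ Icc (-((R ^ 3 : ℕ) : ℤ)) (R ^ 3 : ℕ),
        (jacobiSym y r₁.natAbs : ℝ) * jacobiSym y r₂.natAbs| ≤
      C₂ * (R : ℝ) ^ (1 + ε₁) * (3 * (R : ℝ) ^ 3) + (3 * R) ^ 2 * (R : ℝ) ^ 2 := by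
    have hcard : ((oddBall R).card : ℝ) ≤ 3 * R := by exact_mod_cast card_oddBall_le hR
    have hnn : ∀ r ∈ oddBall R, 1 ≤ r.natAbs ∧ r.natAbs ≤ R ∧
        (r : GaussianInt) ∣ (r.natAbs : GaussianInt) := by
      intro r hr
      rw [mem_oddBall] at hr
      refine ⟨by omega, hr.1, ?_⟩
      have h1 : r ∣ (r.natAbs : ℤ) := Int.dvd_natAbs_self
      have := (Zsqrtd.intCast_dvd_intCast (d := -1) _ _).2 h1
      rwa [Int.cast_natCast] at this
    have := sum_sum_abs_le_of_square_pairs (oddBall R) (fun r => r.natAbs)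
      (fun r₁ r₂ => ∑ y ∈ Icc (-((R ^ 3 : ℕ) : ℤ)) (R ^ 3 : ℕ),
        (jacobiSym y r₁.natAbs : ℝ) * jacobiSym y r₂.natAbs)
      (N := C₂ * (R : ℝ) ^ (1 + ε₁)) (D := 3 * (R : ℝ) ^ 3) (O := (R : ℝ) ^ 2)
      (by positivity) (by positivity)
      (hC₂ (oddBall R) (fun r => r.natAbs) (fun r => (r : GaussianInt)) R hinj hnn) ?_ ?_
    · refine this.trans ?_
      gcongr
    · intro r₁ _ r₂ _
      refine (abs_sum_le_sum_abs _ _).trans ((sum_le_card_nsmul _ _ 1 fun y _ => ?_).trans ?_)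
      · rw [abs_mul]
        exact mul_le_one₀ (abs_jacobiSym_le_one _ _) (abs_nonneg _) (abs_jacobiSym_le_one _ _)
      · rw [Int.card_Icc, nsmul_eq_mul, mul_one]
        have h1 : 1 ≤ R ^ 3 := Nat.one_le_pow _ _ hR
        have : (((R ^ 3 : ℕ) : ℤ) + 1 - -((R ^ 3 : ℕ) : ℤ)).toNat ≤ 3 * R ^ 3 := by omega
        exact_mod_cast this
    · intro r₁ h₁ r₂ h₂ hsq
      have hn₁ := (hnn r₁ h₁).2.1
      have hn₂ := (hnn r₂ h₂).2.1
      rw [mem_oddBall] at h₁ h₂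
      refine (abs_sum_Icc_jacobiSym_mul_le (by omega) (by omega) hsq _).trans ?_
      rw [sq]; exact_mod_cast Nat.mul_le_mul hn₁ hn₂
  have main := abs_bilin_pow_le (oddBall R) (puncturedBall R)
    (Icc (-((R ^ 3 : ℕ) : ℤ)) (R ^ 3 : ℕ)) (fun r s => (jacobiSym s r.natAbs : ℝ))
    (fun r _ => by rw [jacobiSym.one_left]; norm_num)
    (fun r _ s s' => by rw [jacobiSym.mul_left]; push_cast; ring)
    (k := 3) (by norm_num) (τ := C₁ ^ 3 * (R : ℝ) ^ (18 * ε₁)) (by positivity)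
    (fun t ht => (hprod t ht).1) hτ hE a b ha hb
  refine main.trans ?_
  have hcW : ((oddBall R).card : ℝ) ≤ 3 * R := by exact_mod_cast card_oddBall_le hR
  have hcZ : ((puncturedBall R).card : ℝ) ≤ 3 * R := by exact_mod_cast card_puncturedBall_le hR
  have hE' : C₂ * (R : ℝ) ^ (1 + ε₁) * (3 * (R : ℝ) ^ 3) + (3 * R) ^ 2 * (R : ℝ) ^ 2 ≤
      (3 * C₂ + 9) * (R ^ 4 * (R : ℝ) ^ ε₁) := by
    have hRε1 : 1 ≤ (R : ℝ) ^ ε₁ := Real.one_le_rpow hR' hε₁0.le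
    rw [Real.rpow_add hR0, Real.rpow_one]
    have := mul_le_mul_of_nonneg_left hRε1 (by positivity : (0 : ℝ) ≤ 9 * (R : ℝ) ^ 4)
    nlinarith
  calc ((oddBall R).card : ℝ) ^ (2 * (3 - 1)) * (C₁ ^ 3 * (R : ℝ) ^ (18 * ε₁) *
      ((puncturedBall R).card : ℝ) ^ 3 *
      (C₂ * (R : ℝ) ^ (1 + ε₁) * (3 * (R : ℝ) ^ 3) + (3 * R) ^ 2 * (R : ℝ) ^ 2))
      ≤ (3 * R) ^ (2 * (3 - 1)) * (C₁ ^ 3 * (R : ℝ) ^ (18 * ε₁) * (3 * R) ^ 3 *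
        ((3 * C₂ + 9) * (R ^ 4 * (R : ℝ) ^ ε₁))) := by
        gcongr
    _ = K * ((R : ℝ) ^ (11 : ℝ) * ((R : ℝ) ^ (18 * ε₁) * (R : ℝ) ^ ε₁)) := by
        rw [hK, show (11 : ℝ) = ((11 : ℕ) : ℝ) by norm_num, Real.rpow_natCast]; ring
    _ = K * (R : ℝ) ^ (11 + 19 * ε₁) := by
        rw [← Real.rpow_add hR0, ← Real.rpow_add hR0]; congr 2; ring
    _ ≤ K ^ (2 * 3) * (R : ℝ) ^ ((11 / 6 + ε) * (2 * 3 : ℕ)) := by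
        gcongr
        · exact le_self_pow₀ hK1 (by norm_num)
        · rw [hε₁]; push_cast; linarith
    _ = _ := by rw [mul_pow K, ← Real.rpow_mul_natCast hR0.le]

end GaussianSpin

/-! ### The bilinear form in the spin -/

namespace GaussianSpin

open Finset

/-- The spin, restricted to the upper half plane. -/
noncomputable def upperSpin (z : GaussianInt) : ℝ := if 0 < z.im then (spin z : ℝ) else 0

/-- Absorbs the logarithms lost in separating variables, together with the additive constants next
to them, into a small power. -/
theorem exists_natLog_add_le {η : ℝ} (hη : 0 < η) :
    ∃ C : ℝ, 1 ≤ C ∧ ∀ m : ℕ, 1 ≤ m → ((Nat.log 2 m : ℝ) + 20) ≤ C * (m : ℝ) ^ η := by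
  set A := max 1 (1 / (η * Real.log 2)) with hA
  have hA1 : 1 ≤ A := le_max_left _ _
  refine ⟨20 * A, by linarith, fun m hm => ?_⟩
  have h1 := succ_le_mul_rpow hη (Nat.log 2 m)
  have h2 : ((2 : ℝ) ^ η) ^ (Nat.log 2 m) ≤ (m : ℝ) ^ η := by
    rw [← Real.rpow_mul_natCast (by norm_num), mul_comm, Real.rpow_natCast_mul (by norm_num)]
    have : (2 : ℝ) ^ Nat.log 2 m ≤ m := by exact_mod_cast Nat.pow_log_le_self 2 (by omega)
    gcongr
  have h3 : A * ((2 : ℝ) ^ η) ^ (Nat.log 2 m) ≤ A * (m : ℝ) ^ η := by gcongr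
  have h4 : (0 : ℝ) ≤ Nat.log 2 m := Nat.cast_nonneg _
  nlinarith

theorem abs_infHilbert_le (a b : ℤ) : |(infHilbert a b : ℝ)| ≤ 1 := by
  unfold infHilbert; split_ifs <;> simp

theorem abs_spin_le (z : GaussianInt) : |(spin z : ℝ)| ≤ 1 := abs_jacobiSym_le_one _ _

theorem abs_upperSpin_le (z : GaussianInt) : |upperSpin z| ≤ 1 := by
  unfold upperSpin; split_ifs
  · exact abs_spin_le z
  · simp

/-- Separating the variables in the sign of the spin and in the half plane condition. -/
theorem BilinBound.mul_spinSign {W Z : Finset GaussianInt} {K : GaussianInt → GaussianInt → ℝ}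
    {B : ℝ} (h : BilinBound W Z K B) {n : ℕ} (hn : W.card + Z.card < 2 ^ n) :
    BilinBound W Z (fun w z => spinSign w z * (if 0 < (w * z).im then K w z else 0))
      (14000 * (9 + n) ^ 2 * B) := by
  have hB := h.nonneg
  -- Positivity of `Im (w z) = u s + v r` reads `(-u) s < v r`, the sign of a two-dimensional
  -- bilinear form. Negativity of the real part, used next, has the same shape.
  have h1 : BilinBound W Z (fun w z => if 0 < (w * z).im then K w z else 0)
      (9 * ((9 + n) * B)) := by
    refine (h.mul_ite_mul_lt_mul (fun w => -(w.re : ℝ)) (fun w => w.im) (fun z => z.im)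
      (fun z => z.re) hn).congr fun w _ z _ => ?_
    congr 1
    rw [im_mul, eq_iff_iff, ← sub_pos (a := (w.im : ℝ) * z.re)]
    rw [show (w.im : ℝ) * z.re - -w.re * z.im = ((w.re * z.im + w.im * z.re : ℤ) : ℝ) by
      push_cast; ring, Int.cast_pos]
  have h2 := h1.mul_ite_mul_lt_mul (fun w => (w.re : ℝ)) (fun w => w.im) (fun z => z.re)
      (fun z => z.im) hn
  -- Since `infHilbert a b = 1 - 2 * [a < 0 and b < 0]`, the sign is expanded as the kernel itself
  -- minus twice the kernel cut to the negative part; the condition `z.re * w.im < 0` only depends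
  -- on two sign classes.
  have h3 := (h2.mul_classes (fun w => SignType.sign w.im) (fun z => SignType.sign z.re)
    (F := fun i j => if i * j = -1 then 1 else 0)
    (fun i j => by split_ifs <;> simp)).const_mul (-2)
  have h4 := ((h1.add h3).mul_classes (fun w => SignType.sign w.im)
    (fun z => SignType.sign z.re) (F := fun i j => if i * j = -1 ∧ j = -1 then -1 else 1)
    (fun i j => by split_ifs <;> simp)).mul_separated
    (f := fun w => (infHilbert w.im w.re : ℝ)) (g := fun _ => 1)
    (fun w => abs_infHilbert_le _ _) (by simp)
  have hcard : (Fintype.card SignType : ℝ) = 3 := by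
    have : Fintype.card SignType = 3 := rfl
    rw [this]; norm_num
  refine (h4.mono ?_).congr fun w _ z _ => ?_
  · rw [hcard]
    have hn0 : (0 : ℝ) ≤ n := Nat.cast_nonneg n
    norm_num
    have h5 : (9 + (n : ℝ)) * B ≤ (9 + n) ^ 2 * B := by
      refine mul_le_mul_of_nonneg_right ?_ hB; nlinarith
    have h6 : 0 ≤ (9 + (n : ℝ)) ^ 2 * B := by positivity
    nlinarith
  · have hs : ∀ a b : ℤ, (SignType.sign a * SignType.sign b = -1) ↔ b * a < 0 := by
      intro a b
      rw [← sign_mul, mul_comm, sign_eq_neg_one_iff]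
    have hA : ((w.re : ℝ) * z.re < w.im * z.im) ↔ (w * z).re < 0 := by
      rw [re_mul, ← sub_neg, show (w.re : ℝ) * z.re - w.im * z.im =
        ((w.re * z.re - w.im * z.im : ℤ) : ℝ) by push_cast; ring, Int.cast_lt_zero]
    simp only [spinSign, hs, hA, sign_eq_neg_one_iff, infHilbert]
    push_cast
    by_cases h₁ : (w * z).re < 0 <;> by_cases h₂ : 0 < (w * z).im <;>
      by_cases h₃ : z.re * w.im < 0 <;> by_cases h₄ : w.im < 0 ∧ w.re < 0 <;>
      by_cases h₅ : z.re < 0 <;>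
      simp only [h₁, h₂, h₃, h₄, h₅, and_self, and_true, and_false, if_true, if_false] <;> ring

/-- The hypothesis saves `x ^ (3 / 200)` after the root of order `2 k`; the divisor bound, taken
with exponent `1 / 2000`, gives back `x ^ (1 / 2000)`, and `3 / 200 - 1 / 2000 = 29 / 2000`. -/
theorem exists_bilinBound_quadSym_of_le {k : ℕ} (hk : 1 ≤ k) :
    ∃ C : ℝ, 1 ≤ C ∧ ∀ (P Q : ℕ) (x : ℝ), 1 ≤ x → 1 ≤ P → 1 ≤ Q → (P : ℝ) * Q ≤ 2 * x →
      (P : ℝ)⁻¹ + P ^ 2 / (√(Q : ℝ)) ^ k ≤ 3 * (x ^ (-(3 / 200) : ℝ)) ^ (2 * k) →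
      BilinBound (primitiveBall P) (primaryBall Q) (fun w z => (quadSym w z : ℝ))
        (C * x ^ (1 - 29 / 2000 : ℝ)) := by
  obtain ⟨C, hC1, hC⟩ := exists_bilinBound_quadSym hk (ε := 1 / 2000) (by norm_num)
  refine ⟨12 * C, by linarith, ?_⟩
  intro P Q x hx hP hQ hPQ hsmall
  have hx0 : 0 < x := by linarith
  refine hC P Q _ hP hQ (by positivity) ?_
  have hPQ0 : (0 : ℝ) < (P : ℝ) * Q := by
    have : (1 : ℝ) ≤ P := by exact_mod_cast hP
    have : (1 : ℝ) ≤ Q := by exact_mod_cast hQ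
    positivity
  have h1 : ((P : ℝ) * Q) ^ (1 / 2000 : ℝ) ≤ 2 * x ^ (1 / 2000 : ℝ) := by
    calc ((P : ℝ) * Q) ^ (1 / 2000 : ℝ) ≤ (2 * x) ^ (1 / 2000 : ℝ) := by gcongr
      _ = 2 ^ (1 / 2000 : ℝ) * x ^ (1 / 2000 : ℝ) := Real.mul_rpow (by norm_num) hx0.le
      _ ≤ 2 * x ^ (1 / 2000 : ℝ) := by
        gcongr
        calc (2 : ℝ) ^ (1 / 2000 : ℝ) ≤ 2 ^ (1 : ℝ) :=
              Real.rpow_le_rpow_of_exponent_le (by norm_num) (by norm_num)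
          _ = 2 := Real.rpow_one 2
  have h2 : x ^ (1 / 2000 : ℝ) ≤ (x ^ (1 / 2000 : ℝ)) ^ (2 * k) :=
    le_self_pow₀ (Real.one_le_rpow hx (by norm_num)) (by omega)
  have hC2 : 6 * 2 ^ (2 * k) * C ≤ (12 * C) ^ (2 * k) := by
    rw [mul_pow]
    have h3 : C ≤ C ^ (2 * k) := le_self_pow₀ hC1 (by omega)
    have h4 : (6 : ℝ) * 2 ^ (2 * k) ≤ 12 ^ (2 * k) := by
      have h5 : (6 : ℝ) ≤ 6 ^ (2 * k) := le_self_pow₀ (by norm_num) (by omega)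
      calc (6 : ℝ) * 2 ^ (2 * k) ≤ 6 ^ (2 * k) * 2 ^ (2 * k) := by gcongr
        _ = 12 ^ (2 * k) := by rw [← mul_pow]; norm_num
    exact mul_le_mul h4 h3 (by linarith) (by positivity)
  calc C * ((P : ℝ) * Q) ^ (1 / 2000 : ℝ) * ((P : ℝ) * Q) ^ (2 * k) *
        ((P : ℝ)⁻¹ + P ^ 2 / (√(Q : ℝ)) ^ k)
      ≤ C * (2 * (x ^ (1 / 2000 : ℝ)) ^ (2 * k)) * (2 * x) ^ (2 * k) *
        (3 * (x ^ (-(3 / 200) : ℝ)) ^ (2 * k)) := by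
        gcongr
        linarith
    _ = 6 * 2 ^ (2 * k) * C * (x ^ (1 / 2000 : ℝ) * x * x ^ (-(3 / 200) : ℝ)) ^ (2 * k) := by
        simp only [mul_pow]; ring
    _ ≤ (12 * C) ^ (2 * k) * (x ^ (1 / 2000 : ℝ) * x * x ^ (-(3 / 200) : ℝ)) ^ (2 * k) := by
        gcongr
    _ = (12 * C * x ^ (1 - 29 / 2000 : ℝ)) ^ (2 * k) := by
        rw [← mul_pow]
        congr 2
        nth_rewrite 2 [← Real.rpow_one x]
        rw [← Real.rpow_add hx0, ← Real.rpow_add hx0]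
        norm_num

theorem rpow_pow_eq {x : ℝ} (hx : 0 < x) (a : ℝ) (n : ℕ) : (x ^ a) ^ n = x ^ (a * n) :=
  (Real.rpow_mul_natCast hx.le a n).symm

/-- The bilinear form in the quadratic symbol, when the modulus variable is the shorter one. -/
theorem exists_bilinBound_quadSym_short :
    ∃ C : ℝ, 1 ≤ C ∧ ∀ (P Q : ℕ) (x : ℝ), 1 ≤ x → P ≤ Q → (P : ℝ) * Q ≤ 2 * x →
      x ^ (3 / 100 : ℝ) ≤ P →
      BilinBound (primitiveBall P) (primaryBall Q) (fun w z => (quadSym w z : ℝ))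
        (C * x ^ (1 - 29 / 2000 : ℝ)) := by
  obtain ⟨C₁, hC₁1, hC₁⟩ := exists_bilinBound_quadSym_of_le (k := 1) (by norm_num)
  obtain ⟨C₂, hC₂1, hC₂⟩ := exists_bilinBound_quadSym_of_le (k := 2) (by norm_num)
  obtain ⟨C₅, hC₅1, hC₅⟩ := exists_bilinBound_quadSym_of_le (k := 5) (by norm_num)
  refine ⟨C₁ + C₂ + C₅, by linarith, ?_⟩
  intro P Q₀ x hx hPQ₀ hPQ₀x hP
  have hx0 : 0 < x := by linarith
  have hP1 : (1 : ℝ) ≤ P := (Real.one_le_rpow hx (by norm_num)).trans hP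
  have hP1' : 1 ≤ P := by exact_mod_cast hP1
  have hP0 : (0 : ℝ) < P := by linarith
  -- Enlarging the second range to its maximum costs nothing in the bound sought, and gives `Q ≥ x /
  -- P`, so that only `P` matters.
  obtain ⟨Q, hQ⟩ : ∃ Q, Q = ⌊2 * x / P⌋₊ := ⟨_, rfl⟩
  have hQ₀Q : Q₀ ≤ Q := by
    rw [hQ]; refine Nat.le_floor ?_
    rw [le_div_iff₀ hP0]; linarith
  have hPQ : P ≤ Q := hPQ₀.trans hQ₀Q
  have hQ1 : 1 ≤ Q := hP1'.trans hPQ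
  have hPQx : (P : ℝ) * Q ≤ 2 * x := by
    have : (Q : ℝ) ≤ 2 * x / P := by rw [hQ]; exact Nat.floor_le (by positivity)
    rw [le_div_iff₀ hP0] at this; linarith
  have hQx : x / P ≤ Q := by
    have h1 : 2 * x / P < Q + 1 := by rw [hQ]; exact Nat.lt_floor_add_one _
    have h2 : (1 : ℝ) ≤ Q := by exact_mod_cast hQ1
    rw [mul_div_assoc] at h1
    linarith
  have hxpow : 0 < x ^ (1 - 29 / 2000 : ℝ) := by positivity
  have hsub : primaryBall Q₀ ⊆ primaryBall Q := by
    intro z hz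
    rw [mem_primaryBall] at hz ⊢
    exact ⟨hz.1, hz.2.trans (by exact_mod_cast hQ₀Q)⟩
  suffices h : BilinBound (primitiveBall P) (primaryBall Q) (fun w z => (quadSym w z : ℝ))
      ((C₁ + C₂ + C₅) * x ^ (1 - 29 / 2000 : ℝ)) from h.subset subset_rfl hsub
  have hinv : ∀ a : ℝ, x ^ a ≤ P → (P : ℝ)⁻¹ ≤ x ^ (-a) := by
    intro a h
    rw [Real.rpow_neg hx0.le]
    exact inv_anti₀ (by positivity) h
  have hsqrt : ∀ b : ℝ, x ^ b ≤ Q → x ^ (b / 2) ≤ √(Q : ℝ) := by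
    intro b h
    refine Real.le_sqrt_of_sq_le ?_
    rw [rpow_pow_eq hx0]
    convert h using 2
    push_cast; ring
  have hQlow : ∀ a : ℝ, (P : ℝ) ≤ x ^ a → x ^ (1 - a) ≤ Q := by
    intro a h
    refine le_trans ?_ hQx
    rw [Real.rpow_sub hx0, Real.rpow_one]
    gcongr
  have hmono : ∀ a b : ℝ, a ≤ b → x ^ a ≤ x ^ b := fun a b h =>
    Real.rpow_le_rpow_of_exponent_le hx h
  have hratio : ∀ (k : ℕ) (a b c : ℝ), (P : ℝ) ^ 2 ≤ 2 * x ^ a → x ^ b ≤ (√(Q : ℝ)) ^ k →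
      a - b ≤ c → (P : ℝ) ^ 2 / (√(Q : ℝ)) ^ k ≤ 2 * x ^ c := by
    intro k a b c h1 h2 h3
    calc (P : ℝ) ^ 2 / (√(Q : ℝ)) ^ k ≤ 2 * x ^ a / x ^ b := by gcongr
      _ = 2 * x ^ (a - b) := by rw [Real.rpow_sub hx0]; ring
      _ ≤ _ := by have := hmono _ _ h3; linarith
  -- The moment `k` requires `1 / P` and `P² / Q ^ (k / 2)` to be at most about `x ^ (-3 k / 100)`.
  -- The first needs `P` large compared with `k`, the second `k` large compared with `P`; `k = 1, 2,
  -- 5` cover the ranges up to `x ^ (3 / 20)`, up to `x ^ (3 / 10)` and beyond, where `P ≤ Q` gives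
  -- `P² ≤ 2 x` and `Q ≥ √x`.
  rcases le_or_gt (P : ℝ) (x ^ (3 / 20 : ℝ)) with hc | hc
  · refine (hC₁ P Q x hx hP1' hQ1 hPQx ?_).mono (by gcongr; linarith)
    rw [rpow_pow_eq hx0]
    have h1 := hinv _ hP
    have h2 := hratio 1 (3 / 10) (17 / 40) (-(3 / 100)) (by
      have : (P : ℝ) ^ 2 ≤ (x ^ (3 / 20 : ℝ)) ^ 2 := by gcongr
      rw [rpow_pow_eq hx0] at this
      norm_num at this
      have : 0 < x ^ (3 / 10 : ℝ) := by positivity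
      linarith) (by
      have := hsqrt _ (hQlow _ hc)
      norm_num at this
      rwa [pow_one]) (by norm_num)
    norm_num at h1 h2 ⊢
    linarith
  rcases le_or_gt (P : ℝ) (x ^ (3 / 10 : ℝ)) with hc' | hc'
  · refine (hC₂ P Q x hx hP1' hQ1 hPQx ?_).mono (by gcongr; linarith)
    rw [rpow_pow_eq hx0]
    have h1 := (hinv _ hc.le).trans (hmono _ (-(6 / 100)) (by norm_num))
    have h2 := hratio 2 (6 / 10) (7 / 10) (-(6 / 100)) (by
      have : (P : ℝ) ^ 2 ≤ (x ^ (3 / 10 : ℝ)) ^ 2 := by gcongr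
      rw [rpow_pow_eq hx0] at this
      norm_num at this
      have : 0 < x ^ (6 / 10 : ℝ) := by positivity
      norm_num at *
      linarith) (by
      have := hQlow _ hc'
      rw [Real.sq_sqrt (Nat.cast_nonneg _)]
      norm_num at this ⊢
      exact this) (by norm_num)
    norm_num at h1 h2 ⊢
    linarith
  · refine (hC₅ P Q x hx hP1' hQ1 hPQx ?_).mono (by gcongr; linarith)
    rw [rpow_pow_eq hx0]
    have h1 := (hinv _ hc'.le).trans (hmono _ (-(15 / 100)) (by norm_num))
    have hPQ' : (P : ℝ) ≤ Q := by exact_mod_cast hPQ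
    have h2 := hratio 5 1 (5 / 4) (-(15 / 100)) (by
      rw [Real.rpow_one]; nlinarith) (by
      have hQ2 : x ^ (1 / 2 : ℝ) ≤ Q := by
        rw [← Real.sqrt_eq_rpow]
        refine Real.sqrt_le_iff.2 ⟨Nat.cast_nonneg _, ?_⟩
        rw [div_le_iff₀ hP0] at hQx
        nlinarith
      have := pow_le_pow_left₀ (by positivity) (hsqrt _ hQ2) 5
      rw [rpow_pow_eq hx0] at this
      norm_num at this ⊢
      exact this) (by norm_num)
    norm_num at h1 h2 ⊢
    linarith

theorem primitiveBall_subset (P : ℕ) : primitiveBall P ⊆ primaryBall P := by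
  intro z hz
  rw [mem_primitiveBall] at hz
  rw [mem_primaryBall]
  exact ⟨hz.1, hz.2.1⟩

theorem upperSpin_eq_zero_of_not_isCoprime {z : GaussianInt} (hz : IsPrimary z)
    (h : ¬ IsCoprime z.re z.im) : upperSpin z = 0 := by
  rw [upperSpin, spin_eq_zero_of_not_isCoprime hz.re_ne_zero h]
  simp

/-- Quadratic reciprocity makes the kernel symmetric, so the shorter variable can always play the
modulus. -/
theorem exists_bilinBound_quadSym_primitive :
    ∃ C : ℝ, 1 ≤ C ∧ ∀ (P Q : ℕ) (x : ℝ), 1 ≤ x → (P : ℝ) * Q ≤ 2 * x →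
      x ^ (3 / 100 : ℝ) ≤ P → x ^ (3 / 100 : ℝ) ≤ Q →
      BilinBound (primitiveBall P) (primitiveBall Q) (fun w z => (quadSym w z : ℝ))
        (C * x ^ (1 - 29 / 2000 : ℝ)) := by
  obtain ⟨C, hC1, hC⟩ := exists_bilinBound_quadSym_short
  refine ⟨C, hC1, fun P Q x hx hPQ hP hQ => ?_⟩
  rcases le_total P Q with h | h
  · exact (hC P Q x hx h hPQ hP).subset subset_rfl (primitiveBall_subset Q)
  · refine ((hC Q P x hx h (by rwa [mul_comm]) hQ).subset subset_rfl
      (primitiveBall_subset P)).swap.congr fun w hw z hz => ?_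
    rw [mem_primitiveBall] at hw hz
    rw [quadSym_comm hw.1 hz.1 hw.2.2 hz.2.2]

theorem mul_cube_le {N E T : ℝ} (hN : 0 ≤ N) (hE : N + 9 ≤ E) (hT : 0 ≤ T) :
    (N + 1) * (14000 * (9 + N) ^ 2 * T) ≤ 14000 * E ^ 3 * T := by
  have h1 : (9 + N) ^ 2 ≤ E ^ 2 := pow_le_pow_left₀ (by linarith) (by linarith) 2
  have h2 : (N + 1) * (9 + N) ^ 2 ≤ E * E ^ 2 :=
    mul_le_mul (by linarith) h1 (by positivity) (by linarith)
  have h3 := mul_le_mul_of_nonneg_right h2 hT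
  linarith

/-- By the multiplication rule the kernel is `quadSym` times separated factors, a sign and two
cut-offs. Removing these loses three logarithms, bounded by `x ^ (3 / 6000)`, and `29 / 2000 - 1 /
2000 = 7 / 500`. -/
theorem exists_bilinBound_upperSpin_primitive :
    ∃ C : ℝ, 1 ≤ C ∧ ∀ (P Q : ℕ) (x : ℝ), 1 ≤ x → (P : ℝ) * Q ≤ 2 * x →
      x ^ (3 / 100 : ℝ) ≤ P → x ^ (3 / 100 : ℝ) ≤ Q →
      BilinBound (primitiveBall P) (primitiveBall Q)
        (fun w z => if (w.norm : ℝ) * z.norm ≤ x then upperSpin (w * z) else 0)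
        (C * x ^ (1 - 7 / 500 : ℝ)) := by
  obtain ⟨C, hC1, hC⟩ := exists_bilinBound_quadSym_primitive
  obtain ⟨D, hD1, hD⟩ := exists_natLog_add_le (η := 1 / 6000) (by norm_num)
  refine ⟨14000 * (36 * D) ^ 3 * C, ?_, fun P Q x hx hPQ hP hQ => ?_⟩
  · have : (1 : ℝ) ≤ (36 * D) ^ 3 := one_le_pow₀ (by linarith)
    nlinarith
  have hx0 : 0 < x := by linarith
  have hP1 : (1 : ℝ) ≤ P := (Real.one_le_rpow hx (by norm_num)).trans hP
  have hQ1 : (1 : ℝ) ≤ Q := (Real.one_le_rpow hx (by norm_num)).trans hQ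
  have hP1' : 1 ≤ P := by exact_mod_cast hP1
  have hQ1' : 1 ≤ Q := by exact_mod_cast hQ1
  set m := (primitiveBall P).card + (primitiveBall Q).card + 1 with hm
  have hn : (primitiveBall P).card + (primitiveBall Q).card < 2 ^ (Nat.log 2 m + 1) :=
    lt_trans (by omega) (Nat.lt_pow_succ_log_self (by norm_num) m)
  have hm36 : (m : ℝ) ≤ 36 * x := by
    have h1 := (card_le_card (primitiveBall_subset P)).trans (card_primaryBall_le hP1')
    have h2 := (card_le_card (primitiveBall_subset Q)).trans (card_primaryBall_le hQ1')
    have h3 : (m : ℝ) ≤ 9 * P + 9 * Q + 1 := by rw [hm]; exact_mod_cast by omega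
    nlinarith [mul_nonneg (sub_nonneg.2 hP1) (sub_nonneg.2 hQ1)]
  have hlog : ((Nat.log 2 m + 1 : ℕ) : ℝ) + 9 ≤ 36 * D * x ^ (1 / 6000 : ℝ) := by
    have h1 := hD m (by omega)
    have h2 : (m : ℝ) ^ (1 / 6000 : ℝ) ≤ 36 * x ^ (1 / 6000 : ℝ) := by
      calc (m : ℝ) ^ (1 / 6000 : ℝ) ≤ (36 * x) ^ (1 / 6000 : ℝ) := by gcongr
        _ = 36 ^ (1 / 6000 : ℝ) * x ^ (1 / 6000 : ℝ) := Real.mul_rpow (by norm_num) hx0.le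
        _ ≤ 36 * x ^ (1 / 6000 : ℝ) := by
          gcongr
          calc (36 : ℝ) ^ (1 / 6000 : ℝ) ≤ 36 ^ (1 : ℝ) :=
                Real.rpow_le_rpow_of_exponent_le (by norm_num) (by norm_num)
            _ = 36 := Real.rpow_one _
    have h3 : D * (m : ℝ) ^ (1 / 6000 : ℝ) ≤ D * (36 * x ^ (1 / 6000 : ℝ)) := by gcongr
    push_cast
    linarith
  set n := Nat.log 2 m + 1 with hndef
  have h1 := ((hC P Q x hx hPQ hP hQ).mul_separated (f := fun w => (spin w : ℝ))
    (g := fun z => (spin z : ℝ)) abs_spin_le abs_spin_le).mul_spinSign hn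
  have h2 := h1.mul_ite_le (fun w => (w.norm : ℝ)) (fun z => x / z.norm) hn
  refine (h2.mono ?_).congr fun w hw z hz => ?_
  · refine (mul_cube_le (Nat.cast_nonneg n) hlog (T := C * x ^ (1 - 29 / 2000 : ℝ))
      (by positivity)).trans (le_of_eq ?_)
    rw [mul_pow (36 * D), rpow_pow_eq hx0, show (1 - 7 / 500 : ℝ) =
      1 / 6000 * (3 : ℕ) + (1 - 29 / 2000) by norm_num, Real.rpow_add hx0]
    ring
  · rw [mem_primitiveBall] at hw hz
    have hz0 : (0 : ℝ) < z.norm := by exact_mod_cast hz.1.norm_pos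
    simp only [le_div_iff₀ hz0]
    congr 1
    rw [upperSpin, spin_mul hw.1 hz.1]
    split_ifs
    · push_cast; ring
    · ring

/-- The bilinear form in the spin of a product, with both variables of size at least
`x ^ (3 / 100)`. -/
theorem exists_bilinBound_upperSpin :
    ∃ C : ℝ, 1 ≤ C ∧ ∀ (P Q : ℕ) (x : ℝ), 1 ≤ x → (P : ℝ) * Q ≤ 2 * x →
      x ^ (3 / 100 : ℝ) ≤ P → x ^ (3 / 100 : ℝ) ≤ Q →
      BilinBound (primaryBall P) (primaryBall Q)
        (fun w z => if (w.norm : ℝ) * z.norm ≤ x then upperSpin (w * z) else 0)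
        (C * x ^ (1 - 7 / 500 : ℝ)) := by
  obtain ⟨C, hC1, hC⟩ := exists_bilinBound_upperSpin_primitive
  refine ⟨C, hC1, fun P Q x hx hPQ hP hQ a b ha hb => ?_⟩
  refine le_of_eq_of_le (congrArg abs ?_) (hC P Q x hx hPQ hP hQ a b ha hb)
  symm
  have hvan : ∀ w ∈ primaryBall P, ∀ z ∈ primaryBall Q,
      w ∉ primitiveBall P ∨ z ∉ primitiveBall Q → upperSpin (w * z) = 0 := by
    intro w hw z hz h
    rw [mem_primaryBall] at hw hz
    refine upperSpin_eq_zero_of_not_isCoprime (hw.1.mul hz.1) fun hc => ?_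
    rcases h with h | h
    · exact h (mem_primitiveBall.2 ⟨hw.1, hw.2, isCoprime_of_mul_left hc⟩)
    · exact h (mem_primitiveBall.2 ⟨hz.1, hz.2, isCoprime_of_mul_right hc⟩)
  rw [← sum_subset (primitiveBall_subset P)]
  · refine sum_congr rfl fun w hw => sum_subset (primitiveBall_subset Q) fun z hz hz' => ?_
    simp only [hvan w (primitiveBall_subset P hw) z hz (Or.inr hz'), ite_self, mul_zero]
  · intro w hw hw'
    refine sum_eq_zero fun z hz => ?_
    simp only [hvan w hw z hz (Or.inl hw'), ite_self, mul_zero]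

end GaussianSpin

/-! ### The spins of the multiples of a Gaussian integer -/

namespace GaussianSpin

open Finset

/-- The Jacobi symbol kernel, twisted by the factors with which the spin of a fixed multiple of
`r + i s` differs from that of `r + i s`. -/
theorem BilinBound.twist {R : ℕ} {B : ℝ}
    (h : BilinBound (oddBall R) (puncturedBall R) (fun r s => (jacobiSym s r.natAbs : ℝ)) B)
    {n : ℕ} (hn : (oddBall R).card + (puncturedBall R).card < 2 ^ n)
    {w : GaussianInt} (hw : IsPrimary w) (X : ℕ) :
    BilinBound (oddBall R) (puncturedBall R)
      (fun r s => if (⟨r, s⟩ : GaussianInt) ∈ primaryBall X then upperSpin (w * ⟨r, s⟩) else 0)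
      (48 * (n + 1) ^ 3 * (w.norm * B)) := by
  have hB := h.nonneg
  have hq0 := hw.norm_pos
  set q := w.norm.natAbs with hq
  have : NeZero q := ⟨by omega⟩
  have hqc : (q : ℤ) = w.norm := by omega
  have h1 : BilinBound (oddBall R) (puncturedBall R) (fun r s =>
      (jacobiSym (w.re * r - w.im * s) q : ℝ) * (jacobiSym s r.natAbs : ℝ)) (w.norm * B) := by
    -- On a fixed class of `r` modulo `q = N(w)` the twisting symbol depends on `s` alone; the `q`
    -- classes cost the factor `N(w)`.
    have h0 := BilinBound.of_classes (W := oddBall R) (Z := puncturedBall R) (B := B)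
      (fun r : ℤ => (r : ZMod q)) (fun _ : ℤ => ())
      (L := fun i _ r s => 1 * (jacobiSym (w.re * (i.val : ℤ) - w.im * s) q : ℝ) *
        (jacobiSym s r.natAbs : ℝ))
      (fun i _ => h.mul_separated (by simp) fun s => abs_jacobiSym_le_one _ _)
    refine (h0.mono (le_of_eq ?_)).congr fun r _ s _ => ?_
    · rw [ZMod.card, ← hqc]; simp
    · rw [one_mul]
      congr 2
      refine jacobiSym.mod_left' ?_
      have : ((r : ZMod q).val : ℤ) ≡ r [ZMOD q] := by
        rw [← ZMod.intCast_eq_intCast_iff]; simp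
      exact ((this.symm.mul_left _).sub_right _)
  have h2 := h1.mul_ite_lt (fun r => -(w.im * r)) (fun s => w.re * s) hn
  have h3 := ((h2.mul_ite_lt (fun r => w.re * r) (fun s => w.im * s) hn).mul_separated
    (f := fun r => if r * w.im < 0 then 1 else 0) (g := fun _ => 1)
    (fun r => by split_ifs <;> simp) (by simp)).const_mul (-2)
  have h4 := (h2.add h3).mul_separated
    (f := fun r => (infHilbert (r * w.im) r : ℝ))
    (g := fun _ => (infHilbert w.im w.re * spin w : ℝ))
    (fun r => abs_infHilbert_le _ _) (fun _ => by
      rw [abs_mul]; exact mul_le_one₀ (abs_infHilbert_le _ _) (abs_nonneg _) (abs_spin_le w))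
  -- The norm condition is `r² ≤ X - s²`, and for odd `r` being primary is the single congruence `r
  -- + s ≡ 1 (mod 4)`.
  have h5 := (h4.mul_ite_le (fun r => r ^ 2) (fun s => (X : ℤ) - s ^ 2) hn).mul_classes
    (fun r : ℤ => (r : ZMod 4)) (fun s : ℤ => (s : ZMod 4))
    (F := fun i j => if i + j = 1 then 1 else 0) (fun i j => by split_ifs <;> simp)
  refine (h5.mono ?_).congr fun r hr s hs => ?_
  · rw [ZMod.card, abs_neg, abs_two]
    set T : ℝ := w.norm * B with hT
    have hT0 : 0 ≤ T := by
      have : (0 : ℝ) < w.norm := by exact_mod_cast hq0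
      positivity
    have hn0 : (0 : ℝ) ≤ n := Nat.cast_nonneg n
    have : ((4 : ℕ) : ℝ) * (4 : ℕ) * ((n + 1) * (n * T + 2 * (n * (n * T)))) =
        16 * ((n + 1) * (n + 2 * n ^ 2)) * T := by push_cast; ring
    rw [this]
    refine mul_le_mul_of_nonneg_right ?_ hT0
    nlinarith [pow_nonneg hn0 2, pow_nonneg hn0 3]
  · rw [mem_oddBall] at hr
    have hprim : (⟨r, s⟩ : GaussianInt) ∈ primaryBall X ↔
        ((r : ZMod 4) + s = 1) ∧ r ^ 2 ≤ (X : ℤ) - s ^ 2 := by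
      rw [mem_primaryBall, IsPrimary, norm_eq]
      have : ((r : ZMod 4) + s = 1) ↔ (r + s) % 4 = 1 := by
        have := ZMod.intCast_eq_intCast_iff (r + s) 1 4
        push_cast at this
        rw [this]; rfl
      rw [this]
      have := hr.2
      constructor
      · rintro ⟨⟨_, h⟩, h'⟩; exact ⟨h, by linarith⟩
      · rintro ⟨h, h'⟩; exact ⟨⟨by dsimp only; omega, h⟩, by dsimp only; linarith⟩
    by_cases hp : (⟨r, s⟩ : GaussianInt) ∈ primaryBall X
    · have hz := (mem_primaryBall.1 hp).1
      rw [if_pos hp, if_pos (hprim.1 hp).1, if_pos (hprim.1 hp).2, upperSpin, spin_mul hw hz]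
      have him : 0 < (w * (⟨r, s⟩ : GaussianInt)).im ↔ -(w.im * r) < w.re * s := by
        rw [im_mul]; dsimp only; constructor <;> intro h <;> linarith
      have hre : (w * (⟨r, s⟩ : GaussianInt)).re < 0 ↔ w.re * r < w.im * s := by
        rw [re_mul]; dsimp only; constructor <;> intro h <;> linarith
      have hquad : quadSym w ⟨r, s⟩ = jacobiSym (w.re * r - w.im * s) q := by
        rw [quadSym, re_mul]
      have hsp : spin ⟨r, s⟩ = jacobiSym s r.natAbs := rfl
      have hsig : (spinSign w ⟨r, s⟩ : ℝ) = infHilbert w.im w.re *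
          (1 - 2 * ((if r * w.im < 0 then 1 else 0) * (if w.re * r < w.im * s then 1 else 0))) *
          infHilbert (r * w.im) r := by
        rw [spinSign]
        push_cast
        congr 2
        rw [infHilbert]
        simp only [hre]
        by_cases h₁ : r * w.im < 0 <;> by_cases h₂ : w.re * r < w.im * s <;>
          (simp [h₁, h₂]; try norm_num)
      simp only [him]
      push_cast
      rw [hsig, hquad, hsp]
      by_cases h₁ : -(w.im * r) < w.re * s <;> by_cases h₂ : w.re * r < w.im * s <;>
        simp only [h₁, h₂, if_true, if_false] <;> ring
    · rw [if_neg hp]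
      by_cases h₁ : (r : ZMod 4) + s = 1
      · rw [if_neg fun h₂ => hp (hprim.2 ⟨h₁, h₂⟩), mul_zero]
      · rw [if_neg h₁, zero_mul]

/-- The real elements are set aside: the bilinear bound for `(s / r)` excludes `s = 0`, since the
divisor bound needs nonzero products. -/
theorem sum_primaryBall_eq_add (X : ℕ) (f : GaussianInt → ℝ) :
    ∑ z ∈ primaryBall X, f z = ∑ z ∈ primaryBall X with z.im = 0, f z +
      ∑ r ∈ oddBall X.sqrt, ∑ s ∈ puncturedBall X.sqrt,
        if (⟨r, s⟩ : GaussianInt) ∈ primaryBall X then f ⟨r, s⟩ else 0 := by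
  classical
  rw [← sum_filter_add_sum_filter_not (primaryBall X) fun z => z.im = 0]
  congr 1
  rw [← sum_product', ← sum_filter (s := oddBall X.sqrt ×ˢ puncturedBall X.sqrt)
    (fun p => (⟨p.1, p.2⟩ : GaussianInt) ∈ primaryBall X) fun p => f ⟨p.1, p.2⟩]
  refine sum_nbij' (fun z => (z.re, z.im)) (fun p => ⟨p.1, p.2⟩) ?_ ?_ ?_ ?_ ?_
  · intro z hz
    rw [mem_filter] at hz
    have h1 := mem_primaryBall.1 hz.1
    have h2 := mem_gaussBox.1 (mem_gaussBox_sqrt h1.2)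
    have h3 := h1.1.odd_re
    rw [mem_filter, mem_product, mem_oddBall, mem_puncturedBall]
    exact ⟨⟨⟨by dsimp only; omega, h3⟩, by dsimp only; omega, hz.2⟩, hz.1⟩
  · intro p hp
    rw [mem_filter, mem_product, mem_puncturedBall] at hp
    exact mem_filter.2 ⟨hp.2, hp.1.2.2⟩
  · intro z _; rfl
  · intro p _; rfl
  · intro z _; rfl

theorem card_primaryBall_im_eq_zero_le {X : ℕ} (hX : 1 ≤ X) :
    ((primaryBall X).filter fun z => z.im = 0).card ≤ 3 * X.sqrt := by
  refine le_trans ?_ (card_oddBall_le (Nat.sqrt_pos.2 hX))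
  refine card_le_card_of_injOn (fun z => z.re) ?_ ?_
  · intro z hz
    rw [mem_coe, mem_filter] at hz
    have h1 := mem_primaryBall.1 hz.1
    have h2 := mem_gaussBox.1 (mem_gaussBox_sqrt h1.2)
    rw [mem_coe, mem_oddBall]
    exact ⟨by dsimp only; omega, h1.1.odd_re⟩
  · intro z hz z' hz' h
    rw [mem_coe, mem_filter] at hz hz'
    exact Zsqrtd.ext h (hz.2.trans hz'.2.symm)

/-- The sum of the spins of the multiples of a fixed Gaussian integer. -/
theorem exists_sum_upperSpin_mul_le {ε : ℝ} (hε : 0 < ε) :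
    ∃ C : ℝ, 1 ≤ C ∧ ∀ w : GaussianInt, IsPrimary w → ∀ X : ℕ, 1 ≤ X →
      |∑ z ∈ primaryBall X, upperSpin (w * z)| ≤ C * (w.norm * (X : ℝ) ^ (11 / 12 + ε)) := by
  obtain ⟨C, hC1, hC⟩ := exists_bilinBound_jacobiSym hε
  obtain ⟨D, hD1, hD⟩ := exists_natLog_add_le (η := ε / 3) (by positivity)
  refine ⟨48 * (D ^ 3 * 7 ^ ε) * C + 3, ?_, ?_⟩
  · have : (0 : ℝ) ≤ 48 * (D ^ 3 * 7 ^ ε) * C := by positivity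
    linarith
  intro w hw X hX
  set R := X.sqrt with hR
  have hR1 : 1 ≤ R := Nat.sqrt_pos.2 hX
  have hR1' : (1 : ℝ) ≤ R := by exact_mod_cast hR1
  have hR0 : (0 : ℝ) < R := by linarith
  have hq1 : (1 : ℝ) ≤ w.norm := by exact_mod_cast hw.norm_pos
  have hn : (oddBall R).card + (puncturedBall R).card < 2 ^ (Nat.log 2 (7 * R) + 1) := by
    have h1 := card_oddBall_le hR1
    have h2 := card_puncturedBall_le hR1
    exact lt_of_le_of_lt (by omega) (Nat.lt_pow_succ_log_self (by norm_num) (7 * R))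
  have hlog : ((Nat.log 2 (7 * R) + 1 : ℕ) : ℝ) + 1 ≤ D * (7 * R : ℝ) ^ (ε / 3) := by
    have := hD (7 * R) (by omega)
    push_cast at this ⊢
    linarith
  have hlog3 : (((Nat.log 2 (7 * R) + 1 : ℕ) : ℝ) + 1) ^ 3 ≤ D ^ 3 * 7 ^ ε * R ^ ε := by
    refine (pow_le_pow_left₀ (by positivity) hlog 3).trans (le_of_eq ?_)
    rw [mul_pow, rpow_pow_eq (by positivity), mul_assoc, ← Real.mul_rpow (by norm_num) hR0.le]
    congr 2
    push_cast
    ring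
  -- Coordinates run up to `R = √X`, so the exponent `11 / 6` in `R` is `11 / 12` in `X`; the second
  -- `ε` pays for the logarithms.
  have hRX : (R : ℝ) ^ (11 / 6 + 2 * ε) ≤ (X : ℝ) ^ (11 / 12 + ε) := by
    have h1 : ((R : ℝ) ^ 2) ≤ X := by
      have := Nat.sqrt_le' X
      exact_mod_cast this
    calc (R : ℝ) ^ (11 / 6 + 2 * ε) = ((R : ℝ) ^ 2) ^ (11 / 12 + ε) := by
          rw [← Real.rpow_natCast, ← Real.rpow_mul hR0.le]
          congr 1
          push_cast
          ring
      _ ≤ _ := by gcongr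
  have h1 := (hC R hR1).twist hn hw X (fun _ => 1) (fun _ => 1) (by simp) (by simp)
  simp only [one_mul] at h1
  rw [sum_primaryBall_eq_add]
  refine (abs_add_le _ _).trans ?_
  have h2 : |∑ z ∈ primaryBall X with z.im = 0, upperSpin (w * z)| ≤
      3 * (w.norm * (X : ℝ) ^ (11 / 12 + ε)) := by
    refine (abs_sum_le_sum_abs _ _).trans ?_
    refine (sum_le_sum fun z _ => abs_upperSpin_le (w * z)).trans ?_
    rw [sum_const, nsmul_eq_mul, mul_one]
    have h3 : (((primaryBall X).filter fun z => z.im = 0).card : ℝ) ≤ 3 * R := by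
      exact_mod_cast card_primaryBall_im_eq_zero_le hX
    have h4 : (R : ℝ) ≤ R ^ (11 / 6 + 2 * ε) := Real.self_le_rpow_of_one_le hR1' (by linarith)
    have h5 : (X : ℝ) ^ (11 / 12 + ε) ≤ w.norm * (X : ℝ) ^ (11 / 12 + ε) :=
      le_mul_of_one_le_left (by positivity) hq1
    linarith
  have h3 : 48 * (((Nat.log 2 (7 * R) + 1 : ℕ) : ℝ) + 1) ^ 3 *
      (w.norm * (C * (R : ℝ) ^ (11 / 6 + ε))) ≤
      48 * (D ^ 3 * 7 ^ ε) * C * (w.norm * (X : ℝ) ^ (11 / 12 + ε)) := by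
    calc _ ≤ 48 * (D ^ 3 * 7 ^ ε * R ^ ε) * (w.norm * (C * (R : ℝ) ^ (11 / 6 + ε))) := by
          gcongr
      _ = 48 * (D ^ 3 * 7 ^ ε) * C * (w.norm * (R : ℝ) ^ (11 / 6 + 2 * ε)) := by
          rw [show 11 / 6 + 2 * ε = ε + (11 / 6 + ε) by ring, Real.rpow_add hR0 ε]
          ring
      _ ≤ _ := by gcongr
  linarith

end GaussianSpin

/-! ### Convolutions against the spin -/

namespace GaussianSpin

open Finset ArithmeticFunction

/-- Partial summation: a weight of bounded variation costs at most its variation. -/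
theorem abs_sum_mul_le {t g : ℕ → ℝ} {M : ℝ} (Y : ℕ)
    (hM : ∀ X ≤ Y, |∑ n ∈ Icc 1 X, t n| ≤ M) :
    |∑ n ∈ Icc 1 Y, g n * t n| ≤ (|g Y| + ∑ k ∈ range Y, |g (k + 1) - g k|) * M := by
  have key : ∀ Y, ∑ n ∈ Icc 1 Y, g n * t n = g Y * ∑ n ∈ Icc 1 Y, t n -
      ∑ k ∈ range Y, (g (k + 1) - g k) * ∑ n ∈ Icc 1 k, t n := by
    intro Y
    induction Y with
    | zero => simp
    | succ Y ih =>
      rw [sum_Icc_succ_top (by omega), ih, sum_range_succ, sum_Icc_succ_top (by omega)]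
      ring
  rw [key, add_mul, sum_mul]
  refine (abs_sub _ _).trans (add_le_add ?_ ?_)
  · rw [abs_mul]
    exact mul_le_mul_of_nonneg_left (hM Y le_rfl) (abs_nonneg _)
  · refine (abs_sum_le_sum_abs _ _).trans (sum_le_sum fun k hk => ?_)
    rw [abs_mul]
    exact mul_le_mul_of_nonneg_left (hM k (mem_range.1 hk).le) (abs_nonneg _)

theorem abs_sum_mul_le_of_monotone {t g : ℕ → ℝ} {M : ℝ} (Y : ℕ) (hg : Monotone g)
    (hg0 : 0 ≤ g 0) (hM : ∀ X ≤ Y, |∑ n ∈ Icc 1 X, t n| ≤ M) :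
    |∑ n ∈ Icc 1 Y, g n * t n| ≤ 2 * g Y * M := by
  have hM0 : 0 ≤ M := (abs_nonneg _).trans (hM 0 (Nat.zero_le _))
  refine (abs_sum_mul_le Y hM).trans (mul_le_mul_of_nonneg_right ?_ hM0)
  rw [sum_congr rfl fun k _ => abs_of_nonneg (sub_nonneg.2 (hg (Nat.le_succ k))), sum_range_sub,
    abs_of_nonneg (hg0.trans (hg (Nat.zero_le Y)))]
  linarith

theorem abs_sum_mul_le_of_antitone {t g : ℕ → ℝ} {M : ℝ} (Y : ℕ) (hg : Antitone g)
    (hg0 : ∀ n, 0 ≤ g n) (hM : ∀ X ≤ Y, |∑ n ∈ Icc 1 X, t n| ≤ M) :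
    |∑ n ∈ Icc 1 Y, g n * t n| ≤ g 0 * M := by
  have hM0 : 0 ≤ M := (abs_nonneg _).trans (hM 0 (Nat.zero_le _))
  refine (abs_sum_mul_le Y hM).trans (mul_le_mul_of_nonneg_right ?_ hM0)
  rw [sum_congr rfl fun k _ => abs_of_nonpos (sub_nonpos.2 (hg (Nat.le_succ k))),
    sum_neg_distrib, sum_range_sub, abs_of_nonneg (hg0 Y)]
  linarith

theorem sum_Icc_sum_divisorsAntidiagonal (N : ℕ) (F : ℕ → ℕ → ℝ) :
    ∑ n ∈ Icc 1 N, ∑ p ∈ n.divisorsAntidiagonal, F p.1 p.2 =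
      ∑ b ∈ Icc 1 N, ∑ m ∈ Icc 1 N, if b * m ≤ N then F b m else 0 := by
  rw [← sum_product', ← sum_filter (s := Icc 1 N ×ˢ Icc 1 N) (fun p => p.1 * p.2 ≤ N)
    fun p => F p.1 p.2, sum_sigma']
  refine sum_nbij' (fun x => x.2) (fun p => ⟨p.1 * p.2, p⟩) ?_ ?_ ?_ ?_ ?_
  · rintro ⟨n, b, m⟩ h
    simp only [mem_sigma, mem_Icc, Nat.mem_divisorsAntidiagonal, mem_filter, mem_product] at h ⊢
    obtain ⟨⟨h1, h2⟩, rfl, h3⟩ := h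
    have hb : 0 < b := Nat.pos_of_ne_zero (left_ne_zero_of_mul h3)
    have hm : 0 < m := Nat.pos_of_ne_zero (right_ne_zero_of_mul h3)
    exact ⟨⟨⟨hb, (Nat.le_mul_of_pos_right b hm).trans h2⟩, hm,
      (Nat.le_mul_of_pos_left m hb).trans h2⟩, h2⟩
  · rintro ⟨b, m⟩ h
    simp only [mem_sigma, mem_Icc, Nat.mem_divisorsAntidiagonal, mem_filter, mem_product] at h ⊢
    have : 0 < b * m := Nat.mul_pos h.1.1.1 h.1.2.1
    exact ⟨⟨this, h.2⟩, trivial, this.ne'⟩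
  · rintro ⟨n, b, m⟩ h
    simp only [mem_sigma, Nat.mem_divisorsAntidiagonal] at h
    obtain ⟨_, rfl, _⟩ := h
    rfl
  · intro p _; rfl
  · intro p _; rfl

/-- The sum of the spins of the primary Gaussian integers of norm `n` in the upper half plane. -/
noncomputable def spinCoeff (n : ℕ) : ℝ := ∑ z ∈ primaryNorm n, upperSpin z

theorem spinCoeff_mul {b : ℕ} (hb : b ≠ 0) (m : ℕ) :
    spinCoeff (b * m) = ∑ w ∈ primaryNorm b, ∑ z ∈ primaryNorm m, upperSpin (w * z) :=
  sum_primaryNorm_mul hb upperSpin fun _ hz h => upperSpin_eq_zero_of_not_isCoprime hz h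

theorem natAbs_norm_of_mem_primaryNorm {n : ℕ} {z : GaussianInt} (hz : z ∈ primaryNorm n) :
    z.norm.natAbs = n := by
  rw [mem_primaryNorm] at hz
  omega

/-- A convolution against the spin is a bilinear form in the spin of a product. -/
theorem sum_spinCoeff_mul (N : ℕ) (f g : ArithmeticFunction ℝ) :
    ∑ n ∈ Icc 1 N, spinCoeff n * (f * g) n =
      ∑ w ∈ primaryBall N, ∑ z ∈ primaryBall N, f w.norm.natAbs * g z.norm.natAbs *
        if w.norm.natAbs * z.norm.natAbs ≤ N then upperSpin (w * z) else 0 := by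
  have h1 : ∀ n ∈ Icc 1 N, spinCoeff n * (f * g) n =
      ∑ p ∈ n.divisorsAntidiagonal, f p.1 * g p.2 * spinCoeff (p.1 * p.2) := by
    intro n _
    rw [ArithmeticFunction.mul_apply, mul_sum]
    refine sum_congr rfl fun p hp => ?_
    rw [(Nat.mem_divisorsAntidiagonal.1 hp).1]
    ring
  rw [sum_congr rfl h1,
    sum_Icc_sum_divisorsAntidiagonal N fun b m => f b * g m * spinCoeff (b * m), sum_primaryBall]
  refine sum_congr rfl fun b hb => ?_
  have hb0 : b ≠ 0 := by rw [mem_Icc] at hb; omega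
  have h2 : ∀ w ∈ primaryNorm b, ∑ z ∈ primaryBall N, f w.norm.natAbs * g z.norm.natAbs *
      (if w.norm.natAbs * z.norm.natAbs ≤ N then upperSpin (w * z) else 0) =
      ∑ m ∈ Icc 1 N, ∑ z ∈ primaryNorm m, f b * g m *
        if b * m ≤ N then upperSpin (w * z) else 0 := by
    intro w hw
    rw [sum_primaryBall, natAbs_norm_of_mem_primaryNorm hw]
    exact sum_congr rfl fun m _ => sum_congr rfl fun z hz => by
      rw [natAbs_norm_of_mem_primaryNorm hz]
  rw [sum_congr rfl h2, sum_comm]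
  refine sum_congr rfl fun m _ => ?_
  split_ifs with h
  · simp only [spinCoeff_mul hb0, mul_sum]
  · simp

end GaussianSpin

/-! ### Type I and type II sums over the spin -/

namespace GaussianSpin

open Finset ArithmeticFunction

/-- The left side is `q ^ (1 / 12 - ε) * (q X) ^ (11 / 12 + ε)`: the loss of a full factor `N(w)` in
the sum over multiples is mostly compensated by the shorter range `X ≤ N / q`. -/
theorem mul_rpow_le_of_mul_le {q X N D ε : ℝ} (hε : 0 ≤ ε) (hq : 1 ≤ q)
    (hX : 0 ≤ X) (hqX : q * X ≤ N) (hqD : q ≤ D) :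
    q * X ^ (11 / 12 + ε) ≤ D ^ (1 / 12 : ℝ) * N ^ (11 / 12 + ε) := by
  have hq0 : 0 < q := by linarith
  calc q * X ^ (11 / 12 + ε) = q ^ (1 / 12 - ε) * (q * X) ^ (11 / 12 + ε) := by
        rw [Real.mul_rpow hq0.le hX, ← mul_assoc, ← Real.rpow_add hq0,
          show 1 / 12 - ε + (11 / 12 + ε) = 1 by ring, Real.rpow_one]
    _ ≤ q ^ (1 / 12 : ℝ) * N ^ (11 / 12 + ε) := by
        have : q ^ (1 / 12 - ε) ≤ q ^ (1 / 12 : ℝ) :=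
          Real.rpow_le_rpow_of_exponent_le hq (by linarith)
        gcongr
    _ ≤ _ := by
        have : 0 ≤ N := (mul_nonneg hq0.le hX).trans hqX
        gcongr

/-- Convolutions in which one factor has small support and the other one is smooth. -/
theorem exists_sum_spinCoeff_mul_le_of_monotone {ε : ℝ} (hε : 0 < ε) :
    ∃ C : ℝ, 1 ≤ C ∧ ∀ (N D : ℕ) (f g : ArithmeticFunction ℝ) (h : ℕ → ℝ) (L G : ℝ),
      1 ≤ D → 0 ≤ L → (∀ b ≤ N, |f b| ≤ L) → (∀ b, D < b → f b = 0) →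
      Monotone h → 0 ≤ h 0 → (∀ n, n ≠ 0 → g n = h n) → h N ≤ G →
      |∑ n ∈ Icc 1 N, spinCoeff n * (f * g) n| ≤
        C * (L * G * ((D : ℝ) ^ (13 / 12 : ℝ) * (N : ℝ) ^ (11 / 12 + ε))) := by
  obtain ⟨C, hC1, hC⟩ := exists_sum_upperSpin_mul_le hε
  refine ⟨18 * C, by linarith, ?_⟩
  intro N D f g h L G hD hL hfL hfD hmono h0 hgh hG
  have hG0 : 0 ≤ G := (h0.trans (hmono (Nat.zero_le N))).trans hG
  set M : ℝ := C * ((D : ℝ) ^ (1 / 12 : ℝ) * (N : ℝ) ^ (11 / 12 + ε)) with hM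
  have hM0 : 0 ≤ M := by positivity
  rw [sum_spinCoeff_mul]
  have inner : ∀ w ∈ primaryBall N, |∑ z ∈ primaryBall N, f w.norm.natAbs * g z.norm.natAbs *
      (if w.norm.natAbs * z.norm.natAbs ≤ N then upperSpin (w * z) else 0)| ≤
      if w.norm.natAbs ≤ D then L * (2 * G * M) else 0 := by
    intro w hw
    rw [mem_primaryBall] at hw
    have hq0 := hw.1.norm_pos
    obtain ⟨q, hq⟩ : ∃ q, q = w.norm.natAbs := ⟨_, rfl⟩
    rw [← hq]
    have hqc : (w.norm : ℝ) = q := by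
      have : w.norm = (q : ℤ) := by omega
      rw [this]; simp
    have hq1 : 1 ≤ q := by omega
    have hqN : q ≤ N := by have := hw.2; omega
    split_ifs with hqD
    · have h1 : ∑ z ∈ primaryBall N, f q * g z.norm.natAbs *
          (if q * z.norm.natAbs ≤ N then upperSpin (w * z) else 0) =
          f q * ∑ m ∈ Icc 1 (N / q), h m * ∑ z ∈ primaryNorm m, upperSpin (w * z) := by
        rw [sum_primaryBall, mul_sum]
        have hsub : Icc 1 (N / q) ⊆ Icc 1 N := Icc_subset_Icc_right (Nat.div_le_self N q)
        rw [← sum_subset hsub]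
        · refine sum_congr rfl fun m hm => ?_
          rw [mem_Icc, Nat.le_div_iff_mul_le hq1] at hm
          rw [mul_sum, mul_sum]
          refine sum_congr rfl fun z hz => ?_
          rw [natAbs_norm_of_mem_primaryNorm hz, if_pos (by rw [mul_comm]; exact hm.2),
            hgh m (by omega), mul_assoc]
        · intro m hm hm'
          rw [mem_Icc] at hm
          rw [mem_Icc, Nat.le_div_iff_mul_le hq1] at hm'
          refine sum_eq_zero fun z hz => ?_
          rw [natAbs_norm_of_mem_primaryNorm hz, if_neg, mul_zero]
          rw [mul_comm]
          exact fun h => hm' ⟨hm.1, h⟩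
      rw [h1, abs_mul]
      refine mul_le_mul (hfL q hqN) ?_ (abs_nonneg _) hL
      refine (abs_sum_mul_le_of_monotone (N / q) hmono h0 (M := M) ?_).trans ?_
      · intro X hX
        rw [← sum_primaryBall X fun z => upperSpin (w * z)]
        rcases Nat.eq_zero_or_pos X with rfl | hX0
        · rw [sum_primaryBall]; simpa using hM0
        · refine (hC w hw.1 X hX0).trans ?_
          rw [hM, hqc]
          refine mul_le_mul_of_nonneg_left ?_ (by linarith)
          refine mul_rpow_le_of_mul_le hε.le (by exact_mod_cast hq1) (Nat.cast_nonneg X) ?_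
            (by exact_mod_cast hqD)
          rw [Nat.le_div_iff_mul_le hq1, mul_comm] at hX
          exact_mod_cast hX
      · have := (hmono (Nat.div_le_self N q)).trans hG
        gcongr
    · rw [hfD q (by omega)]; simp
  refine (abs_sum_le_sum_abs _ _).trans ((sum_le_sum inner).trans ?_)
  rw [← sum_filter, sum_const, nsmul_eq_mul]
  have hcard : (((primaryBall N).filter fun w => w.norm.natAbs ≤ D).card : ℝ) ≤ 9 * D := by
    have h1 : (primaryBall N).filter (fun w => w.norm.natAbs ≤ D) ⊆ primaryBall D := by
      intro w hw
      rw [mem_filter, mem_primaryBall] at hw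
      rw [mem_primaryBall]
      have := hw.2
      exact ⟨hw.1.1, by have := hw.1.1.norm_pos; omega⟩
    exact_mod_cast (card_le_card h1).trans (card_primaryBall_le hD)
  have hD0 : (0 : ℝ) < D := by exact_mod_cast hD
  calc _ ≤ 9 * (D : ℝ) * (L * (2 * G * M)) := by gcongr
    _ = _ := by
      rw [hM, show (13 / 12 : ℝ) = 1 + 1 / 12 by norm_num, Real.rpow_add hD0, Real.rpow_one]
      ring

/-- Convolutions in which both factors vanish at small integers. -/
theorem exists_sum_spinCoeff_mul_le_of_vanish :
    ∃ C : ℝ, 1 ≤ C ∧ ∀ (N y : ℕ) (f g : ArithmeticFunction ℝ) (L : ℝ),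
      1 ≤ N → (N : ℝ) ^ (3 / 100 : ℝ) ≤ y + 1 → 0 < L → (∀ b, |f b| ≤ 1) → (∀ b ≤ y, f b = 0) →
      (∀ m ≤ N, |g m| ≤ L) → (∀ m ≤ y, g m = 0) →
      |∑ n ∈ Icc 1 N, spinCoeff n * (f * g) n| ≤
        C * ((Nat.log 2 N + 1) * L * (N : ℝ) ^ (1 - 7 / 500 : ℝ)) := by
  obtain ⟨C, hC1, hC⟩ := exists_bilinBound_upperSpin
  refine ⟨C, hC1, ?_⟩
  intro N y f g L hN hy hL hf hfy hg hgy
  -- Dyadic blocks in the norm of `w`: in the block `2 ^ i` only `z` of norm at most `N / 2 ^ i`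
  -- matter, so the product of the two ranges is at most `2 N`.
  rw [sum_spinCoeff_mul, ← sum_fiberwise_of_maps_to (t := range (Nat.log 2 N + 1))
    (g := fun w => Nat.log 2 w.norm.natAbs) (fun w hw => by
      rw [mem_primaryBall] at hw
      rw [mem_range, Nat.lt_succ_iff]
      exact Nat.log_mono_right (by have := hw.1.norm_pos; omega))]
  refine (abs_sum_le_sum_abs _ _).trans ?_
  have hB : ∀ i ∈ range (Nat.log 2 N + 1), |∑ w ∈ (primaryBall N).filter
      (fun w => Nat.log 2 w.norm.natAbs = i), ∑ z ∈ primaryBall N,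
      f w.norm.natAbs * g z.norm.natAbs *
        (if w.norm.natAbs * z.norm.natAbs ≤ N then upperSpin (w * z) else 0)| ≤
      L * (C * (N : ℝ) ^ (1 - 7 / 500 : ℝ)) := by
    intro i _
    have hmem : ∀ w ∈ (primaryBall N).filter (fun w => Nat.log 2 w.norm.natAbs = i),
        IsPrimary w ∧ 2 ^ i ≤ w.norm.natAbs ∧ w.norm.natAbs < 2 ^ (i + 1) := by
      intro w hw
      rw [mem_filter, mem_primaryBall] at hw
      have h0 := hw.1.1.norm_pos
      refine ⟨hw.1.1, ?_, ?_⟩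
      · rw [← hw.2]; exact Nat.pow_log_le_self 2 (by omega)
      · rw [← hw.2]; exact Nat.lt_pow_succ_log_self (by norm_num) _
    have hzero : ∀ w ∈ (primaryBall N).filter (fun w => Nat.log 2 w.norm.natAbs = i),
        ∀ z : GaussianInt, N / 2 ^ i < z.norm.natAbs →
        f w.norm.natAbs * g z.norm.natAbs *
        (if w.norm.natAbs * z.norm.natAbs ≤ N then upperSpin (w * z) else 0) = 0 := by
      intro w hw z hz
      rw [if_neg, mul_zero]
      rw [Nat.div_lt_iff_lt_mul (by positivity), mul_comm] at hz
      exact not_le.2 (hz.trans_le (Nat.mul_le_mul_right _ (hmem w hw).2.1))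
    have hbound0 : 0 ≤ L * (C * (N : ℝ) ^ (1 - 7 / 500 : ℝ)) := by positivity
    -- A block in which one of the ranges stays below `y` is empty, as `f` or `g` vanishes there; in
    -- the others both ranges reach `y + 1 ≥ N ^ (3 / 100)`.
    by_cases hP : 2 ^ (i + 1) ≤ y
    · rw [sum_eq_zero, abs_zero]
      · exact hbound0
      · intro w hw
        refine sum_eq_zero fun z _ => ?_
        rw [hfy _ ((hmem w hw).2.2.le.trans hP), zero_mul, zero_mul]
    by_cases hQ : N / 2 ^ i ≤ y
    · rw [sum_eq_zero, abs_zero]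
      · exact hbound0
      · intro w hw
        refine sum_eq_zero fun z _ => ?_
        rcases le_or_gt z.norm.natAbs y with h | h
        · rw [hgy _ h, mul_zero, zero_mul]
        · exact hzero w hw z (hQ.trans_lt h)
    have hsubW : (primaryBall N).filter (fun w => Nat.log 2 w.norm.natAbs = i) ⊆
        primaryBall (2 ^ (i + 1)) := by
      intro w hw
      have := hmem w hw
      rw [mem_primaryBall]
      exact ⟨this.1, by have := this.2.2; omega⟩
    have hsubZ : primaryBall (N / 2 ^ i) ⊆ primaryBall N := by
      intro z hz
      rw [mem_primaryBall] at hz ⊢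
      exact ⟨hz.1, hz.2.trans (by exact_mod_cast Nat.div_le_self N _)⟩
    have hPQ : ((2 ^ (i + 1) : ℕ) : ℝ) * ((N / 2 ^ i : ℕ) : ℝ) ≤ 2 * (N : ℝ) := by
      have : 2 ^ (i + 1) * (N / 2 ^ i) ≤ 2 * N := by
        rw [pow_succ, mul_comm (2 ^ i) 2, mul_assoc]
        exact Nat.mul_le_mul_left 2 (Nat.mul_div_le N _)
      exact_mod_cast this
    have hP' : (N : ℝ) ^ (3 / 100 : ℝ) ≤ (2 ^ (i + 1) : ℕ) :=
      hy.trans (by exact_mod_cast not_le.1 hP)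
    have hQ' : (N : ℝ) ^ (3 / 100 : ℝ) ≤ (N / 2 ^ i : ℕ) :=
      hy.trans (by exact_mod_cast not_le.1 hQ)
    have key := ((hC _ _ N (by exact_mod_cast hN) hPQ hP' hQ').subset hsubW subset_rfl)
      (fun w => f w.norm.natAbs) (fun z => if z.norm.natAbs ≤ N then g z.norm.natAbs / L else 0)
      (fun w => hf _) (fun z => by
        split_ifs with h
        · rw [abs_div, abs_of_pos hL, div_le_one hL]; exact hg _ h
        · simp)
    have := mul_le_mul_of_nonneg_left key hL.le
    rw [← abs_of_pos hL, ← abs_mul, abs_of_pos hL] at this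
    refine le_of_eq_of_le (congrArg abs ?_) this
    rw [mul_sum]
    refine sum_congr rfl fun w hw => ?_
    rw [mul_sum, ← sum_subset hsubZ]
    · refine sum_congr rfl fun z hz => ?_
      have hzN := (mem_primaryBall.1 (hsubZ hz)).2
      have hz0 := (mem_primaryBall.1 hz).1.norm_pos
      have hw0 := (hmem w hw).1.norm_pos
      have hle : z.norm.natAbs ≤ N := by omega
      have hiff : ((w.norm : ℝ) * z.norm ≤ N) ↔ w.norm.natAbs * z.norm.natAbs ≤ N := by
        rw [show w.norm = (w.norm.natAbs : ℤ) by omega, show z.norm = (z.norm.natAbs : ℤ) by omega,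
          Int.cast_natCast, Int.cast_natCast, Int.natAbs_natCast, Int.natAbs_natCast]
        exact_mod_cast Iff.rfl
      simp only [hiff, if_pos hle]
      field_simp
    · intro z hz hz'
      refine hzero w hw z ?_
      rw [mem_primaryBall] at hz hz'
      by_contra h
      exact hz' ⟨hz.1, by have := hz.1.norm_pos; omega⟩
  refine (sum_le_sum hB).trans (le_of_eq ?_)
  rw [sum_const, card_range, nsmul_eq_mul]
  push_cast
  ring

end GaussianSpin

/-! ### Vaughan's identity -/

namespace GaussianSpin

open Finset ArithmeticFunction
open scoped ArithmeticFunction.Moebius ArithmeticFunction.zeta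

/-- The restriction of an arithmetic function to the integers up to `y`. -/
noncomputable def lowPart (y : ℕ) (f : ArithmeticFunction ℝ) : ArithmeticFunction ℝ :=
  ⟨fun n => if n ≤ y then f n else 0, by simp⟩

theorem lowPart_apply (y : ℕ) (f : ArithmeticFunction ℝ) (n : ℕ) :
    lowPart y f n = if n ≤ y then f n else 0 := rfl

theorem arithmeticFunction_sub_apply (f g : ArithmeticFunction ℝ) (n : ℕ) :
    (f - g) n = f n - g n := by
  rw [eq_sub_iff_add_eq, ← ArithmeticFunction.add_apply, sub_add_cancel]

theorem sub_lowPart_apply (y : ℕ) (f : ArithmeticFunction ℝ) (n : ℕ) :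
    (f - lowPart y f) n = if n ≤ y then 0 else f n := by
  rw [arithmeticFunction_sub_apply, lowPart_apply]
  split_ifs <;> ring

theorem abs_moebius_le (n : ℕ) : |(μ : ArithmeticFunction ℝ) n| ≤ 1 := by
  rw [intCoe_apply]
  exact_mod_cast abs_moebius_le_one

/-- Vaughan's identity. -/
theorem vonMangoldt_eq_vaughan (y : ℕ) :
    Λ = lowPart y Λ + lowPart y μ * ArithmeticFunction.log - lowPart y μ * lowPart y Λ * ζ +
      ((μ : ArithmeticFunction ℝ) - lowPart y μ) * ((Λ - lowPart y Λ) * ζ) := by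
  have h1 : Λ * (ζ : ArithmeticFunction ℝ) = ArithmeticFunction.log := vonMangoldt_mul_zeta
  have h2 : (μ : ArithmeticFunction ℝ) * (ζ : ArithmeticFunction ℝ) = 1 :=
    coe_moebius_mul_coe_zeta
  linear_combination (lowPart y Λ - Λ) * h2 + lowPart y μ * h1

/-- Bound the Möbius factor by `1`, drop the truncation of `Λ ≥ 0` and use that `Λ` sums to `log`
over divisors. -/
theorem abs_lowPart_mul_lowPart_le (y b : ℕ) :
    |(lowPart y μ * lowPart y Λ) b| ≤ Real.log b := by
  rw [ArithmeticFunction.mul_apply]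
  refine (abs_sum_le_sum_abs _ _).trans ?_
  have h1 : Real.log b = ∑ p ∈ b.divisorsAntidiagonal, Λ p.2 := by
    rw [← vonMangoldt_sum, Nat.sum_divisorsAntidiagonal' (f := fun _ e => Λ e)]
  rw [h1]
  refine sum_le_sum fun p _ => ?_
  rw [abs_mul, ← one_mul (Λ p.2)]
  refine mul_le_mul ?_ ?_ (abs_nonneg _) zero_le_one
  · rw [lowPart_apply]
    split_ifs
    · exact abs_moebius_le _
    · simp
  · rw [lowPart_apply]
    split_ifs
    · rw [abs_of_nonneg vonMangoldt_nonneg]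
    · simp [vonMangoldt_nonneg]

theorem lowPart_mul_lowPart_eq_zero {y b : ℕ} (h : y ^ 2 < b) :
    (lowPart y μ * lowPart y Λ) b = 0 := by
  rw [ArithmeticFunction.mul_apply]
  refine sum_eq_zero fun p hp => ?_
  rw [lowPart_apply, lowPart_apply]
  have hpb := (Nat.mem_divisorsAntidiagonal.1 hp).1
  split_ifs with h1 h2
  · exact absurd (Nat.mul_le_mul h1 h2) (by rw [hpb, ← sq]; exact not_le.2 h)
  all_goals simp

theorem abs_sub_lowPart_mul_zeta_le (y m : ℕ) :
    |((Λ - lowPart y Λ) * (ζ : ArithmeticFunction ℝ)) m| ≤ Real.log m := by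
  have h1 : Real.log m = ∑ e ∈ m.divisors, Λ e := vonMangoldt_sum.symm
  rw [coe_mul_zeta_apply, h1]
  refine (abs_sum_le_sum_abs _ _).trans (sum_le_sum fun e _ => ?_)
  rw [sub_lowPart_apply]
  split_ifs
  · simp [vonMangoldt_nonneg]
  · rw [abs_of_nonneg vonMangoldt_nonneg]

theorem sub_lowPart_mul_zeta_eq_zero {y m : ℕ} (h : m ≤ y) :
    ((Λ - lowPart y Λ) * (ζ : ArithmeticFunction ℝ)) m = 0 := by
  rw [coe_mul_zeta_apply]
  refine sum_eq_zero fun e he => ?_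
  rw [sub_lowPart_apply, if_pos ((Nat.divisor_le he).trans h)]

/-- An element of norm `n` divides `n`, so their number is controlled by the divisor bound. -/
theorem exists_abs_spinCoeff_le {ε : ℝ} (hε : 0 < ε) :
    ∃ C : ℝ, 1 ≤ C ∧ ∀ n : ℕ, 1 ≤ n → |spinCoeff n| ≤ C * (n : ℝ) ^ ε := by
  obtain ⟨C, hC1, hC⟩ := exists_card_divisors_le (ε := ε / 2) (by positivity)
  refine ⟨C, hC1, fun n hn => ?_⟩
  have hn0 : (0 : ℝ) < n := by exact_mod_cast hn
  have h1 := hC (n : GaussianInt) (by exact_mod_cast (by omega : n ≠ 0)) (primaryNorm n)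
    (fun z hz => by
      have h := (mem_primaryNorm.1 hz).2
      refine ⟨star z, ?_⟩
      rw [← Zsqrtd.norm_eq_mul_conj, h]
      simp)
  have h2 : (((n : GaussianInt).norm : ℤ) : ℝ) ^ (ε / 2) = (n : ℝ) ^ ε := by
    rw [Zsqrtd.norm_natCast]
    push_cast
    rw [← sq, ← Real.rpow_natCast, ← Real.rpow_mul hn0.le]
    congr 1
    push_cast; ring
  rw [h2] at h1
  refine le_trans ?_ h1
  refine (abs_sum_le_sum_abs _ _).trans ((sum_le_sum fun z _ => abs_upperSpin_le z).trans ?_)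
  simp

theorem monotone_log_natCast : Monotone fun n : ℕ => Real.log n := by
  intro a b hab
  rcases Nat.eq_zero_or_pos a with rfl | ha
  · simpa using Real.log_natCast_nonneg b
  · exact Real.log_le_log (by exact_mod_cast ha) (by exact_mod_cast hab)

theorem exists_log_add_one_le {η : ℝ} (hη : 0 < η) :
    ∃ C : ℝ, 1 ≤ C ∧ ∀ N : ℕ, 1 ≤ N → Real.log N + 1 ≤ C * (N : ℝ) ^ η := by
  refine ⟨1 / η + 1, by have : 0 < 1 / η := by positivity
                        linarith, fun N hN => ?_⟩
  have h1 : (1 : ℝ) ≤ N := by exact_mod_cast hN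
  have h2 := Real.log_le_rpow_div (by linarith : (0 : ℝ) ≤ N) hη
  have h3 : 1 ≤ (N : ℝ) ^ η := Real.one_le_rpow h1 hη.le
  rw [add_mul, one_div, ← div_eq_inv_mul]
  linarith

/-- The sum of the spins, weighted by the von Mangoldt function. -/
theorem exists_sum_spinCoeff_mul_vonMangoldt_le :
    ∃ C : ℝ, 1 ≤ C ∧ ∀ N : ℕ, 1 ≤ N →
      |∑ n ∈ Icc 1 N, spinCoeff n * Λ n| ≤ C * (N : ℝ) ^ (1 - 27 / 2000 : ℝ) := by
  obtain ⟨C₀, hC₀1, hC₀⟩ := exists_abs_spinCoeff_le (ε := 1 / 1000) (by norm_num)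
  obtain ⟨C₁, hC₁1, hC₁⟩ := exists_sum_spinCoeff_mul_le_of_monotone (ε := 1 / 1000) (by norm_num)
  obtain ⟨C₂, hC₂1, hC₂⟩ := exists_sum_spinCoeff_mul_le_of_vanish
  obtain ⟨K, hK1, hK⟩ := exists_log_add_one_le (η := 1 / 10000) (by norm_num)
  obtain ⟨K', hK'1, hK'⟩ := exists_natLog_add_le (η := 1 / 10000) (by norm_num)
  refine ⟨C₀ * K + C₁ * K + C₁ * K + C₂ * (K' * K), ?_, fun N hN => ?_⟩
  · have : 1 ≤ C₀ * K := one_le_mul_of_one_le_of_one_le hC₀1 hK1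
    have : 0 ≤ C₁ * K := by positivity
    have : 0 ≤ C₂ * (K' * K) := by positivity
    linarith
  have hN1 : (1 : ℝ) ≤ N := by exact_mod_cast hN
  have hN0 : (0 : ℝ) < N := by linarith
  have hlogN : 0 ≤ Real.log N := Real.log_nonneg hN1
  -- The type II estimate needs `y + 1 ≥ N ^ (3 / 100)`, while the type I estimate wants `y` small.
  -- Its divisors run up to `y² ≤ N ^ (6 / 100)`, which still yields `N ^ (983 / 1000)`.
  obtain ⟨y, hy⟩ : ∃ y, y = ⌊(N : ℝ) ^ (3 / 100 : ℝ)⌋₊ := ⟨_, rfl⟩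
  have hyle : (y : ℝ) ≤ (N : ℝ) ^ (3 / 100 : ℝ) := by
    rw [hy]; exact Nat.floor_le (by positivity)
  have hylt : (N : ℝ) ^ (3 / 100 : ℝ) ≤ y + 1 := by
    rw [hy]; exact (Nat.lt_floor_add_one _).le
  have hy1 : 1 ≤ y := by
    rw [hy]; exact Nat.le_floor (by simpa using Real.one_le_rpow hN1 (by norm_num))
  have hexp : ∀ a b : ℝ, a ≤ b → (N : ℝ) ^ a ≤ (N : ℝ) ^ b := fun a b h =>
    Real.rpow_le_rpow_of_exponent_le hN1 h
  have hD : ((y ^ 2 : ℕ) : ℝ) ^ (13 / 12 : ℝ) * (N : ℝ) ^ (11 / 12 + 1 / 1000 : ℝ) ≤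
      (N : ℝ) ^ (983 / 1000 : ℝ) := by
    have h1 : ((y ^ 2 : ℕ) : ℝ) ≤ (N : ℝ) ^ (6 / 100 : ℝ) := by
      push_cast
      refine (pow_le_pow_left₀ (Nat.cast_nonneg y) hyle 2).trans (le_of_eq ?_)
      rw [rpow_pow_eq hN0]
      norm_num
    calc ((y ^ 2 : ℕ) : ℝ) ^ (13 / 12 : ℝ) * (N : ℝ) ^ (11 / 12 + 1 / 1000 : ℝ)
        ≤ ((N : ℝ) ^ (6 / 100 : ℝ)) ^ (13 / 12 : ℝ) * (N : ℝ) ^ (11 / 12 + 1 / 1000 : ℝ) := by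
          gcongr
      _ = (N : ℝ) ^ (6 / 100 * (13 / 12) + (11 / 12 + 1 / 1000) : ℝ) := by
          rw [← Real.rpow_mul hN0.le, ← Real.rpow_add hN0]
      _ ≤ _ := hexp _ _ (by norm_num)
  have hfin : ∀ a b : ℝ, a + b ≤ 1 - 27 / 2000 → (N : ℝ) ^ a * (N : ℝ) ^ b ≤
      (N : ℝ) ^ (1 - 27 / 2000 : ℝ) := by
    intro a b h
    rw [← Real.rpow_add hN0]
    exact hexp _ _ h
  have hℓ := hK N hN
  have hsmall : |∑ n ∈ Icc 1 N, spinCoeff n * lowPart y Λ n| ≤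
      C₀ * K * (N : ℝ) ^ (1 - 27 / 2000 : ℝ) := by
    have h1 : ∀ n ∈ Icc 1 N, |spinCoeff n * lowPart y Λ n| ≤
        if n ≤ y then C₀ * (N : ℝ) ^ (1 / 1000 : ℝ) * (K * (N : ℝ) ^ (1 / 10000 : ℝ)) else 0 := by
      intro n hn
      rw [mem_Icc] at hn
      rw [lowPart_apply, abs_mul]
      split_ifs
      · have hnN : (n : ℝ) ≤ N := by exact_mod_cast hn.2
        refine mul_le_mul ((hC₀ n hn.1).trans ?_) ?_ (abs_nonneg _) (by positivity)
        · gcongr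
        · rw [abs_of_nonneg vonMangoldt_nonneg]
          have := vonMangoldt_le_log (n := n)
          have := monotone_log_natCast hn.2
          dsimp only at this
          linarith
      · simp
    refine (abs_sum_le_sum_abs _ _).trans ((sum_le_sum h1).trans ?_)
    rw [← sum_filter, sum_const, nsmul_eq_mul]
    have hcard : (((Icc 1 N).filter fun n => n ≤ y).card : ℝ) ≤ (N : ℝ) ^ (3 / 100 : ℝ) := by
      refine le_trans ?_ hyle
      have : (Icc 1 N).filter (fun n => n ≤ y) ⊆ Icc 1 y := by
        intro n hn
        simp only [mem_filter, mem_Icc] at hn ⊢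
        omega
      exact_mod_cast (card_le_card this).trans (by simp)
    calc _ ≤ (N : ℝ) ^ (3 / 100 : ℝ) *
          (C₀ * (N : ℝ) ^ (1 / 1000 : ℝ) * (K * (N : ℝ) ^ (1 / 10000 : ℝ))) := by gcongr
      _ = C₀ * K * ((N : ℝ) ^ (3 / 100 : ℝ) * (N : ℝ) ^ (1 / 1000 + 1 / 10000 : ℝ)) := by
          rw [Real.rpow_add hN0]; ring
      _ ≤ _ := by
          refine mul_le_mul_of_nonneg_left (hfin _ _ (by norm_num)) (by positivity)
  have hlow1 : |∑ n ∈ Icc 1 N, spinCoeff n * (lowPart y μ * ArithmeticFunction.log) n| ≤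
      C₁ * K * (N : ℝ) ^ (1 - 27 / 2000 : ℝ) := by
    have h1 := hC₁ N (y ^ 2) (lowPart y μ) ArithmeticFunction.log (fun n => Real.log n) 1
      (K * (N : ℝ) ^ (1 / 10000 : ℝ)) (Nat.one_le_pow _ _ hy1) zero_le_one
      (fun b _ => by
        rw [lowPart_apply]; split_ifs
        · exact abs_moebius_le b
        · simp)
      (fun b hb => by
        rw [lowPart_apply, if_neg]
        have : y ≤ y ^ 2 := Nat.le_self_pow (by norm_num) y
        omega) monotone_log_natCast (by simp) (fun n _ => rfl) (by linarith)
    refine h1.trans ?_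
    calc _ ≤ C₁ * (1 * (K * (N : ℝ) ^ (1 / 10000 : ℝ)) * (N : ℝ) ^ (983 / 1000 : ℝ)) := by
          gcongr
      _ = C₁ * K * ((N : ℝ) ^ (1 / 10000 : ℝ) * (N : ℝ) ^ (983 / 1000 : ℝ)) := by ring
      _ ≤ _ := mul_le_mul_of_nonneg_left (hfin _ _ (by norm_num)) (by positivity)
  have hlow2 : |∑ n ∈ Icc 1 N, spinCoeff n * (lowPart y μ * lowPart y Λ * ζ) n| ≤
      C₁ * K * (N : ℝ) ^ (1 - 27 / 2000 : ℝ) := by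
    have h1 := hC₁ N (y ^ 2) (lowPart y μ * lowPart y Λ) ζ (fun _ => 1)
      (K * (N : ℝ) ^ (1 / 10000 : ℝ)) 1 (Nat.one_le_pow _ _ hy1) (by positivity)
      (fun b hb => by
        have := abs_lowPart_mul_lowPart_le y b
        have := monotone_log_natCast hb
        dsimp only at this
        linarith)
      (fun b hb => lowPart_mul_lowPart_eq_zero hb) monotone_const zero_le_one
      (fun n hn => by rw [natCoe_apply, zeta_apply, if_neg hn, Nat.cast_one]) le_rfl
    refine h1.trans ?_
    calc _ ≤ C₁ * (K * (N : ℝ) ^ (1 / 10000 : ℝ) * 1 * (N : ℝ) ^ (983 / 1000 : ℝ)) := by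
          gcongr
      _ = C₁ * K * ((N : ℝ) ^ (1 / 10000 : ℝ) * (N : ℝ) ^ (983 / 1000 : ℝ)) := by ring
      _ ≤ _ := mul_le_mul_of_nonneg_left (hfin _ _ (by norm_num)) (by positivity)
  have hhigh : |∑ n ∈ Icc 1 N, spinCoeff n *
      (((μ : ArithmeticFunction ℝ) - lowPart y μ) * ((Λ - lowPart y Λ) * ζ)) n| ≤
      C₂ * (K' * K) * (N : ℝ) ^ (1 - 27 / 2000 : ℝ) := by
    have h1 := hC₂ N y ((μ : ArithmeticFunction ℝ) - lowPart y μ) ((Λ - lowPart y Λ) * ζ)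
      (K * (N : ℝ) ^ (1 / 10000 : ℝ)) hN hylt (by positivity)
      (fun b => by
        rw [sub_lowPart_apply]; split_ifs
        · simp
        · exact abs_moebius_le b)
      (fun b hb => by rw [sub_lowPart_apply, if_pos hb])
      (fun m hm => by
        have := abs_sub_lowPart_mul_zeta_le y m
        have := monotone_log_natCast hm
        dsimp only at this
        linarith)
      (fun m hm => sub_lowPart_mul_zeta_eq_zero hm)
    refine h1.trans ?_
    have h2 := hK' N hN
    calc _ ≤ C₂ * (K' * (N : ℝ) ^ (1 / 10000 : ℝ) * (K * (N : ℝ) ^ (1 / 10000 : ℝ)) *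
          (N : ℝ) ^ (1 - 7 / 500 : ℝ)) := by
          gcongr
          linarith
      _ = C₂ * (K' * K) * ((N : ℝ) ^ (1 / 10000 + 1 / 10000 : ℝ) *
          (N : ℝ) ^ (1 - 7 / 500 : ℝ)) := by rw [Real.rpow_add hN0]; ring
      _ ≤ _ := mul_le_mul_of_nonneg_left (hfin _ _ (by norm_num)) (by positivity)
  have hsplit : ∑ n ∈ Icc 1 N, spinCoeff n * Λ n =
      ∑ n ∈ Icc 1 N, spinCoeff n * lowPart y Λ n +
      ∑ n ∈ Icc 1 N, spinCoeff n * (lowPart y μ * ArithmeticFunction.log) n -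
      ∑ n ∈ Icc 1 N, spinCoeff n * (lowPart y μ * lowPart y Λ * ζ) n +
      ∑ n ∈ Icc 1 N, spinCoeff n *
        (((μ : ArithmeticFunction ℝ) - lowPart y μ) * ((Λ - lowPart y Λ) * ζ)) n := by
    rw [← sum_add_distrib, ← sum_sub_distrib, ← sum_add_distrib]
    refine sum_congr rfl fun n _ => ?_
    rw [← mul_add, ← mul_sub, ← mul_add, ← ArithmeticFunction.add_apply,
      ← arithmeticFunction_sub_apply, ← ArithmeticFunction.add_apply, ← vonMangoldt_eq_vaughan]
  rw [hsplit, abs_le]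
  rw [abs_le] at hsmall hlow1 hlow2 hhigh
  constructor <;> linarith

end GaussianSpin

/-! ### The sum of the spins over the primes -/

namespace GaussianSpin

open Finset ArithmeticFunction

/-- Proper prime powers carry total weight `ψ(N) - θ(N) = O(√N)`, far below the bound even when
multiplied by the size of `spinCoeff`. -/
theorem exists_sum_prime_spinCoeff_mul_log_le :
    ∃ C : ℝ, 1 ≤ C ∧ ∀ N : ℕ, 1 ≤ N →
      |∑ n ∈ Icc 1 N, if n.Prime then spinCoeff n * Real.log n else 0| ≤
        C * (N : ℝ) ^ (1 - 27 / 2000 : ℝ) := by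
  obtain ⟨C₀, hC₀1, hC₀⟩ := exists_abs_spinCoeff_le (ε := 1 / 1000) (by norm_num)
  obtain ⟨C₁, hC₁1, hC₁⟩ := exists_sum_spinCoeff_mul_vonMangoldt_le
  obtain ⟨C₂, hC₂⟩ := Chebyshev.psi_sub_theta_le_mul_sqrt
  refine ⟨C₁ + C₀ * |C₂|, ?_, fun N hN => ?_⟩
  · have : 0 ≤ C₀ * |C₂| := by positivity
    linarith
  have hN1 : (1 : ℝ) ≤ N := by exact_mod_cast hN
  have hN0 : (0 : ℝ) < N := by linarith
  have hsplit : ∑ n ∈ Icc 1 N, (if n.Prime then spinCoeff n * Real.log n else 0) =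
      ∑ n ∈ Icc 1 N, spinCoeff n * Λ n -
        ∑ n ∈ (Icc 1 N).filter (fun n => ¬ n.Prime), spinCoeff n * Λ n := by
    rw [sum_filter, ← sum_sub_distrib]
    refine sum_congr rfl fun n _ => ?_
    by_cases hn : n.Prime
    · simp [hn, vonMangoldt_apply_prime hn]
    · simp [hn]
  have hpow : |∑ n ∈ (Icc 1 N).filter (fun n => ¬ n.Prime), spinCoeff n * Λ n| ≤
      C₀ * |C₂| * (N : ℝ) ^ (1 - 27 / 2000 : ℝ) := by
    have h1 : ∀ n ∈ (Icc 1 N).filter (fun n => ¬ n.Prime), |spinCoeff n * Λ n| ≤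
        C₀ * (N : ℝ) ^ (1 / 1000 : ℝ) * Λ n := by
      intro n hn
      rw [mem_filter, mem_Icc] at hn
      rw [abs_mul, abs_of_nonneg (vonMangoldt_nonneg (n := n))]
      refine mul_le_mul_of_nonneg_right ((hC₀ n hn.1.1).trans ?_) vonMangoldt_nonneg
      have : (n : ℝ) ≤ N := by exact_mod_cast hn.1.2
      gcongr
    refine (abs_sum_le_sum_abs _ _).trans ((sum_le_sum h1).trans ?_)
    rw [← mul_sum]
    have h2 : ∑ n ∈ (Icc 1 N).filter (fun n => ¬ n.Prime), Λ n =
        Chebyshev.psi N - Chebyshev.theta N := by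
      rw [Chebyshev.psi_sub_theta_eq_sum_not_prime, Nat.floor_natCast]
      rfl
    rw [h2]
    have h3 : Chebyshev.psi N - Chebyshev.theta N ≤ |C₂| * (N : ℝ) ^ (1 / 2 : ℝ) := by
      rw [← Real.sqrt_eq_rpow]
      exact (hC₂ N).trans (mul_le_mul_of_nonneg_right (le_abs_self _) (Real.sqrt_nonneg _))
    calc _ ≤ C₀ * (N : ℝ) ^ (1 / 1000 : ℝ) * (|C₂| * (N : ℝ) ^ (1 / 2 : ℝ)) := by gcongr
      _ = C₀ * |C₂| * (N : ℝ) ^ (1 / 1000 + 1 / 2 : ℝ) := by rw [Real.rpow_add hN0]; ring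
      _ ≤ _ := by
        refine mul_le_mul_of_nonneg_left ?_ (by positivity)
        exact Real.rpow_le_rpow_of_exponent_le hN1 (by norm_num)
  rw [hsplit, add_mul]
  exact (abs_sub _ _).trans (add_le_add (hC₁ N hN) hpow)

/-- The maximum with `2` changes nothing at primes, and avoids the value `0` that `1 / log` takes by
convention at `0` and `1`, which would spoil monotonicity. -/
theorem antitone_inv_log_max : Antitone fun n : ℕ => (Real.log (max n 2 : ℕ))⁻¹ := by
  intro a b hab
  have h2 : (1 : ℝ) < ((max a 2 : ℕ) : ℝ) := by exact_mod_cast (by omega : 1 < max a 2)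
  refine inv_anti₀ (Real.log_pos h2) (Real.log_le_log (by linarith) ?_)
  exact_mod_cast max_le_max_right 2 hab

/-- The sum of the spins over the primes. -/
theorem exists_sum_prime_spinCoeff_le :
    ∃ C : ℝ, 1 ≤ C ∧ ∀ N : ℕ, 1 ≤ N →
      |∑ n ∈ Icc 1 N, if n.Prime then spinCoeff n else 0| ≤
        C * (N : ℝ) ^ (1 - 27 / 2000 : ℝ) := by
  obtain ⟨C, hC1, hC⟩ := exists_sum_prime_spinCoeff_mul_log_le
  have hlog2 : 0 < Real.log 2 := Real.log_pos (by norm_num)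
  refine ⟨(Real.log 2)⁻¹ * C, ?_, fun N hN => ?_⟩
  · have : 1 ≤ (Real.log 2)⁻¹ := (one_le_inv₀ hlog2).2 (by
      have := Real.log_two_lt_d9; linarith)
    exact one_le_mul_of_one_le_of_one_le this hC1
  have h1 := abs_sum_mul_le_of_antitone
    (t := fun n => if n.Prime then spinCoeff n * Real.log n else 0)
    (M := C * (N : ℝ) ^ (1 - 27 / 2000 : ℝ)) N antitone_inv_log_max
    (fun n => inv_nonneg.2 (Real.log_natCast_nonneg _)) (fun X hX => by
      rcases Nat.eq_zero_or_pos X with rfl | hX0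
      · simp only [zero_lt_one, Icc_eq_empty_of_lt, sum_empty, abs_zero]; positivity
      · refine (hC X hX0).trans ?_
        have : (X : ℝ) ≤ N := by exact_mod_cast hX
        gcongr)
  refine le_of_eq_of_le (congrArg abs (sum_congr rfl fun n hn => ?_)) (h1.trans (le_of_eq ?_))
  · split_ifs with hp
    · have h2 := hp.two_le
      rw [max_eq_left h2]
      have : 0 < Real.log n := Real.log_pos (by exact_mod_cast hp.one_lt)
      field_simp
    · simp
  · norm_num; ring

theorem eq_one_of_odd_of_prime {r s : ℕ} (hr : Odd r) (hs : Odd s) (hp : (r ^ 2 + s ^ 2).Prime) :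
    r = 1 ∧ s = 1 := by
  have h2 : r ^ 2 + s ^ 2 = 2 := (hp.even_iff).1 (hr.pow.add_odd hs.pow)
  have hr0 := hr.pos
  have hs0 := hs.pos
  constructor <;> nlinarith

theorem mem_spinPairs {x : ℝ} (hx : 0 ≤ x) {rs : ℕ × ℕ} :
    rs ∈ spinPairs x ↔ (0 < rs.1 ∧ 0 < rs.2) ∧ Odd rs.1 ∧
      (rs.1 ^ 2 + rs.2 ^ 2).Prime ∧ rs.1 ^ 2 + rs.2 ^ 2 ≤ ⌊x⌋₊ := by
  rw [spinPairs, mem_filter, mem_product, mem_Icc, mem_Icc]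
  constructor
  · rintro ⟨⟨⟨h1, -⟩, h2, -⟩, h3, h4, h5⟩
    exact ⟨⟨h1, h2⟩, h3, h4, Nat.le_floor h5⟩
  · rintro ⟨⟨h1, h2⟩, h3, h4, h5⟩
    exact ⟨⟨⟨h1, by nlinarith⟩, h2, by nlinarith⟩, h3, h4, (Nat.le_floor_iff hx).1 h5⟩

/-- For `s` even exactly one of `r + i s` and `-r + i s` is primary, and both have spin `(s / r)`.
If `s` is odd the prime is `2`, and the pair `(1, 1)` accounts for the `1`. -/
theorem abs_spinSum_le {x : ℝ} (hx : 0 ≤ x) :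
    |(spinSum x : ℝ)| ≤ 1 + |∑ n ∈ Icc 1 ⌊x⌋₊, if n.Prime then spinCoeff n else 0| := by
  classical
  set N := ⌊x⌋₊ with hN
  have h1 : ∑ n ∈ Icc 1 N, (if n.Prime then spinCoeff n else 0) =
      ∑ z ∈ (primaryBall N).filter (fun z => z.norm.natAbs.Prime ∧ 0 < z.im), (spin z : ℝ) := by
    rw [sum_filter, sum_primaryBall]
    refine sum_congr rfl fun n _ => ?_
    rw [spinCoeff]
    split_ifs with hp
    · refine sum_congr rfl fun z hz => ?_
      rw [natAbs_norm_of_mem_primaryNorm hz, upperSpin]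
      simp only [hp, true_and]
    · symm
      refine sum_eq_zero fun z hz => ?_
      rw [natAbs_norm_of_mem_primaryNorm hz, if_neg fun h => hp h.1]
  have h2 : ∑ rs ∈ (spinPairs x).filter (fun rs => Even rs.2), (jacobiSym rs.2 rs.1 : ℝ) =
      ∑ z ∈ (primaryBall N).filter (fun z => z.norm.natAbs.Prime ∧ 0 < z.im), (spin z : ℝ) := by
    refine sum_nbij' (fun rs => ⟨if (rs.1 + rs.2) % 4 = 1 then rs.1 else -rs.1, rs.2⟩)
      (fun z => (z.re.natAbs, z.im.natAbs)) ?_ ?_ ?_ ?_ ?_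
    · rintro ⟨r, s⟩ h
      rw [mem_filter, mem_spinPairs hx] at h
      obtain ⟨⟨⟨hr0, hs0⟩, hr, hp, hle⟩, hs⟩ := h
      dsimp only at *
      obtain ⟨k, rfl⟩ := hr
      obtain ⟨l, rfl⟩ := hs
      set z : GaussianInt := ⟨if (2 * k + 1 + (l + l)) % 4 = 1 then ((2 * k + 1 : ℕ) : ℤ) else
        -((2 * k + 1 : ℕ) : ℤ), ((l + l : ℕ) : ℤ)⟩ with hz
      have hnorm : z.norm = (((2 * k + 1) ^ 2 + (l + l) ^ 2 : ℕ) : ℤ) := by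
        rw [norm_eq, hz]
        dsimp only
        split_ifs <;> push_cast <;> ring
      rw [mem_filter, mem_primaryBall, hnorm, Int.natAbs_natCast]
      refine ⟨⟨?_, by exact_mod_cast hle⟩, hp, ?_⟩
      · constructor
        · rw [hz]; dsimp only; omega
        · rw [hz]; dsimp only; split_ifs <;> omega
      · rw [hz]; dsimp only; omega
    · intro z h
      rw [mem_filter, mem_primaryBall] at h
      obtain ⟨⟨hz, hle⟩, hp, him⟩ := h
      have hn : z.re.natAbs ^ 2 + z.im.natAbs ^ 2 = z.norm.natAbs := by
        zify
        rw [norm_eq, abs_of_nonneg (a := z.re ^ 2 + z.im ^ 2) (by positivity), sq_abs, sq_abs]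
      have hre := hz.odd_re
      have him2 := hz.1
      have hpos := hz.norm_pos
      rw [mem_filter, mem_spinPairs hx]
      dsimp only
      rw [hn]
      refine ⟨⟨⟨by omega, by omega⟩, ?_, hp, by omega⟩, ?_⟩
      · rw [Nat.odd_iff]; omega
      · rw [Nat.even_iff]; omega
    · rintro ⟨r, s⟩ _
      dsimp only
      rw [Prod.mk.injEq]
      constructor
      · split_ifs <;> omega
      · omega
    · intro z h
      rw [mem_filter, mem_primaryBall] at h
      obtain ⟨⟨hz, -⟩, -, him⟩ := h
      have hre := hz.odd_re
      obtain ⟨h1, h2⟩ := hz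
      refine Zsqrtd.ext ?_ ?_
      · dsimp only; split_ifs <;> omega
      · dsimp only; omega
    · rintro ⟨r, s⟩ _
      dsimp only [spin]
      congr 2
      split_ifs <;> omega
  have h3 : ∑ rs ∈ (spinPairs x).filter (fun rs => ¬ Even rs.2),
      |(jacobiSym rs.2 rs.1 : ℝ)| ≤ 1 := by
    refine (sum_le_sum fun _ _ => abs_jacobiSym_le_one _ _).trans ?_
    rw [sum_const, nsmul_eq_mul, mul_one]
    have : (spinPairs x).filter (fun rs => ¬ Even rs.2) ⊆ {(1, 1)} := by
      intro rs h
      rw [mem_filter, mem_spinPairs hx] at h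
      have := eq_one_of_odd_of_prime h.1.2.1 (Nat.not_even_iff_odd.1 h.2) h.1.2.2.1
      rw [mem_singleton]
      exact Prod.ext this.1 this.2
    exact_mod_cast (card_le_card this).trans (by simp)
  rw [spinSum, Int.cast_sum, ← sum_filter_add_sum_filter_not (spinPairs x) fun rs => Even rs.2, h2,
    h1, add_comm]
  exact (abs_add_le _ _).trans (add_le_add_left ((abs_sum_le_sum_abs _ _).trans h3) _)

theorem exists_abs_spinSum_le :
    ∃ C : ℝ, 1 ≤ C ∧ ∀ x : ℝ, 1 ≤ x → |(spinSum x : ℝ)| ≤ C * x ^ (1 - 27 / 2000 : ℝ) := by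
  obtain ⟨C, hC1, hC⟩ := exists_sum_prime_spinCoeff_le
  refine ⟨1 + C, by linarith, fun x hx => ?_⟩
  have h1 := abs_spinSum_le (x := x) (by linarith)
  have h2 := hC ⌊x⌋₊ (Nat.le_floor (by simpa using hx))
  have h3 : C * (⌊x⌋₊ : ℝ) ^ (1 - 27 / 2000 : ℝ) ≤ C * x ^ (1 - 27 / 2000 : ℝ) := by
    have := Nat.floor_le (a := x) (by linarith)
    gcongr
  have h4 : 1 ≤ x ^ (1 - 27 / 2000 : ℝ) := Real.one_le_rpow hx (by norm_num)
  linarith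

end GaussianSpin

/-! ### Primes congruent to one modulo four -/

namespace GaussianSpin

open Finset ArithmeticFunction

theorem sum_Icc_sum_divisorsAntidiagonal_eq_sum_div (N : ℕ) (F : ℕ → ℕ → ℝ) :
    ∑ n ∈ Icc 1 N, ∑ p ∈ n.divisorsAntidiagonal, F p.1 p.2 =
      ∑ d ∈ Icc 1 N, ∑ m ∈ Icc 1 (N / d), F d m := by
  rw [sum_Icc_sum_divisorsAntidiagonal]
  refine sum_congr rfl fun d hd => ?_
  rw [mem_Icc] at hd
  rw [← sum_filter]
  refine sum_congr ?_ fun _ _ => rfl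
  ext m
  rw [mem_filter, mem_Icc, mem_Icc, Nat.le_div_iff_mul_le hd.1, mul_comm m]
  constructor
  · rintro ⟨h1, h2⟩; exact ⟨h1.1, h2⟩
  · rintro ⟨h1, h2⟩; exact ⟨⟨h1, (Nat.le_mul_of_pos_left m hd.1).trans h2⟩, h2⟩

theorem sum_divisorsAntidiagonal_vonMangoldt (n : ℕ) :
    ∑ p ∈ n.divisorsAntidiagonal, Λ p.1 = Real.log n := by
  rw [← vonMangoldt_sum, Nat.sum_divisorsAntidiagonal (f := fun d _ => Λ d)]

theorem sum_log_eq_sum_vonMangoldt_mul (N : ℕ) :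
    ∑ n ∈ Icc 1 N, Real.log n = ∑ d ∈ Icc 1 N, Λ d * (N / d : ℕ) := by
  rw [sum_congr rfl fun n _ => (sum_divisorsAntidiagonal_vonMangoldt n).symm,
    sum_Icc_sum_divisorsAntidiagonal_eq_sum_div N fun d _ => Λ d]
  refine sum_congr rfl fun d _ => ?_
  rw [sum_const, Nat.card_Icc, nsmul_eq_mul, Nat.add_sub_cancel, mul_comm]

theorem sum_vonMangoldt_eq_psi (N : ℕ) : ∑ d ∈ Icc 1 N, Λ d = Chebyshev.psi N := by
  rw [Chebyshev.psi, Nat.floor_natCast]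
  rfl

/-- Chebyshev's identity `log N! = ∑ Λ(d) ⌊N / d⌋` together with `N ^ N / N! ≤ e ^ N`. The upper
bound below uses `log N! ≤ N log N` and pays `ψ(N)` for the integer parts. -/
theorem log_sub_one_le_sum_vonMangoldt_div {N : ℕ} (hN : 1 ≤ N) :
    Real.log N - 1 ≤ ∑ d ∈ Icc 1 N, Λ d / d := by
  have hN0 : (0 : ℝ) < N := by exact_mod_cast hN
  have h1 : ∑ n ∈ Icc 1 N, Real.log n = Real.log (N.factorial : ℝ) := by
    clear hN hN0
    induction N with
    | zero => simp
    | succ N ih =>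
      rw [sum_Icc_succ_top (by omega), ih, Nat.factorial_succ, Nat.cast_mul,
        Real.log_mul (by positivity) (by positivity), add_comm]
  have h2 : N * Real.log N - N ≤ Real.log (N.factorial : ℝ) := by
    have h3 := Real.pow_div_factorial_le_exp (N : ℝ) hN0.le N
    have h4 : (0 : ℝ) < N.factorial := by exact_mod_cast N.factorial_pos
    have h5 := Real.log_le_log (by positivity) h3
    rw [Real.log_exp, Real.log_div (by positivity) h4.ne', Real.log_pow] at h5
    linarith
  have h3 : ∑ d ∈ Icc 1 N, Λ d * (N / d : ℕ) ≤ N * ∑ d ∈ Icc 1 N, Λ d / d := by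
    rw [mul_sum]
    refine sum_le_sum fun d _ => ?_
    calc Λ d * (N / d : ℕ) ≤ Λ d * (N / d) :=
          mul_le_mul_of_nonneg_left Nat.cast_div_le vonMangoldt_nonneg
      _ = N * (Λ d / d) := by ring
  rw [← sum_log_eq_sum_vonMangoldt_mul, h1] at h3
  have : (N : ℝ) * (Real.log N - 1) ≤ N * ∑ d ∈ Icc 1 N, Λ d / d := by linarith
  exact le_of_mul_le_mul_left this hN0

theorem sum_vonMangoldt_div_le {N : ℕ} (hN : 1 ≤ N) :
    ∑ d ∈ Icc 1 N, Λ d / d ≤ Real.log N + (Real.log 4 + 4) := by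
  have hN0 : (0 : ℝ) < N := by exact_mod_cast hN
  have h1 : ∑ n ∈ Icc 1 N, Real.log n ≤ N * Real.log N := by
    refine (sum_le_sum fun n hn => monotone_log_natCast (mem_Icc.1 hn).2).trans (le_of_eq ?_)
    rw [sum_const, Nat.card_Icc, nsmul_eq_mul, Nat.add_sub_cancel]
  have h2 : N * ∑ d ∈ Icc 1 N, Λ d / d ≤ ∑ d ∈ Icc 1 N, Λ d * (N / d : ℕ) + Chebyshev.psi N := by
    rw [← sum_vonMangoldt_eq_psi, ← sum_add_distrib, mul_sum]
    refine sum_le_sum fun d _ => ?_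
    have h3 : (N : ℝ) / d ≤ (N / d : ℕ) + 1 := by
      rw [← Nat.floor_div_eq_div (K := ℝ)]
      exact (Nat.lt_floor_add_one _).le
    have := mul_le_mul_of_nonneg_left h3 (vonMangoldt_nonneg (n := d))
    calc N * (Λ d / d) = Λ d * (N / d) := by ring
      _ ≤ _ := by linarith
  rw [← sum_log_eq_sum_vonMangoldt_mul] at h2
  have h3 := Chebyshev.psi_le_const_mul_self hN0.le
  have : (N : ℝ) * ∑ d ∈ Icc 1 N, Λ d / d ≤ N * (Real.log N + (Real.log 4 + 4)) := by linarith
  exact le_of_mul_le_mul_left this hN0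

/-! ### The character modulo four and its `L`-value at one -/

/-- The nontrivial character modulo four, as a real function on the natural numbers. -/
noncomputable def chiFour (n : ℕ) : ℝ := (ZMod.χ₄ (n : ZMod 4) : ℝ)

theorem chiFour_mul (m n : ℕ) : chiFour (m * n) = chiFour m * chiFour n := by
  rw [chiFour, Nat.cast_mul, map_mul, Int.cast_mul, chiFour, chiFour]

theorem chiFour_eq (n : ℕ) :
    chiFour n = if n % 2 = 0 then 0 else if n % 4 = 1 then 1 else -1 := by
  rw [chiFour, ZMod.χ₄_nat_eq_if_mod_four]
  split_ifs <;> simp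

theorem abs_chiFour_le (n : ℕ) : |chiFour n| ≤ 1 := by
  rw [chiFour_eq]; split_ifs <;> simp

theorem sum_chiFour (X : ℕ) :
    ∑ n ∈ Icc 1 X, chiFour n = if X % 4 = 1 ∨ X % 4 = 2 then 1 else 0 := by
  induction X with
  | zero => simp
  | succ X ih =>
    rw [sum_Icc_succ_top (by omega), ih, chiFour_eq]
    have : X % 4 < 4 := Nat.mod_lt _ (by norm_num)
    split_ifs <;> first | omega | norm_num

theorem abs_sum_chiFour_tail_le (M X : ℕ) :
    |∑ n ∈ Icc 1 X, if M < n then chiFour n else 0| ≤ 1 := by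
  rcases le_or_gt X M with h | h
  · rw [sum_eq_zero, abs_zero]
    · exact zero_le_one
    · intro n hn
      rw [if_neg]
      have := (mem_Icc.1 hn).2
      omega
  · have h1 : ∑ n ∈ Icc 1 X, (if M < n then chiFour n else 0) =
        ∑ n ∈ Icc 1 X, chiFour n - ∑ n ∈ Icc 1 M, chiFour n := by
      have h2 : (Icc 1 X).filter (fun n => n ≤ M) = Icc 1 M := by
        ext n; simp only [mem_filter, mem_Icc]; omega
      rw [← h2, sum_filter, ← sum_sub_distrib]
      refine sum_congr rfl fun n _ => ?_
      split_ifs <;> first | omega | ring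
    rw [h1, sum_chiFour, sum_chiFour]
    split_ifs <;> norm_num

/-- The partial sums of the value at one of the `L`-function. -/
noncomputable def chiFourPartial (N : ℕ) : ℝ := ∑ n ∈ Icc 1 N, chiFour n / n

/-- Partial summation with the weight `1 / max(n, M + 1)`, constant up to `M + 1` and then
decreasing; the sums of the character beyond `M` are bounded by `1`. -/
theorem abs_chiFourPartial_sub_le {M N : ℕ} (h : M ≤ N) :
    |chiFourPartial N - chiFourPartial M| ≤ 1 / (M + 1) := by
  have hanti : Antitone fun n : ℕ => ((max n (M + 1) : ℕ) : ℝ)⁻¹ := by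
    intro a b hab
    refine inv_anti₀ (by exact_mod_cast (by omega : 0 < max a (M + 1))) ?_
    exact_mod_cast max_le_max_right _ hab
  have h1 := abs_sum_mul_le_of_antitone N hanti (fun n => by positivity)
    fun X _ => abs_sum_chiFour_tail_le M X
  have h2 : chiFourPartial N - chiFourPartial M =
      ∑ n ∈ Icc 1 N, ((max n (M + 1) : ℕ) : ℝ)⁻¹ * if M < n then chiFour n else 0 := by
    have h2 : (Icc 1 N).filter (fun n => n ≤ M) = Icc 1 M := by
      ext n; simp only [mem_filter, mem_Icc]; omega
    rw [chiFourPartial, chiFourPartial, ← h2, sum_filter, ← sum_sub_distrib]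
    refine sum_congr rfl fun n _ => ?_
    rcases le_or_gt n M with h | h
    · rw [if_pos h, if_neg (not_lt.2 h)]; ring
    · rw [if_neg (not_le.2 h), if_pos h, max_eq_left h]; ring
  rw [h2]
  refine h1.trans (le_of_eq ?_)
  simp

/-- The effective form of `L(1, χ₄) ≠ 0`: the partial sum at `3` is `2 / 3`, and later ones differ
from it by at most `1 / 4`. -/
theorem chiFourPartial_ge {N : ℕ} (hN : 1 ≤ N) : 5 / 12 ≤ chiFourPartial N := by
  have h3 : chiFourPartial 3 = 2 / 3 := by
    rw [chiFourPartial, show Icc 1 3 = {1, 2, 3} from rfl]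
    simp [chiFour_eq]
    norm_num
  rcases le_or_gt 3 N with h | h
  · have := abs_le.1 (abs_chiFourPartial_sub_le h)
    rw [h3] at this
    norm_num at this
    linarith [this.1]
  · interval_cases N
    · rw [chiFourPartial]; simp [chiFour_eq]; norm_num
    · rw [chiFourPartial, show Icc 1 2 = {1, 2} from rfl]; simp [chiFour_eq]; norm_num

theorem abs_sum_chiFour_mul_log_div_le (N : ℕ) :
    |∑ n ∈ Icc 1 N, chiFour n * Real.log n / n| ≤ 2 := by
  -- `log n / n` decreases only beyond `e`, hence the maximum with `3`; the character vanishes at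
  -- `2`, so only `n = 1` needs a correction.
  have hanti : Antitone fun n : ℕ => Real.log (max n 3 : ℕ) / (max n 3 : ℕ) := by
    intro a b hab
    have he : ∀ c : ℕ, Real.exp 1 ≤ ((max c 3 : ℕ) : ℝ) := by
      intro c
      have h1 : (3 : ℝ) ≤ ((max c 3 : ℕ) : ℝ) := by exact_mod_cast le_max_right c 3
      have := Real.exp_one_lt_d9
      linarith
    exact Real.log_div_self_antitoneOn (he a) (he b) (by exact_mod_cast max_le_max_right 3 hab)
  have h1 := abs_sum_mul_le_of_antitone (t := chiFour) (M := 1) N hanti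
    (fun n => div_nonneg (Real.log_natCast_nonneg _) (Nat.cast_nonneg _)) (fun X _ => by
      rw [sum_chiFour]; split_ifs <;> simp)
  have hlog3 : Real.log 3 / 3 ≤ 1 := by
    have := Real.log_le_sub_one_of_pos (x := 3) (by norm_num)
    linarith
  have hlog30 : 0 ≤ Real.log 3 / 3 := div_nonneg (Real.log_nonneg (by norm_num)) (by norm_num)
  have h2 : |∑ n ∈ Icc 1 N, chiFour n * Real.log n / n -
      ∑ n ∈ Icc 1 N, Real.log (max n 3 : ℕ) / (max n 3 : ℕ) * chiFour n| ≤ 1 := by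
    rw [← sum_sub_distrib]
    refine (abs_sum_le_sum_abs _ _).trans ?_
    have h3 : ∀ n ∈ Icc 1 N, |chiFour n * Real.log n / n -
        Real.log (max n 3 : ℕ) / (max n 3 : ℕ) * chiFour n| ≤ if n = 1 then 1 else 0 := by
      intro n hn
      have hn1 := (mem_Icc.1 hn).1
      rcases le_or_gt 3 n with h | h
      · rw [max_eq_left h, if_neg (by omega)]
        refine le_of_eq (abs_eq_zero.2 ?_)
        ring
      · interval_cases n
        · simp [chiFour_eq, abs_of_nonneg hlog30, hlog3]
        · simp [chiFour_eq]
    refine (sum_le_sum h3).trans ?_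
    rw [sum_ite_eq']
    split_ifs <;> simp
  have h4 := h1.trans (by simpa using hlog3)
  rw [abs_le] at *
  constructor <;> linarith [h4.1, h4.2, h2.1, h2.2]

/-- Mertens' argument: `∑ χ(n) log n / n` is bounded and equals the sum of `χ(d) Λ(d) / d` times the
partial sum of `L(1, χ₄)` at `N / d`. Replacing the latter by the partial sum at `N` costs at most
`ψ(N) / N`, and that partial sum can be divided out because it is at least `5 / 12`. -/
theorem exists_abs_sum_chiFour_mul_vonMangoldt_div_le :
    ∃ B : ℝ, 0 ≤ B ∧ ∀ N : ℕ, 1 ≤ N → |∑ d ∈ Icc 1 N, chiFour d * Λ d / d| ≤ B := by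
  have hc : 0 ≤ Real.log 4 := Real.log_nonneg (by norm_num)
  refine ⟨12 / 5 * (2 + (Real.log 4 + 4)), by positivity, fun N hN => ?_⟩
  have hN0 : (0 : ℝ) < N := by exact_mod_cast hN
  have h1 : ∑ n ∈ Icc 1 N, chiFour n * Real.log n / n =
      ∑ d ∈ Icc 1 N, chiFour d * Λ d / d * chiFourPartial (N / d) := by
    have h2 : ∀ n ∈ Icc 1 N, chiFour n * Real.log n / n = ∑ p ∈ n.divisorsAntidiagonal,
        chiFour p.1 * Λ p.1 / p.1 * (chiFour p.2 / p.2) := by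
      intro n _
      rw [← sum_divisorsAntidiagonal_vonMangoldt, mul_sum, sum_div]
      refine sum_congr rfl fun p hp => ?_
      rw [← (Nat.mem_divisorsAntidiagonal.1 hp).1, chiFour_mul, Nat.cast_mul]
      ring
    rw [sum_congr rfl h2, sum_Icc_sum_divisorsAntidiagonal_eq_sum_div N fun d m =>
      chiFour d * Λ d / d * (chiFour m / m)]
    refine sum_congr rfl fun d _ => ?_
    rw [chiFourPartial, mul_sum]
  have h2 : |chiFourPartial N * ∑ d ∈ Icc 1 N, chiFour d * Λ d / d -
      ∑ n ∈ Icc 1 N, chiFour n * Real.log n / n| ≤ Real.log 4 + 4 := by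
    rw [h1, mul_sum, ← sum_sub_distrib]
    have h3 : ∀ d ∈ Icc 1 N, |chiFourPartial N * (chiFour d * Λ d / d) -
        chiFour d * Λ d / d * chiFourPartial (N / d)| ≤ Λ d / N := by
      intro d hd
      rw [mem_Icc] at hd
      have hd0 : (0 : ℝ) < d := by exact_mod_cast hd.1
      have h4 := abs_chiFourPartial_sub_le (Nat.div_le_self N d)
      have h5 : (1 : ℝ) / ((N / d : ℕ) + 1) ≤ d / N := by
        rw [div_le_div_iff₀ (by positivity) hN0]
        have := Nat.lt_mul_div_succ N hd.1
        exact_mod_cast (by linarith : 1 * N ≤ d * (N / d + 1))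
      rw [show chiFourPartial N * (chiFour d * Λ d / d) - chiFour d * Λ d / d *
        chiFourPartial (N / d) = chiFour d * (Λ d / d *
          (chiFourPartial N - chiFourPartial (N / d))) by ring, abs_mul, abs_mul,
          abs_of_nonneg (a := Λ d / d) (div_nonneg vonMangoldt_nonneg hd0.le)]
      calc _ ≤ 1 * (Λ d / d * (d / N)) := by
            refine mul_le_mul (abs_chiFour_le d) ?_ (by
              have := vonMangoldt_nonneg (n := d); positivity) zero_le_one
            exact mul_le_mul_of_nonneg_left (h4.trans h5)
              (div_nonneg vonMangoldt_nonneg hd0.le)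
        _ = Λ d / N := by field_simp
    refine (abs_sum_le_sum_abs _ _).trans ((sum_le_sum h3).trans ?_)
    rw [← sum_div, sum_vonMangoldt_eq_psi, div_le_iff₀ hN0]
    exact Chebyshev.psi_le_const_mul_self hN0.le
  have h3 := abs_sum_chiFour_mul_log_div_le N
  have h4 := chiFourPartial_ge hN
  have h5 : |chiFourPartial N * ∑ d ∈ Icc 1 N, chiFour d * Λ d / d| ≤ 2 + (Real.log 4 + 4) := by
    rw [abs_le] at *
    constructor <;> linarith [h2.1, h2.2, h3.1, h3.2]
  rw [abs_mul, abs_of_nonneg (by linarith : 0 ≤ chiFourPartial N)] at h5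
  have h6 := mul_le_mul_of_nonneg_right h4 (abs_nonneg (∑ d ∈ Icc 1 N, chiFour d * Λ d / d))
  linarith

end GaussianSpin

/-! ### Mertens' theorem modulo four and a lower bound for the number of Fermat primes -/

namespace GaussianSpin

open Finset ArithmeticFunction

theorem sum_even_vonMangoldt_div_le (N : ℕ) :
    ∑ n ∈ (Icc 1 N).filter (fun n => n % 2 = 0), Λ n / n ≤ 2 := by
  have h1 : ∀ n ∈ (Icc 1 N).filter (fun n => n % 2 = 0), Λ n / n ≤
      ∑ k ∈ range (N + 1), if n = 2 ^ k then (1 / 2 : ℝ) ^ k else 0 := by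
    intro n hn
    rw [mem_filter, mem_Icc] at hn
    have hnn : ∀ k ∈ range (N + 1), 0 ≤ if n = 2 ^ k then (1 / 2 : ℝ) ^ k else 0 := by
      intro k _; split_ifs <;> positivity
    by_cases hp : IsPrimePow n
    · obtain ⟨p, k, hp, hk, rfl⟩ := hp
      rw [← Nat.prime_iff] at hp
      have hp2 : p = 2 := by
        have : 2 ∣ p := Nat.prime_two.dvd_of_dvd_pow (Nat.dvd_of_mod_eq_zero hn.2)
        exact ((Nat.prime_dvd_prime_iff_eq Nat.prime_two hp).1 this).symm
      subst hp2
      have hkN : k ∈ range (N + 1) := by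
        rw [mem_range]
        have : k < 2 ^ k := Nat.lt_two_pow_self
        omega
      refine le_trans ?_ (single_le_sum hnn hkN)
      rw [if_pos rfl, vonMangoldt_apply_pow hk.ne', vonMangoldt_apply_prime Nat.prime_two]
      have : Real.log 2 ≤ 1 := by have := Real.log_two_lt_d9; linarith
      push_cast
      rw [div_pow, one_pow]
      gcongr
    · rw [vonMangoldt_eq_zero_iff.2 hp, zero_div]
      exact sum_nonneg hnn
  refine (sum_le_sum h1).trans ?_
  rw [sum_comm]
  calc _ ≤ ∑ k ∈ range (N + 1), (1 / 2 : ℝ) ^ k := by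
        refine sum_le_sum fun k _ => ?_
        rw [sum_ite_eq']
        split_ifs
        · exact le_rfl
        · positivity
    _ ≤ 2 := by
        rw [geom_sum_eq (by norm_num)]
        have : (0 : ℝ) < (1 / 2) ^ (N + 1) := by positivity
        have h2 : (((1 / 2 : ℝ) ^ (N + 1)) - 1) / (1 / 2 - 1) = 2 - 2 * (1 / 2) ^ (N + 1) := by ring
        linarith

/-- Mertens' theorem in the residue class one modulo four. -/
theorem exists_abs_sum_vonMangoldt_div_sub_le :
    ∃ D : ℝ, 0 ≤ D ∧ ∀ N : ℕ, 1 ≤ N →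
      |∑ n ∈ (Icc 1 N).filter (fun n => n % 4 = 1), Λ n / n - Real.log N / 2| ≤ D := by
  obtain ⟨B, hB0, hB⟩ := exists_abs_sum_chiFour_mul_vonMangoldt_div_le
  have hc : 0 ≤ Real.log 4 := Real.log_nonneg (by norm_num)
  refine ⟨B + (Real.log 4 + 4), by positivity, fun N hN => ?_⟩
  -- Twice the indicator of the class `1` is `1`, minus the indicator of even numbers, plus the
  -- character.
  have h1 : 2 * ∑ n ∈ (Icc 1 N).filter (fun n => n % 4 = 1), Λ n / n =
      ∑ n ∈ Icc 1 N, Λ n / n - ∑ n ∈ (Icc 1 N).filter (fun n => n % 2 = 0), Λ n / n +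
        ∑ n ∈ Icc 1 N, chiFour n * Λ n / n := by
    rw [sum_filter, sum_filter, ← sum_sub_distrib, ← sum_add_distrib, mul_sum]
    refine sum_congr rfl fun n _ => ?_
    rw [chiFour_eq]
    split_ifs <;> first | omega | ring
  have h2 := abs_le.1 (hB N hN)
  have h3 := log_sub_one_le_sum_vonMangoldt_div hN
  have h4 := sum_vonMangoldt_div_le hN
  have h5 := sum_even_vonMangoldt_div_le N
  have h6 : 0 ≤ ∑ n ∈ (Icc 1 N).filter (fun n => n % 2 = 0), Λ n / n :=
    sum_nonneg fun n _ => div_nonneg vonMangoldt_nonneg (Nat.cast_nonneg n)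
  rw [abs_le]
  constructor <;> linarith [h2.1, h2.2]

/-- Compare Mertens' theorem at `N` and at `M = ⌊N ^ (99 / 100)⌋`: the main terms differ by at least
`log N / 200`, which eventually exceeds `1 + 2 D`. So `Λ(n) / n` has sum at least `1` over the class
between `M` and `N`, where `1 / n ≤ 1 / (M + 1)`. -/
theorem eventually_rpow_le_sum_vonMangoldt :
    ∀ᶠ N : ℕ in Filter.atTop, (N : ℝ) ^ (99 / 100 : ℝ) ≤
      ∑ n ∈ (Icc 1 N).filter (fun n => n % 4 = 1), Λ n := by
  obtain ⟨D, hD0, hD⟩ := exists_abs_sum_vonMangoldt_div_sub_le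
  have hlog : ∀ᶠ N : ℕ in Filter.atTop, 200 * (1 + 2 * D) ≤ Real.log N :=
    (Real.tendsto_log_atTop.comp tendsto_natCast_atTop_atTop).eventually_ge_atTop _
  filter_upwards [hlog, Filter.eventually_ge_atTop 1] with N hN hN1
  have hN1' : (1 : ℝ) ≤ N := by exact_mod_cast hN1
  have hN0 : (0 : ℝ) < N := by linarith
  set M := ⌊(N : ℝ) ^ (99 / 100 : ℝ)⌋₊ with hM
  have hMle : (M : ℝ) ≤ (N : ℝ) ^ (99 / 100 : ℝ) := Nat.floor_le (by positivity)
  have hMlt : (N : ℝ) ^ (99 / 100 : ℝ) < M + 1 := Nat.lt_floor_add_one _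
  have hM1 : 1 ≤ M := Nat.le_floor (by simpa using Real.one_le_rpow hN1' (by norm_num))
  have hM0 : (0 : ℝ) < M := by exact_mod_cast hM1
  have hMN : M ≤ N := by
    have : (M : ℝ) ≤ N := hMle.trans (Real.rpow_le_self_of_one_le hN1' (by norm_num))
    exact_mod_cast this
  have hlogM : Real.log M ≤ 99 / 100 * Real.log N := by
    rw [← Real.log_rpow hN0]
    exact Real.log_le_log hM0 hMle
  have h1 := abs_le.1 (hD N hN1)
  have h2 := abs_le.1 (hD M hM1)
  have h3 : (Icc 1 N).filter (fun n => n % 4 = 1) = (Icc 1 M).filter (fun n => n % 4 = 1) ∪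
      (Ioc M N).filter (fun n => n % 4 = 1) := by
    ext n; simp only [mem_union, mem_filter, mem_Icc, mem_Ioc]; omega
  have h4 : Disjoint ((Icc 1 M).filter (fun n => n % 4 = 1))
      ((Ioc M N).filter (fun n => n % 4 = 1)) := by
    rw [Finset.disjoint_left]
    intro n hn hn'
    simp only [mem_filter, mem_Icc, mem_Ioc] at hn hn'
    omega
  have h5 : 1 ≤ ∑ n ∈ (Ioc M N).filter (fun n => n % 4 = 1), Λ n / n := by
    rw [h3, sum_union h4] at h1
    linarith [h1.1, h2.2]
  have h6 : ∑ n ∈ (Ioc M N).filter (fun n => n % 4 = 1), Λ n / n ≤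
      (∑ n ∈ (Ioc M N).filter (fun n => n % 4 = 1), Λ n) / (M + 1) := by
    rw [sum_div]
    refine sum_le_sum fun n hn => ?_
    rw [mem_filter, mem_Ioc] at hn
    have : (M : ℝ) + 1 ≤ n := by exact_mod_cast hn.1.1
    have := vonMangoldt_nonneg (n := n)
    gcongr
  have h7 : (M : ℝ) + 1 ≤ ∑ n ∈ (Ioc M N).filter (fun n => n % 4 = 1), Λ n := by
    have := h5.trans h6
    rwa [le_div_iff₀ (by positivity), one_mul] at this
  rw [h3, sum_union h4]
  have h8 : 0 ≤ ∑ n ∈ (Icc 1 M).filter (fun n => n % 4 = 1), Λ n :=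
    sum_nonneg fun n _ => vonMangoldt_nonneg
  linarith

theorem isFermatPrime_of_mod_four {p : ℕ} (hp : p.Prime) (h : p % 4 = 1) : IsFermatPrime p := by
  have : Fact p.Prime := ⟨hp⟩
  obtain ⟨a, b, hab⟩ := Nat.Prime.sq_add_sq (p := p) (by omega)
  refine ⟨hp, a, b, Nat.pos_of_ne_zero ?_, Nat.pos_of_ne_zero ?_, hab⟩
  · rintro rfl
    refine hp.prime.not_isSquare ⟨b, ?_⟩
    rw [← hab]; ring
  · rintro rfl
    refine hp.prime.not_isSquare ⟨a, ?_⟩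
    rw [← hab]; ring

/-- Any exponent above `1 - 27 / 2000 = 0.9865` would serve. Prime powers cost `O(√N)` and the
weight `log N` at most `N ^ (1 / 1000)` up to a constant, so the `99 / 100` of the weighted sum
leaves room. -/
theorem exists_eventually_rpow_le_fermatPrimeCount :
    ∃ c : ℝ, 0 < c ∧ ∀ᶠ x : ℝ in Filter.atTop,
      c * x ^ (988 / 1000 : ℝ) ≤ fermatPrimeCount x := by
  classical
  obtain ⟨C, hC⟩ := Chebyshev.psi_sub_theta_le_mul_sqrt
  obtain ⟨K, hK1, hK⟩ := exists_log_add_one_le (η := 1 / 1000) (by norm_num)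
  have hcount : ∀ᶠ N : ℕ in Filter.atTop, (N : ℝ) ^ (989 / 1000 : ℝ) ≤
      2 * K * ((Icc 1 N).filter fun p => IsFermatPrime p).card := by
    have hbig : ∀ᶠ N : ℕ in Filter.atTop, 2 * |C| ≤ (N : ℝ) ^ (49 / 100 : ℝ) :=
      ((tendsto_rpow_atTop (by norm_num)).comp tendsto_natCast_atTop_atTop).eventually_ge_atTop _
    filter_upwards [hbig, eventually_rpow_le_sum_vonMangoldt, Filter.eventually_ge_atTop 1]
      with N hN hsum hN1
    have hN1' : (1 : ℝ) ≤ N := by exact_mod_cast hN1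
    have hN0 : (0 : ℝ) < N := by linarith
    obtain ⟨k, hk⟩ : ∃ k : ℕ, k = ((Icc 1 N).filter fun p => IsFermatPrime p).card := ⟨_, rfl⟩
    rw [← hk]
    have h1 : ∑ n ∈ (Icc 1 N).filter (fun n => n % 4 = 1), Λ n ≤
        ∑ n ∈ (Icc 1 N).filter (fun n => IsFermatPrime n), Real.log N +
        ∑ n ∈ (Icc 1 N).filter (fun n => ¬ n.Prime), Λ n := by
      rw [sum_filter, sum_filter, sum_filter, ← sum_add_distrib]
      refine sum_le_sum fun n hn => ?_
      have hlog : Λ n ≤ Real.log N :=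
        vonMangoldt_le_log.trans (monotone_log_natCast (mem_Icc.1 hn).2)
      have h0 := vonMangoldt_nonneg (n := n)
      by_cases hp : n.Prime
      · by_cases h4 : n % 4 = 1
        · rw [if_pos h4, if_pos (isFermatPrime_of_mod_four hp h4), if_neg (not_not.2 hp)]
          linarith
        · rw [if_neg h4, if_neg (not_not.2 hp)]
          split_ifs <;> linarith
      · rw [if_pos hp, if_neg fun h : IsFermatPrime n => hp h.1]
        split_ifs <;> linarith
    have h2 : ∑ n ∈ (Icc 1 N).filter (fun n => ¬ n.Prime), Λ n ≤ |C| * (N : ℝ) ^ (1 / 2 : ℝ) := by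
      have h3 : ∑ n ∈ (Icc 1 N).filter (fun n => ¬ n.Prime), Λ n =
          Chebyshev.psi N - Chebyshev.theta N := by
        rw [Chebyshev.psi_sub_theta_eq_sum_not_prime, Nat.floor_natCast]
        rfl
      rw [h3, ← Real.sqrt_eq_rpow]
      exact (hC N).trans (mul_le_mul_of_nonneg_right (le_abs_self _) (Real.sqrt_nonneg _))
    rw [sum_const, nsmul_eq_mul, ← hk] at h1
    have h3 : |C| * (N : ℝ) ^ (1 / 2 : ℝ) ≤ (N : ℝ) ^ (99 / 100 : ℝ) / 2 := by
      have h4 : (N : ℝ) ^ (99 / 100 : ℝ) = (N : ℝ) ^ (49 / 100 : ℝ) * (N : ℝ) ^ (1 / 2 : ℝ) := by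
        rw [← Real.rpow_add hN0]; norm_num
      rw [h4]
      have := mul_le_mul_of_nonneg_right hN (by positivity : 0 ≤ (N : ℝ) ^ (1 / 2 : ℝ))
      linarith
    have hk0 : (0 : ℝ) ≤ k := Nat.cast_nonneg _
    have h4 : k * Real.log N ≤ k * (K * (N : ℝ) ^ (1 / 1000 : ℝ)) :=
      mul_le_mul_of_nonneg_left (by have := hK N hN1; linarith) hk0
    have h5 : (N : ℝ) ^ (99 / 100 : ℝ) =
        (N : ℝ) ^ (989 / 1000 : ℝ) * (N : ℝ) ^ (1 / 1000 : ℝ) := by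
      rw [← Real.rpow_add hN0]; norm_num
    have h6 : (N : ℝ) ^ (989 / 1000 : ℝ) * (N : ℝ) ^ (1 / 1000 : ℝ) ≤
        2 * K * k * (N : ℝ) ^ (1 / 1000 : ℝ) := by
      rw [← h5]; linarith
    exact le_of_mul_le_mul_right h6 (by positivity)
  refine ⟨(2 * (2 * K))⁻¹, by positivity, ?_⟩
  have hfloor : Filter.Tendsto (fun x : ℝ => ⌊x⌋₊) Filter.atTop Filter.atTop :=
    tendsto_nat_floor_atTop
  filter_upwards [hfloor.eventually hcount, Filter.eventually_ge_atTop 2] with x hx hx2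
  have hx1 : (1 : ℝ) ≤ x := by linarith
  have h1 : x / 2 ≤ (⌊x⌋₊ : ℝ) := by
    have := Nat.lt_floor_add_one x
    linarith
  rw [inv_mul_le_iff₀ (by positivity)]
  have h2 : x ^ (988 / 1000 : ℝ) ≤ 2 * (⌊x⌋₊ : ℝ) ^ (989 / 1000 : ℝ) := by
    calc x ^ (988 / 1000 : ℝ) ≤ x ^ (989 / 1000 : ℝ) :=
          Real.rpow_le_rpow_of_exponent_le hx1 (by norm_num)
      _ = 2 ^ (989 / 1000 : ℝ) * (x / 2) ^ (989 / 1000 : ℝ) := by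
          rw [← Real.mul_rpow (by norm_num) (by positivity)]; congr 1; ring
      _ ≤ 2 * (⌊x⌋₊ : ℝ) ^ (989 / 1000 : ℝ) := by
          gcongr
          exact Real.rpow_le_self_of_one_le (by norm_num) (by norm_num)
  refine h2.trans ?_
  rw [mul_assoc]
  exact mul_le_mul_of_nonneg_left hx (by norm_num)

end GaussianSpin

/-! ### Equidistribution -/

namespace GaussianSpin

open Finset

/-- The representation of a prime as a sum of two squares with odd first term is unique. -/
theorem eq_of_sq_add_sq_eq_prime {p r s r' s' : ℤ} (hp : Prime p) (hr : 0 < r) (hs : 0 < s)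
    (hr' : 0 < r') (hs' : 0 < s') (hodd : r % 2 = 1) (hodd' : r' % 2 = 1)
    (h : r ^ 2 + s ^ 2 = p) (h' : r' ^ 2 + s' ^ 2 = p) : r = r' ∧ s = s' := by
  have hp0 : 0 < p := by rw [← h]; positivity
  have hdvd : p ∣ (r * s' + r' * s) * (r * s' - r' * s) :=
    ⟨s' ^ 2 - s ^ 2, by linear_combination s' ^ 2 * h - s ^ 2 * h'⟩
  rcases hp.dvd_or_dvd hdvd with hd | hd
  -- By the identity for products of two squares, `p ∣ r s' + r' s` forces `r r' = s s'`. Then `s`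
  -- is odd like `r r'`, so `p = 2`.
  · have h1 : (r * r' - s * s') ^ 2 + (r * s' + r' * s) ^ 2 = p ^ 2 := by
      linear_combination (r' ^ 2 + s' ^ 2) * h + p * h'
    have h2 : p ≤ r * s' + r' * s := Int.le_of_dvd (by positivity) hd
    have h3 : r * r' - s * s' = 0 := by nlinarith [sq_nonneg (r * r' - s * s')]
    have hsodd : s % 2 = 1 := by
      by_contra hs2
      have h4 : 2 ∣ s := by omega
      have h5 : 2 ∣ r * r' := by
        rw [show r * r' = s * s' by linarith]
        exact h4.mul_right s'
      rcases Int.prime_two.dvd_or_dvd h5 with h6 | h6 <;> omega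
    have hp2 : p = 2 := by
      obtain ⟨a, ha⟩ : ∃ a, r = 2 * a + 1 := ⟨r / 2, by omega⟩
      obtain ⟨b, hb⟩ : ∃ b, s = 2 * b + 1 := ⟨s / 2, by omega⟩
      have h5 : (2 : ℤ) ∣ p := ⟨2 * a ^ 2 + 2 * a + 2 * b ^ 2 + 2 * b + 1, by
        rw [← h, ha, hb]; ring⟩
      have h6 := (Int.prime_two.associated_of_dvd hp h5)
      have := Int.natAbs_eq_iff_associated.2 h6
      omega
    rw [hp2] at h h'
    refine ⟨?_, ?_⟩ <;> nlinarith
  · have h1 : (r * r' + s * s') ^ 2 + (r * s' - r' * s) ^ 2 = p ^ 2 := by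
      linear_combination (r' ^ 2 + s' ^ 2) * h + p * h'
    have hpos : 0 < r * r' + s * s' := by positivity
    have h2 : (r * s' - r' * s) = 0 := by
      refine Int.eq_zero_of_abs_lt_dvd hd ?_
      refine abs_lt_of_sq_lt_sq ?_ hp0.le
      nlinarith
    have h3 : r * r' + s * s' = p := by
      rw [h2] at h1
      nlinarith
    have h4 : p * (r - r') = 0 := by linear_combination r' * h - r * h3 + s * h2
    have h5 : p * (s - s') = 0 := by linear_combination s' * h - s * h3 - r * h2
    have h6 := (mul_eq_zero.1 h4).resolve_left hp0.ne'
    have h7 := (mul_eq_zero.1 h5).resolve_left hp0.ne'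
    constructor <;> linarith

theorem isOddSumOfSquares_unique {p r s r' s' : ℕ} (hp : p.Prime) (h : IsOddSumOfSquares p r s)
    (h' : IsOddSumOfSquares p r' s') : r = r' ∧ s = s' := by
  obtain ⟨h1, h2, h3, h4⟩ := h
  obtain ⟨h1', h2', h3', h4'⟩ := h'
  rw [Nat.odd_iff] at h3 h3'
  have := eq_of_sq_add_sq_eq_prime (Nat.prime_iff_prime_int.1 hp) (r := r) (s := s) (r' := r')
    (s' := s') (by omega) (by omega) (by omega) (by omega) (by omega) (by omega)
    (by exact_mod_cast h4) (by exact_mod_cast h4')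
  omega

theorem exists_isOddSumOfSquares {p : ℕ} (hp : IsFermatPrime p) :
    ∃ r s, IsOddSumOfSquares p r s := by
  obtain ⟨hp, r, s, hr, hs, h⟩ := hp
  by_cases hr2 : Odd r
  · exact ⟨r, s, hr, hs, hr2, h⟩
  by_cases hs2 : Odd s
  · exact ⟨s, r, hs, hr, hs2, by rw [← h, add_comm]⟩
  exfalso
  rw [Nat.not_odd_iff_even] at hr2 hs2
  obtain ⟨a, rfl⟩ := hr2
  obtain ⟨b, rfl⟩ := hs2
  have h1 : p = 2 * (2 * (a ^ 2 + b ^ 2)) := by rw [← h]; ring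
  have ha : 0 < a := by omega
  have h2 : 0 < a ^ 2 := by positivity
  exact Nat.not_prime_mul (by norm_num) (by omega) (h1 ▸ hp)

/-- A common prime factor `q` of `r` and `s` would make `q²` divide the prime `p`. -/
theorem jacobiSym_eq_one_or_neg_one {p r s : ℕ} (hp : p.Prime) (h : IsOddSumOfSquares p r s) :
    jacobiSym (s : ℤ) r = 1 ∨ jacobiSym (s : ℤ) r = -1 := by
  refine jacobiSym.eq_one_or_neg_one ?_
  obtain ⟨hr, hs, -, h⟩ := h
  rw [Int.gcd_natCast_natCast]
  by_contra hg
  obtain ⟨q, hq, hqg⟩ := Nat.exists_prime_and_dvd hg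
  obtain ⟨a, ha⟩ := hqg.trans (Nat.gcd_dvd_left s r)
  obtain ⟨b, hb⟩ := hqg.trans (Nat.gcd_dvd_right s r)
  have h1 : p = q * (q * (a ^ 2 + b ^ 2)) := by rw [← h, ha, hb]; ring
  have ha0 : 0 < a := Nat.pos_of_ne_zero (by rintro rfl; omega)
  refine Nat.not_prime_mul hq.one_lt.ne' ?_ (h1 ▸ hp)
  have h2 : 0 < a ^ 2 := by positivity
  have h3 := hq.two_le
  nlinarith [Nat.zero_le (b ^ 2)]

theorem mem_spinPairs_iff {x : ℝ} (hx : 0 ≤ x) {rs : ℕ × ℕ} :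
    rs ∈ spinPairs x ↔ (rs.1 ^ 2 + rs.2 ^ 2).Prime ∧ rs.1 ^ 2 + rs.2 ^ 2 ≤ ⌊x⌋₊ ∧
      IsOddSumOfSquares (rs.1 ^ 2 + rs.2 ^ 2) rs.1 rs.2 := by
  rw [mem_spinPairs hx]
  unfold IsOddSumOfSquares
  tauto

theorem injOn_sq_add_sq_spinPairs {x : ℝ} (hx : 0 ≤ x) :
    Set.InjOn (fun rs : ℕ × ℕ => rs.1 ^ 2 + rs.2 ^ 2) (spinPairs x) := by
  intro a ha b hb hab
  rw [mem_coe, mem_spinPairs_iff hx] at ha hb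
  dsimp only at hab
  have := isOddSumOfSquares_unique ha.1 ha.2.2 (hab ▸ hb.2.2)
  exact Prod.ext this.1 this.2

theorem spinCount_eq {x : ℝ} (hx : 0 ≤ x) (ε : ℤ) :
    spinCount ε x = ((spinPairs x).filter fun rs => jacobiSym (rs.2 : ℤ) rs.1 = ε).card := by
  classical
  rw [spinCount, ← card_image_of_injOn (f := fun rs : ℕ × ℕ => rs.1 ^ 2 + rs.2 ^ 2)
    ((injOn_sq_add_sq_spinPairs hx).mono fun rs h => (mem_filter.1 h).1)]
  congr 1
  ext p
  simp only [mem_filter, mem_Icc, mem_image, mem_spinPairs_iff hx]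
  constructor
  · rintro ⟨⟨-, h1⟩, hp, r, s, h, hJ⟩
    obtain rfl := h.2.2.2
    exact ⟨(r, s), ⟨⟨hp, h1, h⟩, hJ⟩, rfl⟩
  · rintro ⟨rs, ⟨⟨hp, h1, h⟩, hJ⟩, rfl⟩
    exact ⟨⟨hp.one_lt.le, h1⟩, hp, rs.1, rs.2, h, hJ⟩

theorem fermatPrimeCount_eq {x : ℝ} (hx : 0 ≤ x) : fermatPrimeCount x = (spinPairs x).card := by
  classical
  rw [fermatPrimeCount, ← card_image_of_injOn (injOn_sq_add_sq_spinPairs hx)]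
  congr 1
  ext p
  simp only [mem_filter, mem_Icc, mem_image, mem_spinPairs_iff hx]
  constructor
  · rintro ⟨⟨-, h1⟩, hp⟩
    obtain ⟨r, s, h⟩ := exists_isOddSumOfSquares hp
    obtain rfl := h.2.2.2
    exact ⟨(r, s), ⟨hp.1, h1, h⟩, rfl⟩
  · rintro ⟨rs, ⟨hp, h1, h⟩, rfl⟩
    exact ⟨⟨hp.one_lt.le, h1⟩, hp, rs.1, rs.2, h.1, h.2.1, rfl⟩

/-- Every symbol in the sum is `1` or `-1`, so the indicator of the value `ε` is `(1 + ε (s / r)) /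
2`. Equidistribution is thus equivalent to the sum of the spins being of smaller order than the
number of primes. -/
theorem spinCount_eq_half_add {x : ℝ} (hx : 0 ≤ x) {ε : ℤ} (hε : ε = 1 ∨ ε = -1) :
    (spinCount ε x : ℝ) = fermatPrimeCount x / 2 + ε * (spinSum x / 2) := by
  have h1 : ∀ rs ∈ spinPairs x, (if jacobiSym (rs.2 : ℤ) rs.1 = ε then (1 : ℝ) else 0) =
      1 / 2 + ε * ((jacobiSym (rs.2 : ℤ) rs.1 : ℤ) / 2) := by
    intro rs hrs
    rw [mem_spinPairs_iff hx] at hrs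
    rcases jacobiSym_eq_one_or_neg_one hrs.1 hrs.2.2 with h | h <;> rcases hε with rfl | rfl <;>
      rw [h] <;> norm_num
  rw [spinCount_eq hx, card_filter, Nat.cast_sum]
  push_cast
  rw [sum_congr rfl h1, sum_add_distrib, sum_const, nsmul_eq_mul, fermatPrimeCount_eq hx, spinSum,
    Int.cast_sum, sum_div, mul_sum]
  ring

theorem tendsto_spinSum_div :
    Filter.Tendsto (fun x : ℝ => (spinSum x : ℝ) / fermatPrimeCount x) Filter.atTop (nhds 0) := by
  obtain ⟨C, hC1, hC⟩ := exists_abs_spinSum_le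
  obtain ⟨c, hc0, hc⟩ := exists_eventually_rpow_le_fermatPrimeCount
  have hlim : Filter.Tendsto (fun x : ℝ => C / c * x ^ (-(3 / 2000) : ℝ)) Filter.atTop
      (nhds 0) := by
    simpa using (tendsto_rpow_neg_atTop (y := 3 / 2000) (by norm_num)).const_mul (C / c)
  refine squeeze_zero_norm' ?_ hlim
  filter_upwards [hc, Filter.eventually_ge_atTop 1] with x hx hx1
  have hx0 : 0 < x := by linarith
  have hden : 0 < c * x ^ (988 / 1000 : ℝ) := by positivity
  rw [Real.norm_eq_abs, abs_div, Nat.abs_cast]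
  calc |(spinSum x : ℝ)| / fermatPrimeCount x
      ≤ C * x ^ (1 - 27 / 2000 : ℝ) / (c * x ^ (988 / 1000 : ℝ)) :=
        div_le_div₀ (by positivity) (hC x hx1) hden hx
    _ = C / c * x ^ (-(3 / 2000) : ℝ) := by
        rw [mul_div_mul_comm, ← Real.rpow_sub hx0]
        norm_num

theorem tendsto_spinCount_div {ε : ℤ} (hε : ε = 1 ∨ ε = -1) :
    Filter.Tendsto (fun x : ℝ => (spinCount ε x : ℝ) / fermatPrimeCount x) Filter.atTop
      (nhds (1 / 2)) := by
  obtain ⟨c, hc0, hc⟩ := exists_eventually_rpow_le_fermatPrimeCount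
  have h1 : Filter.Tendsto
      (fun x : ℝ => 1 / 2 + (ε : ℝ) / 2 * ((spinSum x : ℝ) / fermatPrimeCount x))
      Filter.atTop (nhds (1 / 2)) := by
    have := (tendsto_spinSum_div.const_mul ((ε : ℝ) / 2)).const_add (1 / 2)
    rwa [mul_zero, add_zero] at this
  refine h1.congr' ?_
  filter_upwards [hc, Filter.eventually_ge_atTop 1] with x hx hx1
  have hpos : (0 : ℝ) < fermatPrimeCount x := lt_of_lt_of_le (by positivity) hx
  rw [spinCount_eq_half_add (by linarith) hε]
  field_simp

end GaussianSpin

theorem theorem2 :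
    -- every such prime has exactly one representation, and its spin is `1` or `-1`
    (∀ p : ℕ, IsFermatPrime p →
      (∃! rs : ℕ × ℕ, IsOddSumOfSquares p rs.1 rs.2) ∧ (HasSpin p 1 ∨ HasSpin p (-1))) ∧
    -- the bound for the sum of the spins, with an absolute constant
    (∃ C : ℕ, ∀ x : ℝ, 1 ≤ x → |(spinSum x : ℝ)| ≤ (C : ℝ) * x ^ (76 / 77 : ℝ)) ∧
    -- equidistribution of the positive and the negative spins
    Filter.Tendsto (fun x : ℝ => (spinCount 1 x : ℝ) / (fermatPrimeCount x : ℝ))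
      Filter.atTop (nhds (1 / 2)) ∧
    Filter.Tendsto (fun x : ℝ => (spinCount (-1) x : ℝ) / (fermatPrimeCount x : ℝ))
      Filter.atTop (nhds (1 / 2)) := by
  refine ⟨fun p hp => ?_, ?_, GaussianSpin.tendsto_spinCount_div (Or.inl rfl),
    GaussianSpin.tendsto_spinCount_div (Or.inr rfl)⟩
  · obtain ⟨r, s, h⟩ := GaussianSpin.exists_isOddSumOfSquares hp
    refine ⟨⟨(r, s), h, fun rs hrs => ?_⟩, ?_⟩
    · have := GaussianSpin.isOddSumOfSquares_unique hp.1 hrs h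
      exact Prod.ext this.1 this.2
    · exact (GaussianSpin.jacobiSym_eq_one_or_neg_one hp.1 h).imp (fun hJ => ⟨hp.1, r, s, h, hJ⟩)
        fun hJ => ⟨hp.1, r, s, h, hJ⟩
  · obtain ⟨C, hC1, hC⟩ := GaussianSpin.exists_abs_spinSum_le
    refine ⟨⌈C⌉₊, fun x hx => (hC x hx).trans ?_⟩
    -- The proved exponent `1 - 27 / 2000 = 0.9865` is smaller than `76 / 77 = 0.98701…`.
    refine mul_le_mul (Nat.le_ceil C) (Real.rpow_le_rpow_of_exponent_le hx (by norm_num))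
      (by positivity) (Nat.cast_nonneg _)
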